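/- Let $M$ be a smooth real $n$-dimensional (Hausdorff) manifold, $\pi:TM\to M$ its tangent bundle and $TM\setminus\{0\}$ the slashed tangent bundle. In induced coordinates $(x^i,y^i)$ let $\mathbb{C}=y^i\,\partial/\partial y^i$ be the Liouville vector field and $J=\frac{\partial}{\partial y^i}\otimes dx^i$ the tangent structure. A *spray* is a smooth vector field $S$ on $TM\setminus\{0\}$ with $JS=\mathbb{C}$ and $[\mathbb{C},S]=S$; its horizontal projector is $h=\frac12(\mathrm{Id}-\mathcal{L}_SJ)$, where $(\mathcal L_SJ)(X)=[S,JX]-J[S,X]$. A *geodesic* of $S$ is a smooth curve $c$ in $M$, defined on an open interval, with $c'$ nowhere zero and $S\circ c'=c''$. Two sprays are *projectively equivalent* if their geodesics coincide up to orientation preserving reparametrization (every geodesic of either one becomes a geodesic of the other after such a reparametrization). For a vector valued $1$-form $L$ on $TM\setminus\{0\}$, a function $f$ and a $1$-form $\theta$, put $d_Lf=df\circ L$ and $d_L\theta=i_Ld\theta-d(i_L\theta)$, where $i_L\theta=\theta\circ L$ and $(i_L\omega)(X,Y)=\omega(LX,Y)+\omega(X,LY)$ for a $2$-form $\omega$.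 A *Finsler function* is a continuous function $F:TM\to\mathbb{R}$ that is smooth and positive on $TM\setminus\{0\}$, vanishes on the zero section, satisfies $F(x,\lambda y)=\lambda F(x,y)$ for all $\lambda>0$, and whose metric tensor $g_{ij}=\frac12\,\partial^2F^2/\partial y^i\partial y^j$ has rank $n$ at every point of $TM\setminus\{0\}$. Its *geodesic spray* is the spray $S_F$ with $i_{S_F}dd_JF^2=-dF^2$ on $TM\setminus\{0\}$. A spray is *projectively metrizable* if it is projectively equivalent to the geodesic spray of some Finsler function. A $1$-form on $TM\setminus\{0\}$ is *semi-basic* if it vanishes on vertical vectors, i.e. on $\ker d\pi$. **Theorem.** A spray $S$ on $M$ is projectively metrizable if and only if there exists a smooth semi-basic $1$-form $\theta$ on $TM\setminus\{0\}$ such that, everywhere on $TM\setminus\{0\}$, $$\operatorname{rank}(d\theta)=2n-2,\qquad i_S\theta>0,\qquad \mathcal{L}_{\mathbb{C}}\theta=0,\qquad d_J\theta=0,\qquad d_h\theta=0.$$ Moreover, for every such $\theta$, the function $F=i_S\theta$ on $TM\setminus\{0\}$, extended by $0$ to the zero section, is a Finsler function whose geodesic spray is projectively equivalent to $S$, and $\theta=d_JF$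 on $TM\setminus\{0\}$. -/

import Mathlib

open Set Bundle VectorField
open scoped Manifold ContDiff

noncomputable section

/-! ### Tensor calculus on a manifold

`N` is a manifold modelled on `(E, H)` through `I`. A vector field, a `1`-form, and a vector valued
`1`-form are dependent functions `X u : T_u N`, `θ u : T_u N →L[ℝ] ℝ`, `L u : T_u N →L[ℝ] T_u N`.
The differential operators are local: their value at `u` depends only on the germs at `u`, and it
has its usual meaning when these germs are smooth. -/

section TensorCalculus

variable {E : Type*} [NormedAddCommGroup E] [NormedSpace ℝ E] {H : Type*} [TopologicalSpace H]
  (I : ModelWithCorners ℝ E H) {N : Type*} [TopologicalSpace N] [ChartedSpace H N]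

/-- The differential at `u` of the chart around `p`. -/
def chartDiff (p u : N) : TangentSpace I u →L[ℝ] E :=
  mfderiv I 𝓘(ℝ, E) (extChartAt I p) u

/-- The differential at `z` of the inverse of the chart around `p`. -/
def chartInvDiff (p : N) (z : E) : E →L[ℝ] TangentSpace I ((extChartAt I p).symm z) :=
  mfderivWithin 𝓘(ℝ, E) I (extChartAt I p).symm (range I) z

/-- The coordinate expression of a vector field in the chart around `p`. -/
def vectorFieldInChart (X : ∀ u : N, TangentSpace I u) (p : N) (z : E) : E :=
  chartDiff I p ((extChartAt I p).symm z) (X ((extChartAt I p).symm z))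

/-- The coordinate expression of a `1`-form in the chart around `p`. -/
def oneFormInChart (θ : ∀ u : N, TangentSpace I u →L[ℝ] ℝ) (p : N) (z : E) : E →L[ℝ] ℝ :=
  (θ ((extChartAt I p).symm z)).comp (chartInvDiff I p z)

/-- The coordinate expression of a vector valued `1`-form in the chart around `p`. -/
def endoInChart (L : ∀ u : N, TangentSpace I u →L[ℝ] TangentSpace I u) (p : N) (z : E) :
    E →L[ℝ] E :=
  (chartDiff I p ((extChartAt I p).symm z)).comp
    ((L ((extChartAt I p).symm z)).comp (chartInvDiff I p z))

/-- The exterior derivative `dθ` of a `1`-form, as a bilinear form on each tangent space. In the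
chart around `u` it is `dθ(ξ, η) = ∂_ξ θ (η) - ∂_η θ (ξ)`. -/
def extDerivOneForm (θ : ∀ u : N, TangentSpace I u →L[ℝ] ℝ) (u : N) :
    TangentSpace I u →L[ℝ] TangentSpace I u →L[ℝ] ℝ :=
  let D : E →L[ℝ] E →L[ℝ] ℝ :=
    fderivWithin ℝ (oneFormInChart I θ u) (range I) (extChartAt I u u)
  ((chartDiff I u u).precomp ℝ).comp ((D - D.flip).comp (chartDiff I u u))

/-- The Lie derivative of a `1`-form along a vector field, `ℒ_X θ = i_X dθ + d (i_X θ)`. -/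
def lieDerivOneForm (X : ∀ u : N, TangentSpace I u) (θ : ∀ u : N, TangentSpace I u →L[ℝ] ℝ)
    (u : N) : TangentSpace I u →L[ℝ] ℝ :=
  extDerivOneForm I θ u (X u) + mvfderiv I (fun w ↦ θ w (X w)) u

/-- The derivation `d_L f = df ∘ L` on functions defined by a vector valued `1`-form `L`. -/
def derivAlongFun (L : ∀ u : N, TangentSpace I u →L[ℝ] TangentSpace I u) (f : N → ℝ)
    (u : N) : TangentSpace I u →L[ℝ] ℝ :=
  (mvfderiv I f u).comp (L u)

/-- The derivation `d_L θ = i_L dθ - d (i_L θ)` on `1`-forms defined by a vector valued `1`-form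
`L`, where `i_L θ = θ ∘ L` and `(i_L ω)(ξ, η) = ω(L ξ, η) + ω(ξ, L η)` for a `2`-form `ω`. -/
def derivAlongOneForm (L : ∀ u : N, TangentSpace I u →L[ℝ] TangentSpace I u)
    (θ : ∀ u : N, TangentSpace I u →L[ℝ] ℝ) (u : N) (ξ η : TangentSpace I u) : ℝ :=
  extDerivOneForm I θ u (L u ξ) η + extDerivOneForm I θ u ξ (L u η)
    - extDerivOneForm I (fun w ↦ (θ w).comp (L w)) u ξ η

/-- The Lie derivative of a vector valued `1`-form along a vector field,
`(ℒ_X L)(Y) = [X, L Y] - L [X, Y]`. In the chart around `u` this is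
`ℒ_X L = ∂_X L - DX ∘ L + L ∘ DX`. -/
def lieDerivEndo (X : ∀ u : N, TangentSpace I u)
    (L : ∀ u : N, TangentSpace I u →L[ℝ] TangentSpace I u) (u : N) :
    TangentSpace I u →L[ℝ] TangentSpace I u :=
  let z := extChartAt I u u
  let DX : E →L[ℝ] E := fderivWithin ℝ (vectorFieldInChart I X u) (range I) z
  let DL : E →L[ℝ] E →L[ℝ] E := fderivWithin ℝ (endoInChart I L u) (range I) z
  let A : E →L[ℝ] E := endoInChart I L u z
  let B : E →L[ℝ] E := DL (chartDiff I u u (X u)) - DX.comp A + A.comp DX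
  (chartDiff I u u).inverse.comp (B.comp (chartDiff I u u))

variable [IsManifold I 1 N]

/-- Smoothness of a vector field on a set. -/
def SmoothVectorFieldOn (X : ∀ u : N, TangentSpace I u) (s : Set N) : Prop :=
  ContMDiffOn I I.tangent ∞ (fun u ↦ (⟨u, X u⟩ : TangentBundle I N)) s

/-- Smoothness of a `1`-form on a set, as a section of the cotangent bundle. -/
def SmoothOneFormOn (θ : ∀ u : N, TangentSpace I u →L[ℝ] ℝ) (s : Set N) : Prop :=
  ContMDiffOn I (I.prod 𝓘(ℝ, E →L[ℝ] ℝ)) ∞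
    (fun u ↦ TotalSpace.mk' (E →L[ℝ] ℝ)
      (E := fun u : N ↦ TangentSpace I u →L[ℝ] Bundle.Trivial N ℝ u) u (θ u)) s

end TensorCalculus

/-! ### The geometry of the tangent bundle

All objects live on the slashed tangent bundle `TM ∖ {0}`, an open subset of `TM`. They are
represented by functions on `TM` whose values on the zero section are irrelevant. -/

section Sprays

variable {E : Type*} [NormedAddCommGroup E] [NormedSpace ℝ E] {H : Type*} [TopologicalSpace H]
  (I : ModelWithCorners ℝ E H) (M : Type*) [TopologicalSpace M] [ChartedSpace H M]
  [IsManifold I ∞ M]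

/-- The slashed tangent bundle `TM ∖ {0}`. -/
def slashedTangentBundle : Set (TangentBundle I M) := {u | u.2 ≠ 0}

variable {M}

/-- The differential of the bundle projection `π : TM → M`. -/
def projDiff (u : TangentBundle I M) : TangentSpace I.tangent u →L[ℝ] TangentSpace I u.1 :=
  mfderiv I.tangent I (fun w : TangentBundle I M ↦ w.1) u

/-- The vertical lift `T_x M → T_u TM` at `u = (x, y)`: the differential at `y` of the inclusion
of the fibre `T_x M` in `TM`. -/
def verticalLift (u : TangentBundle I M) : TangentSpace I u.1 →L[ℝ] TangentSpace I.tangent u :=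
  mfderiv 𝓘(ℝ, E) I.tangent (fun w : E ↦ (⟨u.1, w⟩ : TangentBundle I M)) u.2

/-- The Liouville vector field `ℂ = yⁱ ∂/∂yⁱ`. -/
def liouville (u : TangentBundle I M) : TangentSpace I.tangent u :=
  verticalLift I u u.2

/-- The tangent structure (vertical endomorphism) `J = ∂/∂yⁱ ⊗ dxⁱ`. -/
def tangentStructure (u : TangentBundle I M) :
    TangentSpace I.tangent u →L[ℝ] TangentSpace I.tangent u :=
  (verticalLift I u).comp (projDiff I u)

/-- A spray: a smooth vector field `S` on `TM ∖ {0}` with `J S = ℂ` and `[ℂ, S] = S`. -/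
structure IsSpray (S : ∀ u : TangentBundle I M, TangentSpace I.tangent u) : Prop where
  smooth : SmoothVectorFieldOn I.tangent S (slashedTangentBundle I M)
  tangentStructure_apply : ∀ u ∈ slashedTangentBundle I M, tangentStructure I u (S u) = liouville I u
  homogeneous : ∀ u ∈ slashedTangentBundle I M, mlieBracket I.tangent (liouville I) S u = S u

/-- The horizontal projector `h = (Id - ℒ_S J) / 2` of a spray `S`. -/
def horizontalProjector (S : ∀ u : TangentBundle I M, TangentSpace I.tangent u)
    (u : TangentBundle I M) : TangentSpace I.tangent u →L[ℝ] TangentSpace I.tangent u :=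
  (1 / 2 : ℝ) • (ContinuousLinearMap.id ℝ (TangentSpace I.tangent u)
    - lieDerivEndo I.tangent S (tangentStructure I) u)

/-- A `1`-form on `TM ∖ {0}` is semi-basic if it vanishes on vertical vectors. -/
def IsSemiBasic (θ : ∀ u : TangentBundle I M, TangentSpace I.tangent u →L[ℝ] ℝ) : Prop :=
  ∀ u ∈ slashedTangentBundle I M, ∀ ξ : TangentSpace I.tangent u, projDiff I u ξ = 0 → θ u ξ = 0

/-! ### Geodesics and projective equivalence -/

/-- The tangent lift `c'` of a curve `c`. -/
def tangentLift (c : ℝ → M) (t : ℝ) : TangentBundle I M :=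
  ⟨c t, mfderiv 𝓘(ℝ, ℝ) I c t (1 : ℝ)⟩

/-- A non-empty open interval of the real line, possibly unbounded. -/
def IsOpenInterval (s : Set ℝ) : Prop := IsOpen s ∧ s.OrdConnected ∧ s.Nonempty

/-- `c` is a geodesic of `S` on the open interval `s`: a smooth regular curve with `S ∘ c' = c''`.
Values of `c` outside `s` are irrelevant. -/
structure IsGeodesicOn (S : ∀ u : TangentBundle I M, TangentSpace I.tangent u) (c : ℝ → M)
    (s : Set ℝ) : Prop where
  isOpenInterval : IsOpenInterval s
  smooth : ContMDiffOn 𝓘(ℝ, ℝ) I ∞ c s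
  regular : ∀ t ∈ s, tangentLift I c t ∈ slashedTangentBundle I M
  eq : ∀ t ∈ s, mfderiv 𝓘(ℝ, ℝ) I.tangent (tangentLift I c) t (1 : ℝ) = S (tangentLift I c t)

/-- `φ` is an orientation preserving diffeomorphism of the open interval `s'` onto the open
interval `s`. -/
structure IsOrientedReparam (φ : ℝ → ℝ) (s' s : Set ℝ) : Prop where
  isOpenInterval : IsOpenInterval s'
  bijOn : BijOn φ s' s
  smooth : ContDiffOn ℝ ∞ φ s'
  deriv_pos : ∀ t ∈ s', 0 < deriv φ t

/-- Every geodesic of `S₁` becomes a geodesic of `S₂` after an orientation preserving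
reparametrization. -/
def GeodesicsReparamTo (S₁ S₂ : ∀ u : TangentBundle I M, TangentSpace I.tangent u) : Prop :=
  ∀ (c : ℝ → M) (s : Set ℝ), IsGeodesicOn I S₁ c s →
    ∃ (φ : ℝ → ℝ) (s' : Set ℝ), IsOrientedReparam φ s' s ∧ IsGeodesicOn I S₂ (c ∘ φ) s'

/-- Two sprays are projectively equivalent if their geodesics coincide up to an orientation
preserving reparametrization. -/
def ProjectivelyEquivalent (S₁ S₂ : ∀ u : TangentBundle I M, TangentSpace I.tangent u) : Prop :=
  GeodesicsReparamTo I S₁ S₂ ∧ GeodesicsReparamTo I S₂ S₁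

/-! ### Finsler functions and projective metrizability -/

/-- The metric tensor `g_{ij} = (1/2) ∂²F²/∂yⁱ∂yʲ` at `u = (x, y)`: half the second derivative at
`y` of the restriction of `F²` to the fibre `T_x M`. -/
def metricTensor (F : TangentBundle I M → ℝ) (u : TangentBundle I M) : E →L[ℝ] E →L[ℝ] ℝ :=
  (1 / 2 : ℝ) • fderiv ℝ (fderiv ℝ (fun w : E ↦ F ⟨u.1, w⟩ ^ 2)) u.2

/-- Finsler functions. -/
structure IsFinsler (F : TangentBundle I M → ℝ) : Prop where
  continuous : Continuous F
  smooth : ContMDiffOn I.tangent 𝓘(ℝ, ℝ) ∞ F (slashedTangentBundle I M)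
  pos : ∀ u ∈ slashedTangentBundle I M, 0 < F u
  zero : ∀ x : M, F ⟨x, 0⟩ = 0
  homogeneous : ∀ (u : TangentBundle I M) (l : ℝ), 0 < l → F ⟨u.1, l • u.2⟩ = l * F u
  regular : ∀ u ∈ slashedTangentBundle I M,
    Module.finrank ℝ (LinearMap.range (metricTensor I F u).toLinearMap) = Module.finrank ℝ E

/-- `S` is the geodesic spray of `F`: the spray with `i_S d d_J F² = -dF²` on `TM ∖ {0}`. -/
structure IsGeodesicSpray (F : TangentBundle I M → ℝ)
    (S : ∀ u : TangentBundle I M, TangentSpace I.tangent u) : Prop where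
  isSpray : IsSpray I S
  eq : ∀ u ∈ slashedTangentBundle I M,
    extDerivOneForm I.tangent
      (derivAlongFun I.tangent (tangentStructure I) (fun w ↦ F w ^ 2)) u (S u)
      = -mvfderiv I.tangent (fun w ↦ F w ^ 2) u

/-- The spray `S` is projectively equivalent to the geodesic spray of `F`. -/
def IsProjectivelyMetrizedBy (S : ∀ u : TangentBundle I M, TangentSpace I.tangent u)
    (F : TangentBundle I M → ℝ) : Prop :=
  ∃ SF : ∀ u : TangentBundle I M, TangentSpace I.tangent u,
    IsGeodesicSpray I F SF ∧ ProjectivelyEquivalent I S SF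

/-- `S` is projectively equivalent to the geodesic spray of some Finsler function. -/
def IsProjectivelyMetrizable (S : ∀ u : TangentBundle I M, TangentSpace I.tangent u) : Prop :=
  ∃ F : TangentBundle I M → ℝ, IsFinsler I F ∧ IsProjectivelyMetrizedBy I S F

/-- The conditions on a semi-basic `1`-form `θ` on `TM ∖ {0}`: `rank dθ = 2n - 2` where
`n = dim M`, `i_S θ > 0`, `ℒ_ℂ θ = 0`, `d_J θ = 0` and `d_h θ = 0`. -/
structure ProjectiveMetrizabilityConditions
    (S : ∀ u : TangentBundle I M, TangentSpace I.tangent u)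
    (θ : ∀ u : TangentBundle I M, TangentSpace I.tangent u →L[ℝ] ℝ) : Prop where
  smooth : SmoothOneFormOn I.tangent θ (slashedTangentBundle I M)
  semiBasic : IsSemiBasic I θ
  rank : ∀ u ∈ slashedTangentBundle I M,
    Module.finrank ℝ (LinearMap.range (extDerivOneForm I.tangent θ u).toLinearMap) + 2
      = 2 * Module.finrank ℝ E
  pos : ∀ u ∈ slashedTangentBundle I M, 0 < θ u (S u)
  lieDeriv : ∀ u ∈ slashedTangentBundle I M, lieDerivOneForm I.tangent (liouville I) θ u = 0
  dJ : ∀ u ∈ slashedTangentBundle I M, ∀ ξ η : TangentSpace I.tangent u,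
    derivAlongOneForm I.tangent (tangentStructure I) θ u ξ η = 0
  dh : ∀ u ∈ slashedTangentBundle I M, ∀ ξ η : TangentSpace I.tangent u,
    derivAlongOneForm I.tangent (horizontalProjector I S) θ u ξ η = 0

end Sprays

end

/-! Let F be positively homogeneous of degree one and positive off the zero section. Euler's
relation gives i_ℂ dd_JF = 0 and, for every X with JX = ℂ, the identity i_X dd_JF² + dF² = 2 (X(F)
d_JF + F i_X dd_JF). Evaluated on X itself, it shows that i_X dd_JF² = -dF² amounts to i_X dd_JF = 0
together with X(F) = 0 (`IsSmoothHomogeneous.geodesicSpray_equation_iff`). The first of these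
equations does not change when a multiple of ℂ is added to X. Projectively equivalent sprays differ
at each point by a multiple of ℂ, and sprays that differ by aℂ with a smooth are projectively
equivalent (`exists_eq_add_liouville_of_geodesicsReparamTo`,
`geodesicsReparamTo_of_eq_add_liouville`). Hence projective metrizability by F comes down to i_S
dd_JF = 0, and θ is d_JF.

From θ to F: for a semi-basic θ = θ_i dxⁱ, the condition ℒ_ℂθ = 0 says that the θ_i have degree zero
in y, and d_Jθ = 0 that ∂θ_i/∂yʲ is symmetric. So F = θ_i yⁱ satisfies ∂F/∂yʲ = θ_j + yⁱ ∂θ_j/∂yⁱ =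
θ_j, that is θ = d_JF. Since hS = S, inserting S in d_hθ = 0 gives i_S dθ = 0 on horizontal vectors,
and the two other conditions give it on vertical ones. The kernel of dθ contains the independent
vectors S and ℂ, and it is no larger exactly when the metric tensor is nondegenerate
(`IsSmoothHomogeneous.rank_iff`). The geodesic spray is then S - (S(F)/F) ℂ.

From F to θ: all conditions on d_JF except d_hθ = 0 follow from Euler's relation, symmetry of second
derivatives, the rank equivalence and i_S dd_JF = 0. The remaining one says that horizontal spaces
are isotropic for dd_JF. It comes from differentiating i_S dd_JF = 0 along the fibre and using the
symmetry of the third derivative of F (`fderiv_fderiv_horizontal_symm`). -/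

noncomputable section

/-! ### Tensor operations in a chart of an arbitrary boundaryless manifold -/

section GeneralCharts

variable {E : Type*} [NormedAddCommGroup E] [NormedSpace ℝ E] {H : Type*} [TopologicalSpace H]
  {I : ModelWithCorners ℝ E H} {N : Type*} [TopologicalSpace N] [ChartedSpace H N]
  [IsManifold I 1 N]

/-- The tangent space at u is the model space E, identified through the preferred chart at u. This
is what makes ascriptions such as `(ξ : E)` meaningful as coordinates throughout. -/
lemma chartDiff_self_apply (u : N) (ξ : TangentSpace I u) : chartDiff I u u ξ = ξ := by
  have h := mfderiv_extChartAt_self (I := I) (x := u)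
  exact congrArg (fun L : TangentSpace I u →L[ℝ] E ↦ L ξ) h

lemma chartDiff_chartInvDiff {p : N} {z : E} (hz : z ∈ (extChartAt I p).target) (ζ : E) :
    chartDiff I p ((extChartAt I p).symm z) (chartInvDiff I p z ζ) = ζ :=
  congrArg (fun L : E →L[ℝ] E ↦ L ζ)
    (mfderiv_extChartAt_comp_mfderivWithin_extChartAt_symm (I := I) hz)

lemma chartInvDiff_chartDiff {p : N} {z : E} (hz : z ∈ (extChartAt I p).target)
    (ξ : TangentSpace I ((extChartAt I p).symm z)) :
    chartInvDiff I p z (chartDiff I p ((extChartAt I p).symm z) ξ) = ξ :=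
  congrArg (fun L : TangentSpace I ((extChartAt I p).symm z) →L[ℝ]
      TangentSpace I ((extChartAt I p).symm z) ↦ L ξ)
    (mfderivWithin_extChartAt_symm_comp_mfderiv_extChartAt (I := I) hz)

lemma chartInvDiff_self_apply (u : N) (ζ : E) :
    chartInvDiff I u (extChartAt I u u) ζ = (ζ : E) := by
  have h := mfderivWithin_range_extChartAt_symm (I := I) (x := u)
  exact congrArg (fun L : E →L[ℝ] E ↦ L ζ) h

variable [I.Boundaryless]

lemma extDerivOneForm_apply (θ : ∀ u : N, TangentSpace I u →L[ℝ] ℝ) (u : N)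
    (ξ η : TangentSpace I u) :
    extDerivOneForm I θ u ξ η =
      fderiv ℝ (oneFormInChart I θ u) (extChartAt I u u) (ξ : E) (η : E) -
        fderiv ℝ (oneFormInChart I θ u) (extChartAt I u u) (η : E) (ξ : E) := by
  have h1 := chartDiff_self_apply (I := I) u ξ
  have h2 := chartDiff_self_apply (I := I) u η
  simp only [extDerivOneForm, I.range_eq_univ, fderivWithin_univ]
  change fderiv ℝ (oneFormInChart I θ u) (extChartAt I u u) (chartDiff I u u ξ) (chartDiff I u u η)
    - fderiv ℝ (oneFormInChart I θ u) (extChartAt I u u) (chartDiff I u u η) (chartDiff I u u ξ) = _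
  rw [h1, h2]

omit [IsManifold I 1 N] in
lemma mvfderiv_apply_eq_fderiv {f : N → ℝ} {u : N} (hf : MDifferentiableAt I 𝓘(ℝ, ℝ) f u)
    (ξ : TangentSpace I u) :
    mvfderiv I f u ξ = fderiv ℝ (f ∘ (extChartAt I u).symm) (extChartAt I u u) (ξ : E) := by
  change mfderiv I 𝓘(ℝ, ℝ) f u ξ = _
  rw [hf.mfderiv, I.range_eq_univ, fderivWithin_univ]
  rfl

lemma lieDerivEndo_apply (X : ∀ u : N, TangentSpace I u)
    (L : ∀ u : N, TangentSpace I u →L[ℝ] TangentSpace I u) (u : N) (ξ : TangentSpace I u) :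
    lieDerivEndo I X L u ξ =
      ((fderiv ℝ (endoInChart I L u) (extChartAt I u u) (X u : E) (ξ : E)
        - fderiv ℝ (vectorFieldInChart I X u) (extChartAt I u u)
            (endoInChart I L u (extChartAt I u u) (ξ : E))
        + endoInChart I L u (extChartAt I u u)
            (fderiv ℝ (vectorFieldInChart I X u) (extChartAt I u u) (ξ : E)) : E)) := by
  have h1 := chartDiff_self_apply (I := I) u ξ
  have h2 := chartDiff_self_apply (I := I) u (X u)
  have h3 : (chartDiff I u u).inverse = (ContinuousLinearMap.id ℝ E : E →L[ℝ] TangentSpace I u) := by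
    have h := mfderiv_extChartAt_self (I := I) (x := u)
    have h' : (chartDiff I u u) = (ContinuousLinearMap.id ℝ E : TangentSpace I u →L[ℝ] E) := h
    rw [h']
    exact ContinuousLinearMap.inverse_id
  simp only [lieDerivEndo, I.range_eq_univ, fderivWithin_univ, h3]
  change (fderiv ℝ (endoInChart I L u) (extChartAt I u u) (chartDiff I u u (X u))
        (chartDiff I u u ξ)
        - fderiv ℝ (vectorFieldInChart I X u) (extChartAt I u u)
            (endoInChart I L u (extChartAt I u u) (chartDiff I u u ξ))
        + endoInChart I L u (extChartAt I u u)
            (fderiv ℝ (vectorFieldInChart I X u) (extChartAt I u u) (chartDiff I u u ξ)) : E) = _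
  rw [h1, h2]

omit [I.Boundaryless] in
lemma vectorFieldInChart_self (X : ∀ u : N, TangentSpace I u) (u : N) :
    vectorFieldInChart I X u (extChartAt I u u) = (X u : E) := by
  have h : (extChartAt I u).symm (extChartAt I u u) = u := extChartAt_to_inv u
  rw [vectorFieldInChart, h]
  exact chartDiff_self_apply u (X u)

omit [I.Boundaryless] in
lemma mpullbackWithin_extChartAt_symm_apply (X : ∀ u : N, TangentSpace I u) {p : N} {z : E}
    (hz : z ∈ (extChartAt I p).target) :
    (mpullbackWithin 𝓘(ℝ, E) I (extChartAt I p).symm X (range I) z : E) =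
      vectorFieldInChart I X p z := by
  have h : (mfderivWithin 𝓘(ℝ, E) I (extChartAt I p).symm (range I) z).inverse
      = mfderiv I 𝓘(ℝ, E) (extChartAt I p) ((extChartAt I p).symm z) :=
    ContinuousLinearMap.inverse_eq
      (mfderivWithin_extChartAt_symm_comp_mfderiv_extChartAt hz)
      (mfderiv_extChartAt_comp_mfderivWithin_extChartAt_symm hz)
  rw [mpullbackWithin_apply, h]
  rfl

/-- The bracket is defined by pulling back along the inverse chart. Near the centre this pullback is
the coordinate expression, and the bracket depends only on germs. -/
lemma mlieBracket_eq_lieBracket (X Y : ∀ u : N, TangentSpace I u) (u : N) :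
    mlieBracket I X Y u =
      (lieBracket ℝ (vectorFieldInChart I X u) (vectorFieldInChart I Y u) (extChartAt I u u) : E) := by
  have h3 : (mfderiv I 𝓘(ℝ, E) (extChartAt I u) u).inverse =
      (ContinuousLinearMap.id ℝ E : E →L[ℝ] TangentSpace I u) := by
    rw [mfderiv_extChartAt_self (I := I) (x := u)]
    exact ContinuousLinearMap.inverse_id
  have key : ∀ Z : ∀ u : N, TangentSpace I u,
      (mpullbackWithin 𝓘(ℝ, E) I (extChartAt I u).symm Z (range I) : E → E)
        =ᶠ[nhds (extChartAt I u u)] vectorFieldInChart I Z u := fun Z ↦ by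
    filter_upwards [extChartAt_target_mem_nhds (I := I) u] with z hz
    exact mpullbackWithin_extChartAt_symm_apply Z hz
  have h := Filter.EventuallyEq.lieBracket_vectorField_eq (𝕜 := ℝ) (key X) (key Y)
  rw [mlieBracket, mlieBracketWithin]
  change (mfderiv I 𝓘(ℝ, E) (extChartAt I u) u).inverse _ = _
  rw [h3, preimage_univ, univ_inter]
  simp only [I.range_eq_univ] at h ⊢
  exact (congrFun (lieBracketWithin_univ (𝕜 := ℝ) (E := E)) (extChartAt I u u)).trans h

/-- The trivialization of the tangent bundle at u acts on fibres by the differential of the chart at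
u, so it reads the section as its coordinate expression. -/
lemma smoothVectorField_contDiffAt_iff [IsManifold I ∞ N] (X : ∀ u : N, TangentSpace I u) (u : N) :
    ContMDiffAt I I.tangent ∞ (fun u ↦ (⟨u, X u⟩ : TangentBundle I N)) u ↔
      ContDiffAt ℝ ∞ (vectorFieldInChart I X u) (extChartAt I u u) := by
  have hev : (fun w ↦ (trivializationAt E (TangentSpace I) u (⟨w, X w⟩ : TangentBundle I N)).2)
      =ᶠ[nhds u] fun w ↦ (chartDiff I u w (X w) : E) := by
    filter_upwards [chart_source_mem_nhds H u] with w hw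
    rw [chartDiff, ← TangentBundle.continuousLinearMapAt_trivializationAt hw]
    rw [Bundle.Trivialization.continuousLinearMapAt_apply, Bundle.Trivialization.linearMapAt_apply]
    exact (if_pos (show w ∈ (trivializationAt E (TangentSpace I) u).baseSet from hw)).symm
  have h0 : (fun w : N ↦ (chartDiff I u w (X w) : E)) ∘ (extChartAt I u).symm =
      vectorFieldInChart I X u := rfl
  rw [contMDiffAt_section, hev.contMDiffAt_iff, contMDiffAt_iff, I.range_eq_univ,
    contDiffWithinAt_univ]
  simp only [extChartAt_model_space_eq_id, PartialEquiv.refl_coe, Function.id_comp, h0]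
  -- Smoothness on the manifold also asks for continuity there; it is recovered by composing the
  -- coordinate expression with the chart.
  refine ⟨fun h ↦ h.2, fun h ↦ ⟨?_, h⟩⟩
  have h2 : ContinuousAt (vectorFieldInChart I X u ∘ extChartAt I u) u :=
    h.continuousAt.comp (continuousAt_extChartAt u)
  refine h2.congr ?_
  filter_upwards [extChartAt_source_mem_nhds (I := I) u] with w hw
  simp only [Function.comp, vectorFieldInChart]
  rw [(extChartAt I u).left_inv hw]

lemma smoothOneForm_contDiffAt_iff [IsManifold I ∞ N] (θ : ∀ u : N, TangentSpace I u →L[ℝ] ℝ)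
    (u : N) :
    ContMDiffAt I (I.prod 𝓘(ℝ, E →L[ℝ] ℝ)) ∞
    (fun u ↦ TotalSpace.mk' (E →L[ℝ] ℝ)
      (E := fun u : N ↦ TangentSpace I u →L[ℝ] Bundle.Trivial N ℝ u) u (θ u)) u ↔
      ContDiffAt ℝ ∞ (oneFormInChart I θ u) (extChartAt I u u) := by
  have hev : (fun w ↦ ContinuousLinearMap.inCoordinates E (TangentSpace I) ℝ (Bundle.Trivial N ℝ)
      u w u w (θ w)) ∘ (extChartAt I u).symm =ᶠ[nhds (extChartAt I u u)] oneFormInChart I θ u := by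
    filter_upwards [extChartAt_target_mem_nhds (I := I) u] with z hz
    have hw : (extChartAt I u).symm z ∈ (chartAt H u).source := by
      rw [← extChartAt_source I]; exact (extChartAt I u).map_target hz
    simp only [Function.comp, ContinuousLinearMap.inCoordinates, oneFormInChart, chartInvDiff]
    rw [TangentBundle.symmL_trivializationAt hw, (extChartAt I u).right_inv hz]
    ext v
    simp
  rw [contMDiffAt_hom_bundle, contMDiffAt_iff, contMDiffAt_iff, I.range_eq_univ,
    contDiffWithinAt_univ, contDiffWithinAt_univ]
  simp only [extChartAt_model_space_eq_id, PartialEquiv.refl_coe, Function.id_comp]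
  have hc : ContDiffAt ℝ ∞ ((fun w ↦ ContinuousLinearMap.inCoordinates E (TangentSpace I) ℝ
      (Bundle.Trivial N ℝ) u w u w (θ w)) ∘ (extChartAt I u).symm) (extChartAt I u u) ↔
      ContDiffAt ℝ ∞ (oneFormInChart I θ u) (extChartAt I u u) :=
    ⟨fun h ↦ h.congr_of_eventuallyEq hev.symm, fun h ↦ h.congr_of_eventuallyEq hev⟩
  rw [hc]
  refine ⟨fun h ↦ h.2.2, fun h ↦ ⟨⟨continuousAt_id, ?_⟩, ?_, h⟩⟩
  · have h1 := (contMDiffAt_iff.1 (contMDiffAt_id (I := I) (n := ∞) (x := u))).2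
    rwa [I.range_eq_univ, contDiffWithinAt_univ] at h1
  have h2 : ContinuousAt (oneFormInChart I θ u ∘ extChartAt I u) u :=
    h.continuousAt.comp (continuousAt_extChartAt u)
  refine h2.congr ?_
  have := (continuousAt_extChartAt (I := I) u).eventually hev
  filter_upwards [this, extChartAt_source_mem_nhds (I := I) u] with w hw hw'
  simp only [Function.comp] at hw ⊢
  rw [← hw, (extChartAt I u).left_inv hw']

end GeneralCharts

/-! ### Natural charts of the tangent bundle -/

section TangentCharts

variable {E : Type*} [NormedAddCommGroup E] [NormedSpace ℝ E]
  {M : Type*} [TopologicalSpace M] [ChartedSpace E M] [IsManifold 𝓘(ℝ, E) ∞ M]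

lemma mem_extChartAt_tangent_source {p w : TangentBundle 𝓘(ℝ, E) M} :
    w ∈ (extChartAt 𝓘(ℝ, E).tangent p).source ↔ w.1 ∈ (extChartAt 𝓘(ℝ, E) p.1).source := by
  rw [extChartAt_source, extChartAt_source, TangentBundle.mem_chart_source_iff]

lemma mem_extChartAt_tangent_target {p : TangentBundle 𝓘(ℝ, E) M} {z : E × E} :
    z ∈ (extChartAt 𝓘(ℝ, E).tangent p).target ↔ z.1 ∈ (extChartAt 𝓘(ℝ, E) p.1).target := by
  rw [FiberBundle.extChartAt_target]
  simp only [mem_prod, mem_inter_iff, mem_univ, and_true, mem_preimage,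
    TangentBundle.trivializationAt_baseSet]
  refine ⟨fun h ↦ h.1, fun h ↦ ⟨h, ?_⟩⟩
  rw [← extChartAt_source 𝓘(ℝ, E)]
  exact (extChartAt 𝓘(ℝ, E) p.1).map_target h

lemma extChartAt_tangent_apply {p w : TangentBundle 𝓘(ℝ, E) M}
    (hw : w.1 ∈ (extChartAt 𝓘(ℝ, E) p.1).source) :
    extChartAt 𝓘(ℝ, E).tangent p w =
      (extChartAt 𝓘(ℝ, E) p.1 w.1, chartDiff 𝓘(ℝ, E) p.1 w.1 w.2) := by
  rw [extChartAt_source] at hw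
  rw [FiberBundle.extChartAt, chartDiff, ← TangentBundle.continuousLinearMapAt_trivializationAt hw,
    Bundle.Trivialization.continuousLinearMapAt_apply_of_mem (R := ℝ)
      (trivializationAt E (TangentSpace 𝓘(ℝ, E)) p.1) (b := w.1) hw]
  rfl

lemma extChartAt_tangent_symm_apply {p : TangentBundle 𝓘(ℝ, E) M} {z : E × E}
    (hz : z.1 ∈ (extChartAt 𝓘(ℝ, E) p.1).target) :
    (extChartAt 𝓘(ℝ, E).tangent p).symm z =
      ⟨(extChartAt 𝓘(ℝ, E) p.1).symm z.1, chartInvDiff 𝓘(ℝ, E) p.1 z.1 z.2⟩ := by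
  have hs : (⟨(extChartAt 𝓘(ℝ, E) p.1).symm z.1, chartInvDiff 𝓘(ℝ, E) p.1 z.1 z.2⟩ :
      TangentBundle 𝓘(ℝ, E) M) ∈ (extChartAt 𝓘(ℝ, E).tangent p).source :=
    mem_extChartAt_tangent_source.2 ((extChartAt 𝓘(ℝ, E) p.1).map_target hz)
  have h := extChartAt_tangent_apply (p := p)
    (w := ⟨(extChartAt 𝓘(ℝ, E) p.1).symm z.1, chartInvDiff 𝓘(ℝ, E) p.1 z.1 z.2⟩)
    ((extChartAt 𝓘(ℝ, E) p.1).map_target hz)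
  have h2 : chartDiff 𝓘(ℝ, E) p.1 ((extChartAt 𝓘(ℝ, E) p.1).symm z.1)
      (chartInvDiff 𝓘(ℝ, E) p.1 z.1 z.2) = z.2 := chartDiff_chartInvDiff hz z.2
  have h1 : extChartAt 𝓘(ℝ, E) p.1 ((extChartAt 𝓘(ℝ, E) p.1).symm z.1) = z.1 :=
    (extChartAt 𝓘(ℝ, E) p.1).right_inv hz
  have h3 := (extChartAt 𝓘(ℝ, E).tangent p).left_inv hs
  rw [h] at h3
  have h4 : (extChartAt 𝓘(ℝ, E) p.1 ((extChartAt 𝓘(ℝ, E) p.1).symm z.1),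
    chartDiff 𝓘(ℝ, E) p.1 ((extChartAt 𝓘(ℝ, E) p.1).symm z.1)
      (chartInvDiff 𝓘(ℝ, E) p.1 z.1 z.2)) = z := Prod.ext h1 h2
  exact (congrArg (extChartAt 𝓘(ℝ, E).tangent p).symm h4).symm.trans h3

/-- The chart of TM centred at (x, v) depends only on x, so a single chart covers the whole fibre
over x. This makes it possible to differentiate along fibres in one chart. -/
lemma extChartAt_tangent_self (x : M) (v y : E) :
    extChartAt 𝓘(ℝ, E).tangent (⟨x, v⟩ : TangentBundle 𝓘(ℝ, E) M) ⟨x, y⟩ =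
      (extChartAt 𝓘(ℝ, E) x x, y) := by
  have h := extChartAt_tangent_apply (p := (⟨x, v⟩ : TangentBundle 𝓘(ℝ, E) M)) (w := ⟨x, y⟩)
    (mem_extChartAt_source x)
  have h2 : chartDiff 𝓘(ℝ, E) x x y = y := chartDiff_self_apply (I := 𝓘(ℝ, E)) x y
  rw [h]
  exact Prod.ext rfl h2

lemma extChartAt_tangent_symm_self (x : M) (v y : E) :
    (extChartAt 𝓘(ℝ, E).tangent (⟨x, v⟩ : TangentBundle 𝓘(ℝ, E) M)).symm
      (extChartAt 𝓘(ℝ, E) x x, y) = ⟨x, y⟩ := by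
  rw [← extChartAt_tangent_self x v y, PartialEquiv.left_inv]
  exact mem_extChartAt_tangent_source.2 (mem_extChartAt_source x)

/-- Chain rule applied to π ∘ (inverse chart of TM), which near z equals (inverse chart of M) ∘ fst.
-/
lemma projDiff_chartInvDiff {p : TangentBundle 𝓘(ℝ, E) M} {z : E × E}
    (hz : z ∈ (extChartAt 𝓘(ℝ, E).tangent p).target) (ζ : E × E) :
    (projDiff 𝓘(ℝ, E) ((extChartAt 𝓘(ℝ, E).tangent p).symm z)
      (chartInvDiff 𝓘(ℝ, E).tangent p z ζ) : E) = chartInvDiff 𝓘(ℝ, E) p.1 z.1 ζ.1 := by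
  have hz' := mem_extChartAt_tangent_target.1 hz
  have h1 : MDifferentiableAt 𝓘(ℝ, E).tangent 𝓘(ℝ, E) (fun w : TangentBundle 𝓘(ℝ, E) M ↦ w.1)
      ((extChartAt 𝓘(ℝ, E).tangent p).symm z) :=
    (contMDiffAt_proj (n := 1) (TangentSpace 𝓘(ℝ, E))).mdifferentiableAt one_ne_zero
  have h2 := (mdifferentiableWithinAt_extChartAt_symm (I := 𝓘(ℝ, E).tangent) hz)
  have h3 := mdifferentiableWithinAt_extChartAt_symm (I := 𝓘(ℝ, E)) hz'
  have e1 := mfderiv_comp_mfderivWithin (x := z) (s := range 𝓘(ℝ, E).tangent) h1 h2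
    (by rw [ModelWithCorners.range_eq_univ]; exact uniqueMDiffWithinAt_univ _)
  rw [ModelWithCorners.range_eq_univ] at *
  rw [mdifferentiableWithinAt_univ] at h3
  have e2 : HasMFDerivAt 𝓘(ℝ, E × E) 𝓘(ℝ, E) ((extChartAt 𝓘(ℝ, E) p.1).symm ∘ (Prod.fst : E × E → E)) z
      ((mfderiv 𝓘(ℝ, E) 𝓘(ℝ, E) (extChartAt 𝓘(ℝ, E) p.1).symm z.1).comp
        (ContinuousLinearMap.fst ℝ E E)) :=
    h3.hasMFDerivAt.comp z (hasFDerivAt_fst.hasMFDerivAt)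
  have e3 : ((fun w : TangentBundle 𝓘(ℝ, E) M ↦ w.1) ∘ (extChartAt 𝓘(ℝ, E).tangent p).symm)
      =ᶠ[nhds z] ((extChartAt 𝓘(ℝ, E) p.1).symm ∘ (Prod.fst : E × E → E)) := by
    filter_upwards [(isOpen_extChartAt_target p).mem_nhds hz] with y hy
    have := extChartAt_tangent_symm_apply (mem_extChartAt_tangent_target.1 hy)
    simp only [Function.comp, this]
  rw [mfderivWithin_univ, e3.mfderiv_eq, e2.mfderiv] at e1
  have := congrArg (fun L : E × E →L[ℝ] E ↦ L ζ) e1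
  simp only [projDiff, chartInvDiff, ModelWithCorners.range_eq_univ]
  simp only [mfderivWithin_univ] at this ⊢
  exact this.symm

lemma mdifferentiableAt_fiberInclusion (x : M) (y : E) :
    MDifferentiableAt 𝓘(ℝ, E) 𝓘(ℝ, E).tangent
      (fun w : E ↦ (⟨x, w⟩ : TangentBundle 𝓘(ℝ, E) M)) y := by
  refine ContMDiffAt.mdifferentiableAt (n := 1) ?_ one_ne_zero
  rw [contMDiffAt_totalSpace]
  refine ⟨contMDiffAt_const, ?_⟩
  have : (fun w : E ↦ (trivializationAt E (TangentSpace 𝓘(ℝ, E)) x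
      (⟨x, w⟩ : TangentBundle 𝓘(ℝ, E) M)).2) = fun w ↦
        ((trivializationAt E (TangentSpace 𝓘(ℝ, E)) x).continuousLinearMapAt ℝ x : E →L[ℝ] E) w := by
    ext w
    exact (Bundle.Trivialization.continuousLinearMapAt_apply_of_mem (R := ℝ)
      (trivializationAt E (TangentSpace 𝓘(ℝ, E)) x) (b := x)
      (FiberBundle.mem_baseSet_trivializationAt E (TangentSpace 𝓘(ℝ, E)) x) w).symm
  rw [this]
  exact (ContinuousLinearMap.contDiff _).contMDiff.contMDiffAt

/-- In a natural chart the inclusion of a fibre is the affine map v ↦ (const, D v), with D the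
differential of the chart of M. -/
lemma chartDiff_verticalLift {p w : TangentBundle 𝓘(ℝ, E) M}
    (hw : w.1 ∈ (extChartAt 𝓘(ℝ, E) p.1).source) (v : TangentSpace 𝓘(ℝ, E) w.1) :
    chartDiff 𝓘(ℝ, E).tangent p w (verticalLift 𝓘(ℝ, E) w v) =
      (0, chartDiff 𝓘(ℝ, E) p.1 w.1 v) := by
  obtain ⟨x, y⟩ := w
  have hw' : (⟨x, y⟩ : TangentBundle 𝓘(ℝ, E) M) ∈ (chartAt (ModelProd E E) p).source := by
    rw [← extChartAt_source 𝓘(ℝ, E).tangent]; exact mem_extChartAt_tangent_source.2 hw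
  have h1 := (mdifferentiableAt_extChartAt (I := 𝓘(ℝ, E).tangent) hw').hasMFDerivAt
  have h2 := (mdifferentiableAt_fiberInclusion (E := E) (M := M) x y).hasMFDerivAt
  let D : E →L[ℝ] E := chartDiff 𝓘(ℝ, E) p.1 x
  have e1 := HasMFDerivAt.comp (E := E) (y : E) (I := 𝓘(ℝ, E)) (I' := 𝓘(ℝ, E).tangent) (M := E)
    (f := fun v : E ↦ (⟨x, v⟩ : TangentBundle 𝓘(ℝ, E) M)) h1 h2
  have e2 : (extChartAt 𝓘(ℝ, E).tangent p) ∘ (fun v : E ↦ (⟨x, v⟩ : TangentBundle 𝓘(ℝ, E) M)) =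
      fun v : E ↦ (extChartAt 𝓘(ℝ, E) p.1 x, D v) := by
    ext1 v
    exact extChartAt_tangent_apply (w := ⟨x, v⟩) hw
  have e3 : HasFDerivAt (fun v : E ↦ (extChartAt 𝓘(ℝ, E) p.1 x, D v))
      ((0 : E →L[ℝ] E).prod D) y :=
    (hasFDerivAt_const _ _).prodMk (ContinuousLinearMap.hasFDerivAt _)
  rw [e2] at e1
  have := hasMFDerivAt_unique e1 e3.hasMFDerivAt
  exact (congrArg (fun L : E →L[ℝ] E × E ↦ L v) this)

end TangentCharts

/-! ### Liouville field, tangent structure and semi-basic forms in coordinates -/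

section TangentGeometry

variable {E : Type*} [NormedAddCommGroup E] [NormedSpace ℝ E]
  {M : Type*} [TopologicalSpace M] [ChartedSpace E M] [IsManifold 𝓘(ℝ, E) ∞ M]

lemma chartDiff_projDiff {p w : TangentBundle 𝓘(ℝ, E) M}
    (hw : w.1 ∈ (extChartAt 𝓘(ℝ, E) p.1).source) (ξ : TangentSpace 𝓘(ℝ, E).tangent w) :
    chartDiff 𝓘(ℝ, E) p.1 w.1 (projDiff 𝓘(ℝ, E) w ξ) =
      (chartDiff 𝓘(ℝ, E).tangent p w ξ).1 := by
  obtain ⟨z, hz, rfl⟩ : ∃ z ∈ (extChartAt 𝓘(ℝ, E).tangent p).target,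
      (extChartAt 𝓘(ℝ, E).tangent p).symm z = w :=
    ⟨_, (extChartAt 𝓘(ℝ, E).tangent p).map_source (mem_extChartAt_tangent_source.2 hw),
      (extChartAt 𝓘(ℝ, E).tangent p).left_inv (mem_extChartAt_tangent_source.2 hw)⟩
  have hz' := mem_extChartAt_tangent_target.1 hz
  have h1 := projDiff_chartInvDiff hz (chartDiff 𝓘(ℝ, E).tangent p _ ξ)
  rw [chartInvDiff_chartDiff hz] at h1
  have h2 : ((extChartAt 𝓘(ℝ, E).tangent p).symm z).1 = (extChartAt 𝓘(ℝ, E) p.1).symm z.1 := by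
    rw [extChartAt_tangent_symm_apply hz']
  have h3 := chartDiff_chartInvDiff hz' (chartDiff 𝓘(ℝ, E).tangent p _ ξ).1
  -- The two base points are equal only propositionally, so the differentials live at different
  -- points; generalizing the point allows the substitution.
  have h4 : ∀ x : M, x = (extChartAt 𝓘(ℝ, E) p.1).symm z.1 → ∀ v : E,
      (chartDiff 𝓘(ℝ, E) p.1 x : E →L[ℝ] E) v =
        (chartDiff 𝓘(ℝ, E) p.1 ((extChartAt 𝓘(ℝ, E) p.1).symm z.1) : E →L[ℝ] E) v := by
    rintro x rfl v; rfl
  have h5 := h4 _ h2 (projDiff 𝓘(ℝ, E) ((extChartAt 𝓘(ℝ, E).tangent p).symm z) ξ)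
  refine h5.trans (Eq.trans ?_ h3)
  exact congrArg (chartDiff 𝓘(ℝ, E) p.1 ((extChartAt 𝓘(ℝ, E) p.1).symm z.1) : E →L[ℝ] E) h1

lemma projDiff_apply (u : TangentBundle 𝓘(ℝ, E) M) (ξ : TangentSpace 𝓘(ℝ, E).tangent u) :
    projDiff 𝓘(ℝ, E) u ξ = (ξ : E × E).1 := by
  have h := chartDiff_projDiff (p := u) (w := u) (mem_extChartAt_source _) ξ
  rw [chartDiff_self_apply, chartDiff_self_apply] at h
  exact h

lemma verticalLift_apply (u : TangentBundle 𝓘(ℝ, E) M) (v : TangentSpace 𝓘(ℝ, E) u.1) :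
    verticalLift 𝓘(ℝ, E) u v = ((0, v) : E × E) := by
  have h := chartDiff_verticalLift (p := u) (w := u) (mem_extChartAt_source _) v
  rw [chartDiff_self_apply, chartDiff_self_apply] at h
  exact h

lemma liouville_apply (u : TangentBundle 𝓘(ℝ, E) M) :
    liouville 𝓘(ℝ, E) u = ((0, u.2) : E × E) :=
  verticalLift_apply u u.2

lemma tangentStructure_apply (u : TangentBundle 𝓘(ℝ, E) M)
    (ξ : TangentSpace 𝓘(ℝ, E).tangent u) :
    tangentStructure 𝓘(ℝ, E) u ξ = ((0, (ξ : E × E).1) : E × E) := by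
  rw [tangentStructure, ContinuousLinearMap.comp_apply, verticalLift_apply, projDiff_apply]

lemma chartDiff_liouville {p w : TangentBundle 𝓘(ℝ, E) M}
    (hw : w.1 ∈ (extChartAt 𝓘(ℝ, E) p.1).source) :
    chartDiff 𝓘(ℝ, E).tangent p w (liouville 𝓘(ℝ, E) w) =
      (0, (extChartAt 𝓘(ℝ, E).tangent p w).2) := by
  rw [liouville, chartDiff_verticalLift hw, extChartAt_tangent_apply hw]

lemma chartDiff_tangentStructure {p w : TangentBundle 𝓘(ℝ, E) M}
    (hw : w.1 ∈ (extChartAt 𝓘(ℝ, E) p.1).source) (ξ : TangentSpace 𝓘(ℝ, E).tangent w) :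
    chartDiff 𝓘(ℝ, E).tangent p w (tangentStructure 𝓘(ℝ, E) w ξ) =
      (0, (chartDiff 𝓘(ℝ, E).tangent p w ξ).1) := by
  rw [tangentStructure, ContinuousLinearMap.comp_apply, chartDiff_verticalLift hw,
    chartDiff_projDiff hw]

lemma proj_extChartAt_tangent_symm_mem {p : TangentBundle 𝓘(ℝ, E) M} {z : E × E}
    (hz : z ∈ (extChartAt 𝓘(ℝ, E).tangent p).target) :
    ((extChartAt 𝓘(ℝ, E).tangent p).symm z).1 ∈ (extChartAt 𝓘(ℝ, E) p.1).source :=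
  mem_extChartAt_tangent_source.1 ((extChartAt 𝓘(ℝ, E).tangent p).map_target hz)

lemma vectorFieldInChart_liouville {p : TangentBundle 𝓘(ℝ, E) M} {z : E × E}
    (hz : z ∈ (extChartAt 𝓘(ℝ, E).tangent p).target) :
    vectorFieldInChart 𝓘(ℝ, E).tangent (liouville 𝓘(ℝ, E)) p z = (0, z.2) := by
  rw [vectorFieldInChart, chartDiff_liouville (proj_extChartAt_tangent_symm_mem hz),
    (extChartAt 𝓘(ℝ, E).tangent p).right_inv hz]

lemma tangentStructure_chartInvDiff {p : TangentBundle 𝓘(ℝ, E) M} {z : E × E}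
    (hz : z ∈ (extChartAt 𝓘(ℝ, E).tangent p).target) (ζ : E × E) :
    tangentStructure 𝓘(ℝ, E) _ (chartInvDiff 𝓘(ℝ, E).tangent p z ζ) =
      chartInvDiff 𝓘(ℝ, E).tangent p z (0, ζ.1) := by
  rw [← chartInvDiff_chartDiff hz (tangentStructure 𝓘(ℝ, E) _ _),
    chartDiff_tangentStructure (proj_extChartAt_tangent_symm_mem hz), chartDiff_chartInvDiff hz]

/-- J has constant coefficients in natural coordinates; its derivative therefore drops out of ℒ_S J.
-/
lemma endoInChart_tangentStructure {p : TangentBundle 𝓘(ℝ, E) M} {z : E × E}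
    (hz : z ∈ (extChartAt 𝓘(ℝ, E).tangent p).target) :
    endoInChart 𝓘(ℝ, E).tangent (tangentStructure 𝓘(ℝ, E)) p z =
      (ContinuousLinearMap.inr ℝ E E).comp (ContinuousLinearMap.fst ℝ E E) := by
  refine ContinuousLinearMap.ext fun ζ ↦ ?_
  change chartDiff 𝓘(ℝ, E).tangent p _ (tangentStructure 𝓘(ℝ, E) _
    (chartInvDiff 𝓘(ℝ, E).tangent p z ζ)) = (0, ζ.1)
  rw [chartDiff_tangentStructure (proj_extChartAt_tangent_symm_mem hz), chartDiff_chartInvDiff hz]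

lemma mem_slashedTangentBundle_iff {p w : TangentBundle 𝓘(ℝ, E) M}
    (hw : w.1 ∈ (extChartAt 𝓘(ℝ, E) p.1).source) :
    w ∈ slashedTangentBundle 𝓘(ℝ, E) M ↔ (extChartAt 𝓘(ℝ, E).tangent p w).2 ≠ 0 := by
  rw [extChartAt_tangent_apply hw]
  have h : (chartDiff 𝓘(ℝ, E) p.1 w.1).IsInvertible := isInvertible_mfderiv_extChartAt hw
  exact (map_ne_zero_iff _ h.injective).symm

lemma symm_mem_slashedTangentBundle_iff {p : TangentBundle 𝓘(ℝ, E) M} {z : E × E}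
    (hz : z ∈ (extChartAt 𝓘(ℝ, E).tangent p).target) :
    (extChartAt 𝓘(ℝ, E).tangent p).symm z ∈ slashedTangentBundle 𝓘(ℝ, E) M ↔ z.2 ≠ 0 := by
  rw [mem_slashedTangentBundle_iff (proj_extChartAt_tangent_symm_mem hz),
    (extChartAt 𝓘(ℝ, E).tangent p).right_inv hz]

lemma isOpen_slashedTangentBundle : IsOpen (slashedTangentBundle 𝓘(ℝ, E) M) := by
  rw [isOpen_iff_mem_nhds]
  intro u hu
  have h1 := (continuousAt_extChartAt (I := 𝓘(ℝ, E).tangent) u).snd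
  have h2 := (mem_slashedTangentBundle_iff (p := u) (mem_extChartAt_source _)).1 hu
  filter_upwards [h1.eventually_ne h2, extChartAt_source_mem_nhds (I := 𝓘(ℝ, E).tangent) u]
    with w hw hw'
  exact (mem_slashedTangentBundle_iff (mem_extChartAt_tangent_source.1 hw')).2 hw

/-- Near the coordinates of a nonzero vector, coordinates describe nonzero vectors. -/
lemma eventually_slashed {u : TangentBundle 𝓘(ℝ, E) M}
    (hu : u ∈ slashedTangentBundle 𝓘(ℝ, E) M) :
    ∀ᶠ z in nhds (extChartAt 𝓘(ℝ, E).tangent u u),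
      z ∈ (extChartAt 𝓘(ℝ, E).tangent u).target ∧
        (extChartAt 𝓘(ℝ, E).tangent u).symm z ∈ slashedTangentBundle 𝓘(ℝ, E) M := by
  have h2 := (mem_slashedTangentBundle_iff (p := u) (mem_extChartAt_source _)).1 hu
  filter_upwards [extChartAt_target_mem_nhds (I := 𝓘(ℝ, E).tangent) u,
    (continuous_snd.continuousAt (x := extChartAt 𝓘(ℝ, E).tangent u u)).eventually_ne h2]
    with z hz hz'
  exact ⟨hz, (symm_mem_slashedTangentBundle_iff hz).2 hz'⟩

lemma extChartAt_tangent_self' (u : TangentBundle 𝓘(ℝ, E) M) :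
    extChartAt 𝓘(ℝ, E).tangent u u = (extChartAt 𝓘(ℝ, E) u.1 u.1, (u.2 : E)) :=
  extChartAt_tangent_self (E := E) u.1 u.2 u.2

lemma mvfderiv_chartInvDiff {N : Type*} [TopologicalSpace N] [ChartedSpace (ModelProd E E) N]
    [IsManifold 𝓘(ℝ, E).tangent 1 N] {F : N → ℝ} {p : N} {z : E × E}
    (hz : z ∈ (extChartAt 𝓘(ℝ, E).tangent p).target)
    (hF : MDifferentiableAt 𝓘(ℝ, E).tangent 𝓘(ℝ, ℝ) F ((extChartAt 𝓘(ℝ, E).tangent p).symm z))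
    (ζ : E × E) :
    mvfderiv 𝓘(ℝ, E).tangent F _ (chartInvDiff 𝓘(ℝ, E).tangent p z ζ) =
      fderiv ℝ (F ∘ (extChartAt 𝓘(ℝ, E).tangent p).symm) z ζ := by
  have h2 := mdifferentiableWithinAt_extChartAt_symm (I := 𝓘(ℝ, E).tangent) hz
  have h := mfderiv_comp_mfderivWithin (x := z) (s := range 𝓘(ℝ, E).tangent) hF h2
    (by rw [ModelWithCorners.range_eq_univ]; exact uniqueMDiffWithinAt_univ _)
  have h' : mfderivWithin 𝓘(ℝ, E × E) 𝓘(ℝ, ℝ) (F ∘ (extChartAt 𝓘(ℝ, E).tangent p).symm)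
      (range 𝓘(ℝ, E).tangent) z = fderiv ℝ (F ∘ (extChartAt 𝓘(ℝ, E).tangent p).symm) z := by
    rw [ModelWithCorners.range_eq_univ, mfderivWithin_univ, mfderiv_eq_fderiv]
  rw [h'] at h
  exact (congrArg (fun L : E × E →L[ℝ] ℝ ↦ L ζ) h).symm

lemma oneFormInChart_derivAlongFun_tangentStructure {F : TangentBundle 𝓘(ℝ, E) M → ℝ}
    {p : TangentBundle 𝓘(ℝ, E) M} {z : E × E}
    (hz : z ∈ (extChartAt 𝓘(ℝ, E).tangent p).target)
    (hF : MDifferentiableAt 𝓘(ℝ, E).tangent 𝓘(ℝ, ℝ) F ((extChartAt 𝓘(ℝ, E).tangent p).symm z))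
    (ζ : E × E) :
    oneFormInChart 𝓘(ℝ, E).tangent
        (derivAlongFun 𝓘(ℝ, E).tangent (tangentStructure 𝓘(ℝ, E)) F) p z ζ =
      fderiv ℝ (F ∘ (extChartAt 𝓘(ℝ, E).tangent p).symm) z (0, ζ.1) := by
  rw [← mvfderiv_chartInvDiff hz hF, ← tangentStructure_chartInvDiff hz]
  rfl

lemma projDiff_chartInvDiff_eq_zero {p : TangentBundle 𝓘(ℝ, E) M} {z : E × E}
    (hz : z ∈ (extChartAt 𝓘(ℝ, E).tangent p).target) (v : E) :
    projDiff 𝓘(ℝ, E) ((extChartAt 𝓘(ℝ, E).tangent p).symm z)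
      (chartInvDiff 𝓘(ℝ, E).tangent p z (0, v)) = 0 := by
  refine (projDiff_chartInvDiff hz (0, v)).trans ?_
  exact map_zero (chartInvDiff 𝓘(ℝ, E) p.1 z.1)

lemma IsSemiBasic.oneFormInChart_apply
    {θ : ∀ u : TangentBundle 𝓘(ℝ, E) M, TangentSpace 𝓘(ℝ, E).tangent u →L[ℝ] ℝ}
    (hθ : IsSemiBasic 𝓘(ℝ, E) θ) {p : TangentBundle 𝓘(ℝ, E) M} {z : E × E}
    (hz : z ∈ (extChartAt 𝓘(ℝ, E).tangent p).target)
    (hz' : (extChartAt 𝓘(ℝ, E).tangent p).symm z ∈ slashedTangentBundle 𝓘(ℝ, E) M) (ζ : E × E) :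
    oneFormInChart 𝓘(ℝ, E).tangent θ p z ζ = oneFormInChart 𝓘(ℝ, E).tangent θ p z (ζ.1, 0) := by
  have h : oneFormInChart 𝓘(ℝ, E).tangent θ p z (0, ζ.2) = 0 :=
    hθ _ hz' _ (projDiff_chartInvDiff_eq_zero hz _)
  have : ζ = (ζ.1, 0) + (0, ζ.2) := by simp
  conv_lhs => rw [this]
  rw [map_add, h, add_zero]

lemma IsSemiBasic.apply_eq
    {θ : ∀ u : TangentBundle 𝓘(ℝ, E) M, TangentSpace 𝓘(ℝ, E).tangent u →L[ℝ] ℝ}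
    (hθ : IsSemiBasic 𝓘(ℝ, E) θ) {u : TangentBundle 𝓘(ℝ, E) M}
    (hu : u ∈ slashedTangentBundle 𝓘(ℝ, E) M) {ξ η : TangentSpace 𝓘(ℝ, E).tangent u}
    (h : (ξ : E × E).1 = (η : E × E).1) : θ u ξ = θ u η := by
  rw [← sub_eq_zero, ← map_sub]
  refine hθ u hu _ ?_
  rw [map_sub, projDiff_apply, projDiff_apply]
  exact sub_eq_zero.2 h

end TangentGeometry

/-! ### Sprays, their horizontal projector and Euler's relation -/

section SprayGeometry

variable {E : Type*} [NormedAddCommGroup E] [NormedSpace ℝ E]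
  {M : Type*} [TopologicalSpace M] [ChartedSpace E M] [IsManifold 𝓘(ℝ, E) ∞ M]
  {S : ∀ u : TangentBundle 𝓘(ℝ, E) M, TangentSpace 𝓘(ℝ, E).tangent u}

lemma vectorFieldInChart_fst
    (hS : ∀ u ∈ slashedTangentBundle 𝓘(ℝ, E) M,
      tangentStructure 𝓘(ℝ, E) u (S u) = liouville 𝓘(ℝ, E) u)
    {p : TangentBundle 𝓘(ℝ, E) M} {z : E × E}
    (hz : z ∈ (extChartAt 𝓘(ℝ, E).tangent p).target)
    (hz' : (extChartAt 𝓘(ℝ, E).tangent p).symm z ∈ slashedTangentBundle 𝓘(ℝ, E) M) :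
    (vectorFieldInChart 𝓘(ℝ, E).tangent S p z).1 = z.2 := by
  have h1 := chartDiff_tangentStructure (proj_extChartAt_tangent_symm_mem hz)
    (S ((extChartAt 𝓘(ℝ, E).tangent p).symm z))
  rw [hS _ hz', chartDiff_liouville (proj_extChartAt_tangent_symm_mem hz),
    (extChartAt 𝓘(ℝ, E).tangent p).right_inv hz] at h1
  exact (congrArg Prod.snd h1).symm

lemma spray_fst
    (hS : ∀ u ∈ slashedTangentBundle 𝓘(ℝ, E) M,
      tangentStructure 𝓘(ℝ, E) u (S u) = liouville 𝓘(ℝ, E) u)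
    {u : TangentBundle 𝓘(ℝ, E) M} (hu : u ∈ slashedTangentBundle 𝓘(ℝ, E) M) :
    (S u : E × E).1 = (u.2 : E) := by
  have h := hS u hu
  rw [tangentStructure_apply, liouville_apply] at h
  exact congrArg Prod.snd h

lemma IsSpray.contDiffAt (hS : IsSpray 𝓘(ℝ, E) S) {u : TangentBundle 𝓘(ℝ, E) M}
    (hu : u ∈ slashedTangentBundle 𝓘(ℝ, E) M) :
    ContDiffAt ℝ ∞ (vectorFieldInChart 𝓘(ℝ, E).tangent S u) (extChartAt 𝓘(ℝ, E).tangent u u) :=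
  (smoothVectorField_contDiffAt_iff S u).1
    (hS.smooth.contMDiffAt (isOpen_slashedTangentBundle.mem_nhds hu))

/-- The first component of the derivative of a spray in coordinates. -/
lemma IsSpray.fderiv_fst (hS : IsSpray 𝓘(ℝ, E) S) {u : TangentBundle 𝓘(ℝ, E) M}
    (hu : u ∈ slashedTangentBundle 𝓘(ℝ, E) M) (ζ : E × E) :
    (fderiv ℝ (vectorFieldInChart 𝓘(ℝ, E).tangent S u) (extChartAt 𝓘(ℝ, E).tangent u u) ζ).1 =
      ζ.2 := by
  have hd : DifferentiableAt ℝ (vectorFieldInChart 𝓘(ℝ, E).tangent S u)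
      (extChartAt 𝓘(ℝ, E).tangent u u) := (hS.contDiffAt hu).differentiableAt (by simp)
  have h1 := hd.hasFDerivAt.fst
  have h2 : HasFDerivAt (fun z : E × E ↦ z.2) (ContinuousLinearMap.snd ℝ E E)
    (extChartAt 𝓘(ℝ, E).tangent u u) := hasFDerivAt_snd
  have h3 : (fun z ↦ (vectorFieldInChart 𝓘(ℝ, E).tangent S u z).1)
      =ᶠ[nhds (extChartAt 𝓘(ℝ, E).tangent u u)] fun z : E × E ↦ z.2 := by
    filter_upwards [eventually_slashed hu] with z hz
    exact vectorFieldInChart_fst hS.tangentStructure_apply hz.1 hz.2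
  have h4 := h1.unique (h2.congr_of_eventuallyEq h3)
  exact congrArg (fun L : E × E →L[ℝ] E ↦ L ζ) h4

/-- The coefficients `Nʲᵢ = -(1/2) ∂Sʲ/∂yⁱ`, up to sign, of the nonlinear connection of a spray. -/
def sprayConnection (S : ∀ u : TangentBundle 𝓘(ℝ, E) M, TangentSpace 𝓘(ℝ, E).tangent u)
    (u : TangentBundle 𝓘(ℝ, E) M) (v : E) : E :=
  (1 / 2 : ℝ) • (fderiv ℝ (vectorFieldInChart 𝓘(ℝ, E).tangent S u)
    (extChartAt 𝓘(ℝ, E).tangent u u) (0, v)).2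

/-- Since J is constant, ℒ_S J = -DS ∘ J + J ∘ DS, where S = (y, σ). The first component of DS(a, b)
is b, hence (Id - ℒ_S J)(a, b) = (2a, ∂_yσ a). -/
lemma IsSpray.horizontalProjector_apply (hS : IsSpray 𝓘(ℝ, E) S)
    {u : TangentBundle 𝓘(ℝ, E) M} (hu : u ∈ slashedTangentBundle 𝓘(ℝ, E) M)
    (ξ : TangentSpace 𝓘(ℝ, E).tangent u) :
    horizontalProjector 𝓘(ℝ, E) S u ξ =
      (((ξ : E × E).1, sprayConnection S u (ξ : E × E).1) : E × E) := by
  have h1 := lieDerivEndo_apply (I := 𝓘(ℝ, E).tangent) S (tangentStructure 𝓘(ℝ, E)) u ξ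
  have h2 : endoInChart 𝓘(ℝ, E).tangent (tangentStructure 𝓘(ℝ, E)) u
      =ᶠ[nhds (extChartAt 𝓘(ℝ, E).tangent u u)]
      fun _ ↦ (ContinuousLinearMap.inr ℝ E E).comp (ContinuousLinearMap.fst ℝ E E) := by
    filter_upwards [extChartAt_target_mem_nhds (I := 𝓘(ℝ, E).tangent) u] with z hz
    exact endoInChart_tangentStructure hz
  rw [h2.fderiv_eq, h2.eq_of_nhds, fderiv_const_apply] at h1
  have h3 : horizontalProjector 𝓘(ℝ, E) S u ξ = (1 / 2 : ℝ) •
    (ξ - lieDerivEndo 𝓘(ℝ, E).tangent S (tangentStructure 𝓘(ℝ, E)) u ξ) := rfl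
  rw [h3, h1]
  obtain ⟨a, b⟩ : E × E := ξ
  have h5 := hS.fderiv_fst hu (0, a)
  have h6 := hS.fderiv_fst hu (a, b)
  have key : (1 / 2 : ℝ) • (((a, b) : E × E) - ((0 : E × E) -
      fderiv ℝ (vectorFieldInChart 𝓘(ℝ, E).tangent S u) (extChartAt 𝓘(ℝ, E).tangent u u) (0, a) +
      (0, (fderiv ℝ (vectorFieldInChart 𝓘(ℝ, E).tangent S u)
        (extChartAt 𝓘(ℝ, E).tangent u u) (a, b)).1))) = (a, sprayConnection S u a) := by
    rw [h6]
    refine Prod.ext ?_ ?_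
    · simp only [Prod.smul_fst, Prod.fst_sub, Prod.fst_add, h5, Prod.fst_zero]
      module
    · simp only [Prod.smul_snd, Prod.snd_sub, Prod.snd_add, Prod.snd_zero, sprayConnection]
      module
  exact key

/-- In coordinates ℂ is the linear field (0, y), so [ℂ, S] = DS(ℂ) - ℂ(S), with ℂ applied as a
linear map. -/
lemma mlieBracket_liouville (u : TangentBundle 𝓘(ℝ, E) M) :
    mlieBracket 𝓘(ℝ, E).tangent (liouville 𝓘(ℝ, E)) S u =
      (fderiv ℝ (vectorFieldInChart 𝓘(ℝ, E).tangent S u) (extChartAt 𝓘(ℝ, E).tangent u u)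
        (0, (u.2 : E)) - (0, (S u : E × E).2) : E × E) := by
  have h1 : vectorFieldInChart 𝓘(ℝ, E).tangent (liouville 𝓘(ℝ, E)) u
      =ᶠ[nhds (extChartAt 𝓘(ℝ, E).tangent u u)]
        (ContinuousLinearMap.inr ℝ E E).comp (ContinuousLinearMap.snd ℝ E E) := by
    filter_upwards [extChartAt_target_mem_nhds (I := 𝓘(ℝ, E).tangent) u] with z hz
    exact vectorFieldInChart_liouville hz
  have h2 := vectorFieldInChart_self (I := 𝓘(ℝ, E).tangent) S u
  have h3 : vectorFieldInChart 𝓘(ℝ, E).tangent (liouville 𝓘(ℝ, E)) u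
      (extChartAt 𝓘(ℝ, E).tangent u u) = (0, (u.2 : E)) :=
    (vectorFieldInChart_self _ u).trans (liouville_apply u)
  rw [mlieBracket_eq_lieBracket]
  simp only [lieBracket_eq]
  rw [h1.fderiv_eq, ContinuousLinearMap.fderiv, h2, h3]
  rfl

/-- Euler's relation for a spray in coordinates. -/
lemma IsSpray.fderiv_radial (hS : IsSpray 𝓘(ℝ, E) S) {u : TangentBundle 𝓘(ℝ, E) M}
    (hu : u ∈ slashedTangentBundle 𝓘(ℝ, E) M) :
    fderiv ℝ (vectorFieldInChart 𝓘(ℝ, E).tangent S u) (extChartAt 𝓘(ℝ, E).tangent u u)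
      (0, (u.2 : E)) = ((u.2 : E), (2 : ℝ) • (S u : E × E).2) := by
  have h1 : (_ : E × E) = (S u : E × E) :=
    (mlieBracket_liouville (S := S) u).symm.trans (hS.homogeneous u hu)
  have h2 : (S u : E × E).1 = (u.2 : E) := spray_fst hS.tangentStructure_apply hu
  have aux : ∀ (A s : E × E) (y : E), A - (0, s.2) = s → s.1 = y → A = (y, (2 : ℝ) • s.2) := by
    rintro A s y h rfl
    rw [sub_eq_iff_eq_add] at h
    rw [h]
    exact Prod.ext (by simp) (two_smul ℝ _).symm
  exact aux _ _ _ h1 h2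

end SprayGeometry

/-- A function on a punctured normed space satisfying Euler's relation of degree `k` is positively
homogeneous of degree `k`. -/
lemma posHomogeneous_of_euler {E F : Type*} [NormedAddCommGroup E] [NormedSpace ℝ E]
    [NormedAddCommGroup F] [NormedSpace ℝ F] {f : E → F} {f' : E → E →L[ℝ] F} {k : ℕ}
    (hf : ∀ y ≠ 0, HasFDerivAt f (f' y) y) (hE : ∀ y ≠ 0, f' y y = (k : ℝ) • f y)
    {y : E} (hy : y ≠ 0) {l : ℝ} (hl : 0 < l) : f (l • y) = l ^ k • f y := by
  -- By Euler's relation t⁻ᵏ f(ty) has zero derivative on the half-line t > 0, so it equals its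
  -- value at t = 1.
  have hd : ∀ t ∈ Ioi (0 : ℝ), HasDerivAt (fun t : ℝ ↦ (t ^ k)⁻¹ • f (t • y)) 0 t := by
    intro t ht
    have ht0 : t ≠ 0 := (mem_Ioi.1 ht).ne'
    have h1 : HasDerivAt (fun t : ℝ ↦ f (t • y)) (f' (t • y) y) t := by
      have := (hf (t • y) (smul_ne_zero ht0 hy)).comp_hasDerivAt t
        ((hasDerivAt_id t).smul_const y)
      simpa [Function.comp_def] using this
    have h2 : HasDerivAt (fun t : ℝ ↦ (t ^ k)⁻¹) (-(k * t ^ (k - 1)) / (t ^ k) ^ 2) t :=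
      (hasDerivAt_pow k t).inv (pow_ne_zero k ht0)
    refine (h2.smul h1).congr_deriv ?_
    have h3 : f' (t • y) y = (t⁻¹ * k) • f (t • y) := by
      rw [mul_smul, ← hE _ (smul_ne_zero ht0 hy), map_smul, smul_smul, inv_mul_cancel₀ ht0, one_smul]
    rw [h3, smul_smul, ← add_smul]
    have : (t ^ k)⁻¹ * (t⁻¹ * k) + -(k * t ^ (k - 1)) / (t ^ k) ^ 2 = 0 := by
      rcases k with _ | k
      · simp
      · simp only [Nat.add_sub_cancel]
        field_simp
        ring
    rw [this, zero_smul]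
  have h := isOpen_Ioi.is_const_of_deriv_eq_zero (𝕜 := ℝ) isPreconnected_Ioi
    (fun t ht ↦ (hd t ht).differentiableAt.differentiableWithinAt)
    (fun t ht ↦ (hd t ht).deriv) (mem_Ioi.2 hl) (mem_Ioi.2 one_pos)
  simp only [one_pow, inv_one, one_smul] at h
  rw [← h, smul_smul, mul_inv_cancel₀ (pow_ne_zero k hl.ne'), one_smul]

/-! ### Restriction to fibres; the differential conditions on a semi-basic form -/

section Fibers

variable {E : Type*} [NormedAddCommGroup E] [NormedSpace ℝ E]
  {M : Type*} [TopologicalSpace M] [ChartedSpace E M] [IsManifold 𝓘(ℝ, E) ∞ M]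
  {S : ∀ u : TangentBundle 𝓘(ℝ, E) M, TangentSpace 𝓘(ℝ, E).tangent u}
  {θ : ∀ u : TangentBundle 𝓘(ℝ, E) M, TangentSpace 𝓘(ℝ, E).tangent u →L[ℝ] ℝ}

/-- All charts centred at points of one fibre agree, and each is the identity on tangent vectors at
its centre; so one coordinate expression records S on the whole fibre. -/
lemma vectorFieldInChart_fiber
    (S : ∀ u : TangentBundle 𝓘(ℝ, E) M, TangentSpace 𝓘(ℝ, E).tangent u) (x : M) (v y : E) :
    vectorFieldInChart 𝓘(ℝ, E).tangent S ⟨x, v⟩ (extChartAt 𝓘(ℝ, E) x x, y) =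
      (S ⟨x, y⟩ : E × E) := by
  have h := vectorFieldInChart_self (I := 𝓘(ℝ, E).tangent) S (⟨x, y⟩ : TangentBundle 𝓘(ℝ, E) M)
  rw [extChartAt_tangent_self] at h
  exact h

lemma oneFormInChart_self_apply {N : Type*} [TopologicalSpace N] {H : Type*} [TopologicalSpace H]
    {I : ModelWithCorners ℝ E H} [ChartedSpace H N] [IsManifold I 1 N]
    (θ : ∀ u : N, TangentSpace I u →L[ℝ] ℝ) (u : N) (ζ : E) :
    oneFormInChart I θ u (extChartAt I u u) ζ = θ u (ζ : E) := by
  have h : (extChartAt I u).symm (extChartAt I u u) = u := extChartAt_to_inv u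
  have h1 := chartInvDiff_self_apply (I := I) u ζ
  have h2 : ∀ w : N, w = u → ∀ v : E, (θ w : E →L[ℝ] ℝ) v = (θ u : E →L[ℝ] ℝ) v := by
    rintro w rfl v; rfl
  refine (h2 _ h _).trans ?_
  exact congrArg (θ u : E →L[ℝ] ℝ) h1

lemma oneFormInChart_fiber
    (θ : ∀ u : TangentBundle 𝓘(ℝ, E) M, TangentSpace 𝓘(ℝ, E).tangent u →L[ℝ] ℝ) (x : M) (v y : E)
    (ζ : E × E) :
    oneFormInChart 𝓘(ℝ, E).tangent θ ⟨x, v⟩ (extChartAt 𝓘(ℝ, E) x x, y) ζ = θ ⟨x, y⟩ ζ := by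
  have h := oneFormInChart_self_apply (I := 𝓘(ℝ, E).tangent) θ
    (⟨x, y⟩ : TangentBundle 𝓘(ℝ, E) M) ζ
  rw [extChartAt_tangent_self] at h
  exact h

/-- The condition [ℂ, S] = S is Euler's relation of degree two for the second component of S on each
fibre. -/
lemma IsSpray.homogeneous_snd (hS : IsSpray 𝓘(ℝ, E) S) (x : M) {y : E} (hy : y ≠ 0) {l : ℝ}
    (hl : 0 < l) : (S ⟨x, l • y⟩ : E × E).2 = l ^ 2 • (S ⟨x, y⟩ : E × E).2 := by
  refine posHomogeneous_of_euler (f := fun y : E ↦ (S ⟨x, y⟩ : E × E).2)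
    (f' := fun y ↦ (ContinuousLinearMap.snd ℝ E E).comp
      ((fderiv ℝ (vectorFieldInChart 𝓘(ℝ, E).tangent S ⟨x, y⟩)
        (extChartAt 𝓘(ℝ, E) x x, y)).comp (ContinuousLinearMap.inr ℝ E E))) (k := 2)
    (fun v hv ↦ ?_) (fun v hv ↦ ?_) hy hl
  · have hu : (⟨x, v⟩ : TangentBundle 𝓘(ℝ, E) M) ∈ slashedTangentBundle 𝓘(ℝ, E) M := hv
    have h1 := (hS.contDiffAt hu).differentiableAt (by simp)
    rw [extChartAt_tangent_self] at h1
    have h2 : HasFDerivAt (fun y : E ↦ (extChartAt 𝓘(ℝ, E) x x, y)) (ContinuousLinearMap.inr ℝ E E) v :=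
      hasFDerivAt_prodMk_right _ _
    have h3 := ((ContinuousLinearMap.snd ℝ E E).hasFDerivAt).comp v (h1.hasFDerivAt.comp v h2)
    refine h3.congr_of_eventuallyEq (Filter.Eventually.of_forall fun y ↦ ?_)
    exact congrArg Prod.snd (vectorFieldInChart_fiber S x v y).symm
  · have hu : (⟨x, v⟩ : TangentBundle 𝓘(ℝ, E) M) ∈ slashedTangentBundle 𝓘(ℝ, E) M := hv
    have h1 := hS.fderiv_radial hu
    rw [extChartAt_tangent_self] at h1
    exact congrArg Prod.snd h1

lemma SmoothOneFormOn.contDiffAt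
    (hθ : SmoothOneFormOn 𝓘(ℝ, E).tangent θ (slashedTangentBundle 𝓘(ℝ, E) M))
    {u : TangentBundle 𝓘(ℝ, E) M} (hu : u ∈ slashedTangentBundle 𝓘(ℝ, E) M) :
    ContDiffAt ℝ ∞ (oneFormInChart 𝓘(ℝ, E).tangent θ u) (extChartAt 𝓘(ℝ, E).tangent u u) :=
  (smoothOneForm_contDiffAt_iff θ u).1
    (hθ.contMDiffAt (isOpen_slashedTangentBundle.mem_nhds hu))

/-- The derivative of a `1`-form in coordinates around `u`. -/
def oneFormDeriv (θ : ∀ u : TangentBundle 𝓘(ℝ, E) M, TangentSpace 𝓘(ℝ, E).tangent u →L[ℝ] ℝ)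
    (u : TangentBundle 𝓘(ℝ, E) M) : E × E →L[ℝ] E × E →L[ℝ] ℝ :=
  fderiv ℝ (oneFormInChart 𝓘(ℝ, E).tangent θ u) (extChartAt 𝓘(ℝ, E).tangent u u)

lemma extDerivOneForm_eq
    (θ : ∀ u : TangentBundle 𝓘(ℝ, E) M, TangentSpace 𝓘(ℝ, E).tangent u →L[ℝ] ℝ)
    (u : TangentBundle 𝓘(ℝ, E) M) (ξ η : TangentSpace 𝓘(ℝ, E).tangent u) :
    extDerivOneForm 𝓘(ℝ, E).tangent θ u ξ η =
      oneFormDeriv θ u (ξ : E × E) (η : E × E) - oneFormDeriv θ u (η : E × E) (ξ : E × E) :=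
  extDerivOneForm_apply θ u ξ η

lemma oneFormInChart_eventuallyEq
    {θ₁ θ₂ : ∀ u : TangentBundle 𝓘(ℝ, E) M, TangentSpace 𝓘(ℝ, E).tangent u →L[ℝ] ℝ}
    (h : ∀ u ∈ slashedTangentBundle 𝓘(ℝ, E) M, θ₁ u = θ₂ u)
    {u : TangentBundle 𝓘(ℝ, E) M} (hu : u ∈ slashedTangentBundle 𝓘(ℝ, E) M) :
    oneFormInChart 𝓘(ℝ, E).tangent θ₁ u =ᶠ[nhds (extChartAt 𝓘(ℝ, E).tangent u u)]
      oneFormInChart 𝓘(ℝ, E).tangent θ₂ u := by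
  filter_upwards [eventually_slashed hu] with z hz
  rw [oneFormInChart, oneFormInChart, h _ hz.2]

lemma oneFormDeriv_congr
    {θ₁ θ₂ : ∀ u : TangentBundle 𝓘(ℝ, E) M, TangentSpace 𝓘(ℝ, E).tangent u →L[ℝ] ℝ}
    (h : ∀ u ∈ slashedTangentBundle 𝓘(ℝ, E) M, θ₁ u = θ₂ u)
    {u : TangentBundle 𝓘(ℝ, E) M} (hu : u ∈ slashedTangentBundle 𝓘(ℝ, E) M) :
    oneFormDeriv θ₁ u = oneFormDeriv θ₂ u :=
  (oneFormInChart_eventuallyEq h hu).fderiv_eq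

lemma extDerivOneForm_congr
    {θ₁ θ₂ : ∀ u : TangentBundle 𝓘(ℝ, E) M, TangentSpace 𝓘(ℝ, E).tangent u →L[ℝ] ℝ}
    (h : ∀ u ∈ slashedTangentBundle 𝓘(ℝ, E) M, θ₁ u = θ₂ u)
    {u : TangentBundle 𝓘(ℝ, E) M} (hu : u ∈ slashedTangentBundle 𝓘(ℝ, E) M) :
    extDerivOneForm 𝓘(ℝ, E).tangent θ₁ u = extDerivOneForm 𝓘(ℝ, E).tangent θ₂ u := by
  refine ContinuousLinearMap.ext fun ξ ↦ ContinuousLinearMap.ext fun η ↦ ?_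
  rw [extDerivOneForm_eq, extDerivOneForm_eq, oneFormDeriv_congr h hu]

/-- The derivative of a semi-basic form is semi-basic. -/
lemma IsSemiBasic.oneFormDeriv_apply (hb : IsSemiBasic 𝓘(ℝ, E) θ)
    (hθ : SmoothOneFormOn 𝓘(ℝ, E).tangent θ (slashedTangentBundle 𝓘(ℝ, E) M))
    {u : TangentBundle 𝓘(ℝ, E) M} (hu : u ∈ slashedTangentBundle 𝓘(ℝ, E) M) (ξ : E × E) (b : E) :
    oneFormDeriv θ u ξ (0, b) = 0 := by
  have hd := ((hθ.contDiffAt hu).differentiableAt (by simp)).hasFDerivAt.clm_apply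
    (hasFDerivAt_const ((0, b) : E × E) _)
  have h0 : (fun z ↦ oneFormInChart 𝓘(ℝ, E).tangent θ u z (0, b))
      =ᶠ[nhds (extChartAt 𝓘(ℝ, E).tangent u u)] fun _ ↦ 0 := by
    filter_upwards [eventually_slashed hu] with z hz
    rw [hb.oneFormInChart_apply hz.1 hz.2]
    exact map_zero _
  have h1 := hd.unique ((hasFDerivAt_const (0 : ℝ) _).congr_of_eventuallyEq h0)
  simpa [oneFormDeriv] using congrArg (fun L : E × E →L[ℝ] ℝ ↦ L ξ) h1

lemma mvfderiv_eq_zero_of_slashed {f : TangentBundle 𝓘(ℝ, E) M → ℝ}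
    (hf : ∀ u ∈ slashedTangentBundle 𝓘(ℝ, E) M, f u = 0) {u : TangentBundle 𝓘(ℝ, E) M}
    (hu : u ∈ slashedTangentBundle 𝓘(ℝ, E) M) : mvfderiv 𝓘(ℝ, E).tangent f u = 0 := by
  have h : f =ᶠ[nhds u] fun _ ↦ 0 := by
    filter_upwards [isOpen_slashedTangentBundle.mem_nhds hu] with w hw using hf w hw
  refine ContinuousLinearMap.ext fun ξ ↦ ?_
  change mfderiv 𝓘(ℝ, E).tangent 𝓘(ℝ, ℝ) f u ξ = 0
  rw [h.mfderiv_eq, mfderiv_const]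
  rfl

/-- Here i_ℂθ = 0, so ℒ_ℂθ = i_ℂdθ. Of the two terms of dθ(ℂ, η), the one that evaluates a
derivative of θ on ℂ vanishes because θ is semi-basic. -/
lemma IsSemiBasic.lieDerivOneForm_liouville (hb : IsSemiBasic 𝓘(ℝ, E) θ)
    (hθ : SmoothOneFormOn 𝓘(ℝ, E).tangent θ (slashedTangentBundle 𝓘(ℝ, E) M))
    {u : TangentBundle 𝓘(ℝ, E) M} (hu : u ∈ slashedTangentBundle 𝓘(ℝ, E) M)
    (η : TangentSpace 𝓘(ℝ, E).tangent u) :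
    lieDerivOneForm 𝓘(ℝ, E).tangent (liouville 𝓘(ℝ, E)) θ u η =
      oneFormDeriv θ u (0, (u.2 : E)) (η : E × E) := by
  have h0 : ∀ w ∈ slashedTangentBundle 𝓘(ℝ, E) M, θ w (liouville 𝓘(ℝ, E) w) = 0 := by
    intro w hw
    refine hb w hw _ ?_
    rw [projDiff_apply, liouville_apply]
    rfl
  rw [lieDerivOneForm, mvfderiv_eq_zero_of_slashed h0 hu, add_zero, extDerivOneForm_eq,
    liouville_apply]
  have := hb.oneFormDeriv_apply hθ hu (η : E × E) (u.2 : E)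
  exact (congrArg (fun r ↦ oneFormDeriv θ u (0, (u.2 : E)) (η : E × E) - r) this).trans (sub_zero _)

/-- Since θ ∘ J = 0, only i_J dθ remains, and two of its four terms evaluate a derivative of θ on a
vertical vector. The result is the antisymmetric part of ∂θ_i/∂yʲ. -/
lemma IsSemiBasic.derivAlongOneForm_tangentStructure (hb : IsSemiBasic 𝓘(ℝ, E) θ)
    (hθ : SmoothOneFormOn 𝓘(ℝ, E).tangent θ (slashedTangentBundle 𝓘(ℝ, E) M))
    {u : TangentBundle 𝓘(ℝ, E) M} (hu : u ∈ slashedTangentBundle 𝓘(ℝ, E) M)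
    (ξ η : TangentSpace 𝓘(ℝ, E).tangent u) :
    derivAlongOneForm 𝓘(ℝ, E).tangent (tangentStructure 𝓘(ℝ, E)) θ u ξ η =
      oneFormDeriv θ u (0, (ξ : E × E).1) (η : E × E) -
        oneFormDeriv θ u (0, (η : E × E).1) (ξ : E × E) := by
  have h0 : ∀ w ∈ slashedTangentBundle 𝓘(ℝ, E) M,
      (θ w).comp (tangentStructure 𝓘(ℝ, E) w) = 0 := by
    intro w hw
    refine ContinuousLinearMap.ext fun ζ ↦ hb w hw _ ?_
    exact (projDiff_apply w _).trans (congrArg (Prod.fst : E × E → E) (tangentStructure_apply w ζ))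
  have h1 : oneFormDeriv (fun w : TangentBundle 𝓘(ℝ, E) M ↦
      (0 : TangentSpace 𝓘(ℝ, E).tangent w →L[ℝ] ℝ)) u = 0 := by
    have : oneFormInChart 𝓘(ℝ, E).tangent (fun w : TangentBundle 𝓘(ℝ, E) M ↦
      (0 : TangentSpace 𝓘(ℝ, E).tangent w →L[ℝ] ℝ)) u = fun _ ↦ 0 := rfl
    rw [oneFormDeriv, this, fderiv_const_apply]
  rw [derivAlongOneForm, extDerivOneForm_congr h0 hu, extDerivOneForm_eq, extDerivOneForm_eq,
    extDerivOneForm_eq, h1, tangentStructure_apply, tangentStructure_apply]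
  have e1 := hb.oneFormDeriv_apply hθ hu (η : E × E) (ξ : E × E).1
  have e2 := hb.oneFormDeriv_apply hθ hu (ξ : E × E) (η : E × E).1
  have aux : ∀ a b c d : ℝ, b = 0 → c = 0 → a - b + (c - d) - (0 - 0) = a - d := by
    intros; subst_vars; ring
  exact aux _ _ _ _ e1 e2

/-- The vectors hξ and ξ have the same projection to M, so θ ∘ h = θ and the last term of d_hθ is
dθ. -/
lemma IsSemiBasic.derivAlongOneForm_horizontalProjector (hb : IsSemiBasic 𝓘(ℝ, E) θ)
    (hS : IsSpray 𝓘(ℝ, E) S) {u : TangentBundle 𝓘(ℝ, E) M}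
    (hu : u ∈ slashedTangentBundle 𝓘(ℝ, E) M) (ξ η : TangentSpace 𝓘(ℝ, E).tangent u) :
    derivAlongOneForm 𝓘(ℝ, E).tangent (horizontalProjector 𝓘(ℝ, E) S) θ u ξ η =
      extDerivOneForm 𝓘(ℝ, E).tangent θ u
          (((ξ : E × E).1, sprayConnection S u (ξ : E × E).1) : E × E) η +
        extDerivOneForm 𝓘(ℝ, E).tangent θ u ξ
          (((η : E × E).1, sprayConnection S u (η : E × E).1) : E × E) -
        extDerivOneForm 𝓘(ℝ, E).tangent θ u ξ η := by
  have h0 : ∀ w ∈ slashedTangentBundle 𝓘(ℝ, E) M,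
      (θ w).comp (horizontalProjector 𝓘(ℝ, E) S w) = θ w := by
    intro w hw
    refine ContinuousLinearMap.ext fun ζ ↦ ?_
    rw [ContinuousLinearMap.comp_apply, hS.horizontalProjector_apply hw]
    exact hb.apply_eq hw rfl
  rw [derivAlongOneForm, extDerivOneForm_congr h0 hu, hS.horizontalProjector_apply hu,
    hS.horizontalProjector_apply hu]

end Fibers

/-! ### Solving the reparametrization equation on an interval -/

section Reparametrization

/-- A smooth function on an open interval has a smooth antiderivative. -/
lemma exists_antideriv {s : Set ℝ} (hs : IsOpenInterval s) {α : ℝ → ℝ}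
    (hα : ContDiffOn ℝ ∞ α s) :
    ∃ A : ℝ → ℝ, ContDiffOn ℝ ∞ A s ∧ ∀ t ∈ s, HasDerivAt A (α t) t := by
  obtain ⟨ho, hc, t₀, ht₀⟩ := hs
  have hd : ∀ t ∈ s, HasDerivAt (fun t ↦ ∫ r in t₀..t, α r) (α t) t := by
    intro t ht
    refine intervalIntegral.integral_hasDerivAt_right
      ((hα.continuousOn.mono (hc.uIcc_subset ht₀ ht)).intervalIntegrable)
      (hα.continuousOn.stronglyMeasurableAtFilter ho t ht)
      (hα.continuousOn.continuousAt (ho.mem_nhds ht))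
  refine ⟨_, ?_, hd⟩
  rw [contDiffOn_infty_iff_deriv_of_isOpen ho]
  exact ⟨fun t ht ↦ (hd t ht).differentiableAt.differentiableWithinAt,
    hα.congr fun t ht ↦ (hd t ht).deriv⟩

/-- The inverse of an increasing smooth function on an open interval. -/
lemma exists_orientedReparam_inverse {s : Set ℝ} (hs : IsOpenInterval s) {ψ : ℝ → ℝ}
    (hψ : ContDiffOn ℝ ∞ ψ s) (hpos : ∀ t ∈ s, 0 < deriv ψ t) :
    ∃ (φ : ℝ → ℝ) (s' : Set ℝ), IsOrientedReparam φ s' s ∧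
      ∀ r ∈ s', HasDerivAt φ (deriv ψ (φ r))⁻¹ r := by
  obtain ⟨ho, hc, hne⟩ := hs
  have hmono : StrictMonoOn ψ s := by
    refine strictMonoOn_of_deriv_pos hc.convex hψ.continuousOn fun t ht ↦ hpos t ?_
    exact interior_subset ht
  have hct : ∀ t ∈ s, ContDiffAt ℝ ∞ ψ t := fun t ht ↦ hψ.contDiffAt (ho.mem_nhds ht)
  have hstrict : ∀ t ∈ s, HasStrictDerivAt ψ (deriv ψ t) t := fun t ht ↦
    (hct t ht).hasStrictDerivAt (by simp)
  have hφ : ∀ t ∈ s, Function.invFunOn ψ s (ψ t) = t := fun t ht ↦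
    hmono.injOn.leftInvOn_invFunOn ht
  have hmap : ∀ t ∈ s, Filter.map ψ (nhds t) = nhds (ψ t) := fun t ht ↦
    (hstrict t ht).map_nhds_eq (hpos t ht).ne'
  have hcont : ∀ t ∈ s, ContDiffAt ℝ ∞ (Function.invFunOn ψ s) (ψ t) := by
    intro t ht
    have hf' : HasFDerivAt ψ ((ContinuousLinearEquiv.unitsEquivAut ℝ
        (Units.mk0 _ (hpos t ht).ne') : ℝ ≃L[ℝ] ℝ) : ℝ →L[ℝ] ℝ) t := by
      refine ((hct t ht).differentiableAt (by simp)).hasDerivAt.hasFDerivAt.congr_fderiv ?_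
      ext
      simp
    have h1 := (hct t ht).to_localInverse hf' (by simp)
    refine h1.congr_of_eventuallyEq ?_
    have h2 : ∀ᶠ w in nhds t, (hct t ht).localInverse hf' (by simp) (ψ w) = w :=
      ((hct t ht).hasStrictFDerivAt' hf' (by simp)).eventually_left_inverse
    -- Neighbourhoods of ψ t are images of neighbourhoods of t, so the two inverses need only be
    -- compared at points ψ w.
    rw [Filter.EventuallyEq, ← hmap t ht, Filter.eventually_map]
    filter_upwards [h2, ho.mem_nhds ht] with w hw hw'
    rw [hw, hφ w hw']
  have hder : ∀ t ∈ s, HasDerivAt (Function.invFunOn ψ s) (deriv ψ t)⁻¹ (ψ t) := by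
    intro t ht
    have h1 := ((hcont t ht).differentiableAt (by simp)).hasDerivAt
    have h2 := h1.comp t (hstrict t ht).hasDerivAt
    have h3 : Function.invFunOn ψ s ∘ ψ =ᶠ[nhds t] id := by
      filter_upwards [ho.mem_nhds ht] with w hw using hφ w hw
    have h4 := h2.unique ((hasDerivAt_id t).congr_of_eventuallyEq h3)
    rwa [eq_inv_of_mul_eq_one_left h4] at h1
  refine ⟨Function.invFunOn ψ s, ψ '' s, ⟨⟨?_, ?_, hne.image _⟩, ?_, ?_, ?_⟩, ?_⟩
  · rw [isOpen_iff_mem_nhds]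
    rintro _ ⟨t, ht, rfl⟩
    rw [← hmap t ht]
    exact Filter.image_mem_map (ho.mem_nhds ht)
  · exact (hc.isPreconnected.image _ hψ.continuousOn).ordConnected
  · refine ⟨?_, ?_, ?_⟩
    · rintro _ ⟨t, ht, rfl⟩
      rwa [hφ t ht]
    · rintro _ ⟨t, ht, rfl⟩ _ ⟨r, hr, rfl⟩ h
      rw [hφ t ht, hφ r hr] at h
      rw [h]
    · intro t ht
      exact ⟨ψ t, mem_image_of_mem _ ht, hφ t ht⟩
  · rintro _ ⟨t, ht, rfl⟩
    exact (hcont t ht).contDiffWithinAt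
  · rintro _ ⟨t, ht, rfl⟩
    rw [(hder t ht).deriv]
    exact inv_pos.2 (hpos t ht)
  · rintro _ ⟨t, ht, rfl⟩
    rw [hφ t ht]
    exact hder t ht

/-- The reparametrizations `φ` solving `φ'' = φ'² α(φ)`. -/
lemma exists_orientedReparam {s : Set ℝ} (hs : IsOpenInterval s) {α : ℝ → ℝ}
    (hα : ContDiffOn ℝ ∞ α s) :
    ∃ (φ : ℝ → ℝ) (s' : Set ℝ), IsOrientedReparam φ s' s ∧
      ∀ r ∈ s', deriv (deriv φ) r = deriv φ r ^ 2 * α (φ r) := by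
  obtain ⟨A, hA, hA'⟩ := exists_antideriv hs hα
  -- With A' = α and ψ' = exp(-A), the inverse φ of ψ has φ' = exp(A ∘ φ), whence φ'' = φ'² α(φ).
  obtain ⟨ψ, hψ, hψ'⟩ := exists_antideriv hs (hA.neg.exp)
  obtain ⟨φ, s', hφ, hφ'⟩ := exists_orientedReparam_inverse hs hψ
    (fun t ht ↦ by rw [(hψ' t ht).deriv]; exact Real.exp_pos _)
  refine ⟨φ, s', hφ, fun r hr ↦ ?_⟩
  have h1 : ∀ r ∈ s', HasDerivAt φ (Real.exp (A (φ r))) r := fun r hr ↦ by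
    have := hφ' r hr
    rwa [(hψ' _ (hφ.bijOn.mapsTo hr)).deriv, ← Real.exp_neg, neg_neg] at this
  have h2 : deriv φ =ᶠ[nhds r] fun r ↦ Real.exp (A (φ r)) := by
    filter_upwards [hφ.isOpenInterval.1.mem_nhds hr] with w hw using (h1 w hw).deriv
  have h3 := ((hA' _ (hφ.bijOn.mapsTo hr)).comp r (h1 r hr)).exp
  have h4 : HasDerivAt (fun r ↦ Real.exp (A (φ r))) _ r := h3
  rw [h2.deriv_eq, h4.deriv, (h1 r hr).deriv]
  simp only [Function.comp]
  ring

end Reparametrization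

/-! ### Tangent lifts and the geodesic equation in coordinates -/

section Curves

variable {E : Type*} [NormedAddCommGroup E] [NormedSpace ℝ E]
  {M : Type*} [TopologicalSpace M] [ChartedSpace E M] [IsManifold 𝓘(ℝ, E) ∞ M]
  {S : ∀ u : TangentBundle 𝓘(ℝ, E) M, TangentSpace 𝓘(ℝ, E).tangent u} {c : ℝ → M} {t : ℝ}

/-- The coordinate expression of a curve in the chart around the point with parameter `t`. -/
def curveInChart (E : Type*) [NormedAddCommGroup E] [NormedSpace ℝ E]
    {M : Type*} [TopologicalSpace M] [ChartedSpace E M] (c : ℝ → M) (t r : ℝ) : E :=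
  extChartAt 𝓘(ℝ, E) (c t) (c r)

omit [IsManifold 𝓘(ℝ, E) ∞ M] in
lemma contDiffAt_curveInChart (hc : ContMDiffAt 𝓘(ℝ, ℝ) 𝓘(ℝ, E) ∞ c t) :
    ContDiffAt ℝ ∞ (curveInChart E c t) t := by
  have h := (contMDiffAt_iff.1 hc).2
  rw [ModelWithCorners.range_eq_univ, contDiffWithinAt_univ] at h
  exact h

lemma deriv_curveInChart {r : ℝ} (hc : MDifferentiableAt 𝓘(ℝ, ℝ) 𝓘(ℝ, E) c r)
    (hr : c r ∈ (extChartAt 𝓘(ℝ, E) (c t)).source) :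
    chartDiff 𝓘(ℝ, E) (c t) (c r) (mfderiv 𝓘(ℝ, ℝ) 𝓘(ℝ, E) c r (1 : ℝ)) =
      deriv (curveInChart E c t) r := by
  rw [extChartAt_source] at hr
  have h := mfderiv_comp r (mdifferentiableAt_extChartAt (I := 𝓘(ℝ, E)) hr) hc
  have h1 : mfderiv 𝓘(ℝ, ℝ) 𝓘(ℝ, E) (extChartAt 𝓘(ℝ, E) (c t) ∘ c) r =
    fderiv ℝ (curveInChart E c t) r := mfderiv_eq_fderiv
  rw [h1] at h
  exact (congrArg (fun L : ℝ →L[ℝ] E ↦ L 1) h).symm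

lemma tangentLift_snd (hc : MDifferentiableAt 𝓘(ℝ, ℝ) 𝓘(ℝ, E) c t) :
    ((tangentLift 𝓘(ℝ, E) c t).2 : E) = deriv (curveInChart E c t) t := by
  rw [← deriv_curveInChart hc (mem_extChartAt_source _), chartDiff_self_apply]
  rfl

lemma eventually_extChartAt_tangentLift (hc : ContMDiffAt 𝓘(ℝ, ℝ) 𝓘(ℝ, E) ∞ c t) :
    ∀ᶠ r in nhds t, c r ∈ (extChartAt 𝓘(ℝ, E) (c t)).source ∧
      extChartAt 𝓘(ℝ, E).tangent (tangentLift 𝓘(ℝ, E) c t) (tangentLift 𝓘(ℝ, E) c r) =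
        (curveInChart E c t r, deriv (curveInChart E c t) r) := by
  have h1 : ∀ᶠ r in nhds t, ContMDiffAt 𝓘(ℝ, ℝ) 𝓘(ℝ, E) 1 c r :=
    contMDiffAt_iff_contMDiffAt_nhds (by simp) |>.1 (hc.of_le (mod_cast le_top))
  filter_upwards [h1, hc.continuousAt.preimage_mem_nhds
    (extChartAt_source_mem_nhds (I := 𝓘(ℝ, E)) (c t))] with r hr hr'
  refine ⟨hr', ?_⟩
  rw [extChartAt_tangent_apply (p := tangentLift 𝓘(ℝ, E) c t) (w := tangentLift 𝓘(ℝ, E) c r) hr',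
    ← deriv_curveInChart (hr.mdifferentiableAt one_ne_zero) hr']
  rfl

omit [IsManifold 𝓘(ℝ, E) ∞ M] in
lemma contDiffAt_deriv_curveInChart (hc : ContMDiffAt 𝓘(ℝ, ℝ) 𝓘(ℝ, E) ∞ c t) :
    ContDiffAt ℝ ∞ (deriv (curveInChart E c t)) t := by
  have h := (contDiffAt_curveInChart hc).fderiv_right (m := ∞) (by simp)
  exact (h.clm_apply contDiffAt_const : ContDiffAt ℝ ∞ (fun r ↦ fderiv ℝ (curveInChart E c t) r 1) t)

lemma contMDiffAt_tangentLift (hc : ContMDiffAt 𝓘(ℝ, ℝ) 𝓘(ℝ, E) ∞ c t) :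
    ContMDiffAt 𝓘(ℝ, ℝ) 𝓘(ℝ, E).tangent ∞ (tangentLift 𝓘(ℝ, E) c) t := by
  rw [contMDiffAt_totalSpace]
  refine ⟨hc, ?_⟩
  refine (contDiffAt_deriv_curveInChart hc).contMDiffAt.congr_of_eventuallyEq ?_
  filter_upwards [eventually_extChartAt_tangentLift hc] with r hr
  rw [FiberBundle.extChartAt] at hr
  exact congrArg Prod.snd hr.2

lemma mfderiv_tangentLift (hc : ContMDiffAt 𝓘(ℝ, ℝ) 𝓘(ℝ, E) ∞ c t) :
    mfderiv 𝓘(ℝ, ℝ) 𝓘(ℝ, E).tangent (tangentLift 𝓘(ℝ, E) c) t (1 : ℝ) =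
      ((deriv (curveInChart E c t) t, deriv (deriv (curveInChart E c t)) t) : E × E) := by
  have h1 := (contMDiffAt_tangentLift hc).mdifferentiableAt (by simp)
  rw [h1.mfderiv]
  have h2 : writtenInExtChartAt 𝓘(ℝ, ℝ) 𝓘(ℝ, E).tangent t (tangentLift 𝓘(ℝ, E) c) =ᶠ[nhds t]
      fun r ↦ (curveInChart E c t r, deriv (curveInChart E c t) r) := by
    filter_upwards [eventually_extChartAt_tangentLift hc] with r hr using hr.2
  have h3 := ((contDiffAt_curveInChart hc).differentiableAt (by simp)).hasDerivAt.prodMk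
    ((contDiffAt_deriv_curveInChart hc).differentiableAt (by simp)).hasDerivAt
  have h4 := (h3.congr_of_eventuallyEq h2).hasFDerivAt.fderiv
  have h5 : fderivWithin ℝ (writtenInExtChartAt 𝓘(ℝ, ℝ) 𝓘(ℝ, E).tangent t
      (tangentLift 𝓘(ℝ, E) c)) (range 𝓘(ℝ, ℝ)) (extChartAt 𝓘(ℝ, ℝ) t t) =
      fderiv ℝ (writtenInExtChartAt 𝓘(ℝ, ℝ) 𝓘(ℝ, E).tangent t (tangentLift 𝓘(ℝ, E) c)) t := by
    rw [ModelWithCorners.range_eq_univ, fderivWithin_univ]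
    rfl
  have h6 := h5.trans h4
  refine (congrArg (fun L : ℝ →L[ℝ] E × E ↦ L 1) h6).trans ?_
  simp

/-- The geodesic equation in coordinates. -/
lemma geodesic_equation_iff (hS : ∀ u ∈ slashedTangentBundle 𝓘(ℝ, E) M,
      tangentStructure 𝓘(ℝ, E) u (S u) = liouville 𝓘(ℝ, E) u)
    (hc : ContMDiffAt 𝓘(ℝ, ℝ) 𝓘(ℝ, E) ∞ c t)
    (ht : tangentLift 𝓘(ℝ, E) c t ∈ slashedTangentBundle 𝓘(ℝ, E) M) :
    mfderiv 𝓘(ℝ, ℝ) 𝓘(ℝ, E).tangent (tangentLift 𝓘(ℝ, E) c) t (1 : ℝ) =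
        S (tangentLift 𝓘(ℝ, E) c t) ↔
      deriv (deriv (curveInChart E c t)) t = (S (tangentLift 𝓘(ℝ, E) c t) : E × E).2 := by
  rw [mfderiv_tangentLift hc]
  have h1 := (spray_fst hS ht).trans (tangentLift_snd (hc.mdifferentiableAt (by simp)))
  refine ⟨fun h ↦ congrArg (Prod.snd : E × E → E) h, fun h ↦ ?_⟩
  exact Prod.ext h1.symm h

end Curves

/-! ### Smoothness of integral curves -/

section IntegralCurves

variable {E : Type*} [NormedAddCommGroup E] [NormedSpace ℝ E] {H : Type*} [TopologicalSpace H]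
  {I : ModelWithCorners ℝ E H} {N : Type*} [TopologicalSpace N] [ChartedSpace H N]
  [IsManifold I ∞ N] [I.Boundaryless]

/-- Integral curves of smooth vector fields are smooth. -/
lemma contMDiffOn_of_isMIntegralCurveOn {X : ∀ u : N, TangentSpace I u} {γ : ℝ → N} {s : Set ℝ}
    (hs : IsOpen s) (hX : ∀ t ∈ s, ContMDiffAt I I.tangent ∞ (fun u ↦ (⟨u, X u⟩ : TangentBundle I N)) (γ t))
    (hγ : ∀ t ∈ s, HasMFDerivAt 𝓘(ℝ, ℝ) I γ t ((1 : ℝ →L[ℝ] ℝ).smulRight (X (γ t)))) :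
    ContMDiffOn 𝓘(ℝ, ℝ) I ∞ γ s := by
  have hcurve : ∀ t ∈ s, ∀ᶠ r in nhds t, HasDerivAt (fun r ↦ extChartAt I (γ t) (γ r))
      (vectorFieldInChart I X (γ t) (extChartAt I (γ t) (γ r))) r := by
    intro t ht
    filter_upwards [hs.mem_nhds ht, (hγ t ht).continuousAt.preimage_mem_nhds
      (extChartAt_source_mem_nhds (I := I) (γ t))] with r hr hr'
    have hr'' : γ r ∈ (chartAt H (γ t)).source := by rwa [← extChartAt_source I]
    have h1 := (mdifferentiableAt_extChartAt (I := I) hr'').hasMFDerivAt.comp r (hγ r hr)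
    have h2 : HasFDerivAt (fun r ↦ extChartAt I (γ t) (γ r)) ((1 : ℝ →L[ℝ] ℝ).smulRight
        (chartDiff I (γ t) (γ r) (X (γ r)))) r := by
      refine h1.hasFDerivAt.congr_fderiv ?_
      refine ContinuousLinearMap.ext fun (a : ℝ) ↦ ?_
      exact ContinuousLinearMap.map_smul (chartDiff I (γ t) (γ r) : E →L[ℝ] E) a (X (γ r) : E)
    have h3 := h2.hasDerivAt
    have h4 : vectorFieldInChart I X (γ t) (extChartAt I (γ t) (γ r)) =
        chartDiff I (γ t) (γ r) (X (γ r)) := by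
      rw [vectorFieldInChart, (extChartAt I (γ t)).left_inv hr']
    rw [h4]
    refine h3.congr_deriv ?_
    simp
  -- Bootstrap: in a chart γ' = X ∘ γ, so if γ is of class Cⁿ, so is γ', and γ is of class Cⁿ⁺¹.
  have hind : ∀ n : ℕ, ∀ t ∈ s, ContMDiffAt 𝓘(ℝ, ℝ) I n γ t := by
    intro n
    induction n with
    | zero =>
      intro t ht
      have : ContinuousOn γ s := fun t ht ↦ (hγ t ht).continuousAt.continuousWithinAt
      exact (contMDiffOn_zero_iff.2 this).contMDiffAt (hs.mem_nhds ht)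
    | succ n ih =>
      intro t ht
      have h1 := ih t ht
      rw [contMDiffAt_iff, ModelWithCorners.range_eq_univ, contDiffWithinAt_univ] at h1 ⊢
      refine ⟨h1.1, ?_⟩
      have h2 : ContDiffAt ℝ n (fun r ↦ extChartAt I (γ t) (γ r)) t := h1.2
      change ContDiffAt ℝ ((n + 1 : ℕ) : WithTop ℕ∞) (fun r ↦ extChartAt I (γ t) (γ r)) t
      push_cast
      rw [contDiffAt_succ_iff_hasFDerivAt]
      refine ⟨fun r ↦ (1 : ℝ →L[ℝ] ℝ).smulRight
        (vectorFieldInChart I X (γ t) (extChartAt I (γ t) (γ r))), ?_, ?_⟩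
      · refine ⟨_, hcurve t ht, fun r hr ↦ ?_⟩
        exact HasDerivAt.hasFDerivAt hr
      · have h3 := (smoothVectorField_contDiffAt_iff X (γ t)).1 (hX t ht)
        have h4 : ContDiffAt ℝ n
            (fun r ↦ vectorFieldInChart I X (γ t) (extChartAt I (γ t) (γ r))) t :=
          ContDiffAt.comp (g := vectorFieldInChart I X (γ t)) t (h3.of_le (mod_cast le_top)) h2
        exact contDiffAt_const.smulRight h4
  intro t ht
  exact (contMDiffAt_infty.2 fun n ↦ hind n t ht).contMDiffWithinAt

end IntegralCurves

/-! ### Projective equivalence as a difference by a multiple of ℂ -/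

section Geodesics

variable {E : Type*} [NormedAddCommGroup E] [NormedSpace ℝ E]
  {M : Type*} [TopologicalSpace M] [ChartedSpace E M] [IsManifold 𝓘(ℝ, E) ∞ M]
  {S S₁ S₂ : ∀ u : TangentBundle 𝓘(ℝ, E) M, TangentSpace 𝓘(ℝ, E).tangent u}

/-- Project an integral curve γ of S to M. Because JS = ℂ, the velocity of the projection is γ
itself, so γ is the tangent lift and its equation is the geodesic equation. -/
lemma IsSpray.exists_geodesic [CompleteSpace E] (hS : IsSpray 𝓘(ℝ, E) S)
    {u : TangentBundle 𝓘(ℝ, E) M} (hu : u ∈ slashedTangentBundle 𝓘(ℝ, E) M) :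
    ∃ (c : ℝ → M) (s : Set ℝ), IsGeodesicOn 𝓘(ℝ, E) S c s ∧ (0 : ℝ) ∈ s ∧
      tangentLift 𝓘(ℝ, E) c 0 = u := by
  have hsm : ∀ w ∈ slashedTangentBundle 𝓘(ℝ, E) M, ContMDiffAt 𝓘(ℝ, E).tangent
      𝓘(ℝ, E).tangent.tangent ∞ (fun u ↦ (⟨u, S u⟩ :
        TangentBundle 𝓘(ℝ, E).tangent (TangentBundle 𝓘(ℝ, E) M))) w :=
    fun w hw ↦ hS.smooth.contMDiffAt (isOpen_slashedTangentBundle.mem_nhds hw)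
  obtain ⟨γ, h0, hγ⟩ := exists_isMIntegralCurveAt_of_contMDiffAt_boundaryless
    (I := 𝓘(ℝ, E).tangent) (v := S) 0 ((hsm u hu).of_le (mod_cast le_top))
  have h1 : ∀ᶠ t in nhds (0 : ℝ), HasMFDerivAt 𝓘(ℝ, ℝ) 𝓘(ℝ, E).tangent γ t
      ((1 : ℝ →L[ℝ] ℝ).smulRight (S (γ t))) := hγ
  have h2 : ∀ᶠ t in nhds (0 : ℝ), γ t ∈ slashedTangentBundle 𝓘(ℝ, E) M :=
    hγ.continuousAt.preimage_mem_nhds (isOpen_slashedTangentBundle.mem_nhds (h0 ▸ hu))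
  obtain ⟨ε, hε, hball⟩ := Metric.eventually_nhds_iff_ball.1 (h1.and h2)
  have hsmooth : ContMDiffOn 𝓘(ℝ, ℝ) 𝓘(ℝ, E).tangent ∞ γ (Metric.ball 0 ε) :=
    contMDiffOn_of_isMIntegralCurveOn Metric.isOpen_ball
      (fun t ht ↦ hsm _ (hball t ht).2) (fun t ht ↦ (hball t ht).1)
  have hlift : ∀ t ∈ Metric.ball (0 : ℝ) ε, tangentLift 𝓘(ℝ, E) (fun t ↦ (γ t).1) t = γ t := by
    intro t ht
    have e1 : MDifferentiableAt 𝓘(ℝ, E).tangent 𝓘(ℝ, E)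
        (fun w : TangentBundle 𝓘(ℝ, E) M ↦ w.1) (γ t) :=
      (contMDiffAt_proj (n := 1) (TangentSpace 𝓘(ℝ, E))).mdifferentiableAt one_ne_zero
    have e2 := (e1.hasMFDerivAt.comp t (hball t ht).1).mfderiv
    have e3 : mfderiv 𝓘(ℝ, ℝ) 𝓘(ℝ, E) (fun t ↦ (γ t).1) t (1 : ℝ) =
        projDiff 𝓘(ℝ, E) (γ t) ((1 : ℝ) • S (γ t)) := congrArg (fun L : ℝ →L[ℝ] E ↦ L 1) e2
    rw [one_smul, projDiff_apply] at e3
    have e4 := e3.trans (spray_fst hS.tangentStructure_apply (hball t ht).2)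
    unfold tangentLift
    exact congrArg (TotalSpace.mk (γ t).1) e4
  refine ⟨fun t ↦ (γ t).1, Metric.ball 0 ε, ⟨⟨Metric.isOpen_ball, ?_, ?_⟩, ?_, ?_, ?_⟩, ?_, ?_⟩
  · exact (convex_ball 0 ε).ordConnected
  · exact ⟨0, Metric.mem_ball_self hε⟩
  · exact (contMDiff_proj (TangentSpace 𝓘(ℝ, E))).comp_contMDiffOn hsmooth
  · intro t ht
    rw [hlift t ht]
    exact (hball t ht).2
  · intro t ht
    have e1 : tangentLift 𝓘(ℝ, E) (fun t ↦ (γ t).1) =ᶠ[nhds t] γ := by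
      filter_upwards [Metric.isOpen_ball.mem_nhds ht] with r hr using hlift r hr
    have e2 : mfderiv 𝓘(ℝ, ℝ) 𝓘(ℝ, E).tangent (tangentLift 𝓘(ℝ, E) (fun t ↦ (γ t).1)) t (1 : ℝ) =
        ((1 : ℝ →L[ℝ] ℝ).smulRight (S (γ t)) : ℝ →L[ℝ] E × E) 1 :=
      congrArg (fun L : ℝ →L[ℝ] E × E ↦ L 1)
        (((hball t ht).1.congr_of_eventuallyEq e1).mfderiv)
    rw [hlift t ht]
    refine e2.trans ?_
    change (1 : ℝ) • (S (γ t) : E × E) = (S (γ t) : E × E)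
    exact one_smul ℝ _
  · exact Metric.mem_ball_self hε
  · rw [hlift 0 (Metric.mem_ball_self hε), h0]

/-- A tangent vector as an element of the model space, in the preferred chart at its base point. -/
def fiberCoord (u : TangentBundle 𝓘(ℝ, E) M) : E := u.2

/-- The first and second derivatives of a reparametrized curve. -/
lemma deriv_comp_reparam {F : Type*} [NormedAddCommGroup F] [NormedSpace ℝ F] {X : ℝ → F}
    {φ : ℝ → ℝ} {r : ℝ} (hX : ContDiffAt ℝ ∞ X (φ r)) (hφ : ContDiffAt ℝ ∞ φ r) :
    deriv (X ∘ φ) r = deriv φ r • deriv X (φ r) ∧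
      deriv (deriv (X ∘ φ)) r =
        deriv (deriv φ) r • deriv X (φ r) + deriv φ r ^ 2 • deriv (deriv X) (φ r) := by
  have hφ1 : ∀ᶠ q in nhds r, DifferentiableAt ℝ φ q := by
    have := (hφ.of_le (m := 1) (mod_cast le_top)).eventually (by simp)
    filter_upwards [this] with q hq using hq.differentiableAt (by simp)
  have hX1 : ∀ᶠ q in nhds (φ r), DifferentiableAt ℝ X q := by
    have := (hX.of_le (m := 1) (mod_cast le_top)).eventually (by simp)
    filter_upwards [this] with q hq using hq.differentiableAt (by simp)
  have h1 : deriv (X ∘ φ) =ᶠ[nhds r] fun q ↦ deriv φ q • deriv X (φ q) := by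
    filter_upwards [hφ1, hφ.continuousAt.eventually hX1] with q hq hq'
    exact deriv.scomp q hq' hq
  refine ⟨h1.eq_of_nhds, ?_⟩
  have hφ2 : DifferentiableAt ℝ (deriv φ) r := by
    have h := (hφ.fderiv_right (m := ∞) (by simp)).clm_apply (contDiffAt_const (c := (1 : ℝ)))
    exact h.differentiableAt (by simp)
  have hX2 : DifferentiableAt ℝ (deriv X) (φ r) := by
    have h := (hX.fderiv_right (m := ∞) (by simp)).clm_apply (contDiffAt_const (c := (1 : ℝ)))
    exact h.differentiableAt (by simp)
  have h2 := hφ2.hasDerivAt.smul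
    (hX2.hasDerivAt.scomp r (hφ.differentiableAt (by simp)).hasDerivAt)
  rw [h1.deriv_eq]
  refine h2.deriv.trans ?_
  simp only [Function.comp]
  module

lemma IsOrientedReparam.contDiffAt {φ : ℝ → ℝ} {s' s : Set ℝ} (h : IsOrientedReparam φ s' s)
    {r : ℝ} (hr : r ∈ s') : ContDiffAt ℝ ∞ φ r :=
  h.smooth.contDiffAt (h.isOpenInterval.1.mem_nhds hr)

lemma IsGeodesicOn.contMDiffAt {c : ℝ → M} {s : Set ℝ} (h : IsGeodesicOn 𝓘(ℝ, E) S c s)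
    {t : ℝ} (ht : t ∈ s) : ContMDiffAt 𝓘(ℝ, ℝ) 𝓘(ℝ, E) ∞ c t :=
  h.smooth.contMDiffAt (h.isOpenInterval.1.mem_nhds ht)

lemma tangentLift_comp {c : ℝ → M} {φ : ℝ → ℝ} {r : ℝ}
    (hc : ContMDiffAt 𝓘(ℝ, ℝ) 𝓘(ℝ, E) ∞ c (φ r)) (hφ : ContDiffAt ℝ ∞ φ r) :
    tangentLift 𝓘(ℝ, E) (c ∘ φ) r =
      ⟨c (φ r), deriv φ r • (tangentLift 𝓘(ℝ, E) c (φ r)).2⟩ := by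
  have h1 := tangentLift_snd ((hc.comp r hφ.contMDiffAt).mdifferentiableAt (by simp))
  have h2 := tangentLift_snd (hc.mdifferentiableAt (by simp))
  have h3 := (deriv_comp_reparam (contDiffAt_curveInChart hc) hφ).1
  have h4 : ((tangentLift 𝓘(ℝ, E) (c ∘ φ) r).2 : E) =
      deriv φ r • ((tangentLift 𝓘(ℝ, E) c (φ r)).2 : E) := by
    refine h1.trans (h3.trans ?_)
    exact congrArg (fun v : E ↦ deriv φ r • v) h2.symm
  exact congrArg (TotalSpace.mk (c (φ r))) h4

/-- For a geodesic c of S₁, (c ∘ φ)'' = φ'' c' + φ'² c'', while degree-two homogeneity gives the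
second component of S₂ at φ'c' as φ'² (c'' + a c'). The two agree when φ'' = φ'² a(c'), which
`exists_orientedReparam` solves. -/
lemma geodesicsReparamTo_of_eq_add_liouville (hS₁ : IsSpray 𝓘(ℝ, E) S₁) (hS₂ : IsSpray 𝓘(ℝ, E) S₂)
    {a : TangentBundle 𝓘(ℝ, E) M → ℝ}
    (ha : ContMDiffOn 𝓘(ℝ, E).tangent 𝓘(ℝ, ℝ) ∞ a (slashedTangentBundle 𝓘(ℝ, E) M))
    (h : ∀ u ∈ slashedTangentBundle 𝓘(ℝ, E) M,
      (S₂ u : E × E).2 = (S₁ u : E × E).2 + a u • fiberCoord u) :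
    GeodesicsReparamTo 𝓘(ℝ, E) S₁ S₂ := by
  intro c s hc
  have hα : ContDiffOn ℝ ∞ (fun t ↦ a (tangentLift 𝓘(ℝ, E) c t)) s := by
    intro t ht
    have h1 := ContMDiffAt.comp t (ha.contMDiffAt (isOpen_slashedTangentBundle.mem_nhds (hc.regular t ht)))
      (contMDiffAt_tangentLift (hc.contMDiffAt ht))
    exact h1.contDiffAt.contDiffWithinAt
  obtain ⟨φ, s', hφ, hφ'⟩ := exists_orientedReparam hc.isOpenInterval hα
  refine ⟨φ, s', hφ, hφ.isOpenInterval, ?_, ?_, ?_⟩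
  · intro r hr
    exact ((hc.contMDiffAt (hφ.bijOn.mapsTo hr)).comp r
      (hφ.contDiffAt hr).contMDiffAt).contMDiffWithinAt
  · intro r hr
    rw [tangentLift_comp (hc.contMDiffAt (hφ.bijOn.mapsTo hr)) (hφ.contDiffAt hr)]
    exact smul_ne_zero (hφ.deriv_pos r hr).ne' (hc.regular _ (hφ.bijOn.mapsTo hr))
  · intro r hr
    have ht := hφ.bijOn.mapsTo hr
    have hct := hc.contMDiffAt ht
    have e0 := tangentLift_comp hct (hφ.contDiffAt hr)
    have hreg : tangentLift 𝓘(ℝ, E) (c ∘ φ) r ∈ slashedTangentBundle 𝓘(ℝ, E) M := by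
      rw [e0]
      exact smul_ne_zero (hφ.deriv_pos r hr).ne' (hc.regular _ ht)
    rw [geodesic_equation_iff hS₂.tangentStructure_apply
      (hct.comp r (hφ.contDiffAt hr).contMDiffAt) hreg]
    have e1 := (geodesic_equation_iff hS₁.tangentStructure_apply hct (hc.regular _ ht)).1
      (hc.eq _ ht)
    have e2 := (deriv_comp_reparam (contDiffAt_curveInChart hct) (hφ.contDiffAt hr)).2
    have e3 : (S₂ (tangentLift 𝓘(ℝ, E) (c ∘ φ) r) : E × E).2 =
        deriv φ r ^ 2 • (S₂ (tangentLift 𝓘(ℝ, E) c (φ r)) : E × E).2 := by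
      rw [e0]
      exact hS₂.homogeneous_snd (c (φ r)) (hc.regular _ ht) (hφ.deriv_pos r hr)
    refine Eq.trans e2 ?_
    have e4 : fiberCoord (tangentLift 𝓘(ℝ, E) c (φ r)) = _ :=
      tangentLift_snd (hct.mdifferentiableAt (by simp))
    rw [e3, h _ (hc.regular _ ht), ← e1, hφ' r hr, e4]
    module

/-- Reparametrize the S₁-geodesic with initial vector u and compare second derivatives at the
parameter of u: the coefficient is φ''/φ'². The statement is pointwise, so no regularity of a is
involved. -/
lemma exists_eq_add_liouville_of_geodesicsReparamTo [CompleteSpace E] (hS₁ : IsSpray 𝓘(ℝ, E) S₁)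
    (hS₂ : IsSpray 𝓘(ℝ, E) S₂) (h : GeodesicsReparamTo 𝓘(ℝ, E) S₁ S₂)
    {u : TangentBundle 𝓘(ℝ, E) M} (hu : u ∈ slashedTangentBundle 𝓘(ℝ, E) M) :
    ∃ a : ℝ, (S₂ u : E × E).2 = (S₁ u : E × E).2 + a • fiberCoord u := by
  obtain ⟨c, s, hc, h0, rfl⟩ := hS₁.exists_geodesic hu
  obtain ⟨φ, s', hφ, hcφ⟩ := h c s hc
  obtain ⟨r, hr, hr0⟩ := hφ.bijOn.surjOn h0
  rw [← hr0] at h0 ⊢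
  have hct := hc.contMDiffAt h0
  have hpos := hφ.deriv_pos r hr
  have e0 := tangentLift_comp hct (hφ.contDiffAt hr)
  have e1 := (geodesic_equation_iff hS₁.tangentStructure_apply hct (hc.regular _ h0)).1
    (hc.eq _ h0)
  have e2 := (deriv_comp_reparam (contDiffAt_curveInChart hct) (hφ.contDiffAt hr)).2
  have e3 : (S₂ (tangentLift 𝓘(ℝ, E) (c ∘ φ) r) : E × E).2 =
      deriv φ r ^ 2 • (S₂ (tangentLift 𝓘(ℝ, E) c (φ r)) : E × E).2 := by
    rw [e0]
    exact hS₂.homogeneous_snd (c (φ r)) (hc.regular _ h0) hpos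
  have e4 := (geodesic_equation_iff hS₂.tangentStructure_apply (hcφ.contMDiffAt hr)
    (hcφ.regular r hr)).1 (hcφ.eq r hr)
  have e5 := e2.symm.trans (Eq.trans e4 e3)
  have e6 : fiberCoord (tangentLift 𝓘(ℝ, E) c (φ r)) = _ :=
    tangentLift_snd (hct.mdifferentiableAt (by simp))
  rw [e6, ← e1]
  refine ⟨deriv (deriv φ) r / deriv φ r ^ 2, ?_⟩
  have h2 : deriv φ r ^ 2 ≠ 0 := pow_ne_zero 2 hpos.ne'
  apply smul_right_injective E h2
  simp only [smul_add, smul_smul, mul_div_cancel₀ _ h2]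
  rw [← e5, add_comm]

end Geodesics

/-! ### First and second derivatives of functions on the tangent bundle; the form d_JF -/

section Functions

variable {E : Type*} [NormedAddCommGroup E] [NormedSpace ℝ E]
  {M : Type*} [TopologicalSpace M] [ChartedSpace E M] [IsManifold 𝓘(ℝ, E) ∞ M]
  {F : TangentBundle 𝓘(ℝ, E) M → ℝ} {u : TangentBundle 𝓘(ℝ, E) M}

/-- The coordinate expression of a function on the tangent bundle in the chart around `u`. -/
def funInChart (F : TangentBundle 𝓘(ℝ, E) M → ℝ) (u : TangentBundle 𝓘(ℝ, E) M) : E × E → ℝ :=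
  F ∘ (extChartAt 𝓘(ℝ, E).tangent u).symm

/-- The coordinates of a tangent vector in its preferred chart. -/
def coords (u : TangentBundle 𝓘(ℝ, E) M) : E × E := extChartAt 𝓘(ℝ, E).tangent u u

lemma coords_snd (u : TangentBundle 𝓘(ℝ, E) M) : (coords u).2 = fiberCoord u :=
  congrArg Prod.snd (extChartAt_tangent_self' u)

lemma funInChart_coords (F : TangentBundle 𝓘(ℝ, E) M → ℝ) (u : TangentBundle 𝓘(ℝ, E) M) :
    funInChart F u (coords u) = F u :=
  congrArg F (extChartAt_to_inv u)

lemma contMDiffAt_iff_funInChart :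
    ContMDiffAt 𝓘(ℝ, E).tangent 𝓘(ℝ, ℝ) ∞ F u ↔ ContDiffAt ℝ ∞ (funInChart F u) (coords u) := by
  rw [contMDiffAt_iff, ModelWithCorners.range_eq_univ, contDiffWithinAt_univ]
  refine ⟨fun h ↦ h.2, fun h ↦ ⟨?_, h⟩⟩
  have h2 : ContinuousAt (funInChart F u ∘ extChartAt 𝓘(ℝ, E).tangent u) u :=
    ContinuousAt.comp (f := extChartAt 𝓘(ℝ, E).tangent u) h.continuousAt (continuousAt_extChartAt u)
  refine h2.congr ?_
  filter_upwards [extChartAt_source_mem_nhds (I := 𝓘(ℝ, E).tangent) u] with w hw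
  simp only [Function.comp, funInChart]
  rw [(extChartAt 𝓘(ℝ, E).tangent u).left_inv hw]

lemma contDiffAt_funInChart
    (hF : ContMDiffOn 𝓘(ℝ, E).tangent 𝓘(ℝ, ℝ) ∞ F (slashedTangentBundle 𝓘(ℝ, E) M))
    (hu : u ∈ slashedTangentBundle 𝓘(ℝ, E) M) : ContDiffAt ℝ ∞ (funInChart F u) (coords u) :=
  contMDiffAt_iff_funInChart.1 (hF.contMDiffAt (isOpen_slashedTangentBundle.mem_nhds hu))

lemma mdifferentiableAt_of_contMDiffOn_slashed
    (hF : ContMDiffOn 𝓘(ℝ, E).tangent 𝓘(ℝ, ℝ) ∞ F (slashedTangentBundle 𝓘(ℝ, E) M))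
    (hu : u ∈ slashedTangentBundle 𝓘(ℝ, E) M) :
    MDifferentiableAt 𝓘(ℝ, E).tangent 𝓘(ℝ, ℝ) F u :=
  (hF.contMDiffAt (isOpen_slashedTangentBundle.mem_nhds hu)).mdifferentiableAt (by simp)

/-- The first derivative of a function in coordinates around `u`. -/
def chartD1 (F : TangentBundle 𝓘(ℝ, E) M → ℝ) (u : TangentBundle 𝓘(ℝ, E) M) : E × E →L[ℝ] ℝ :=
  fderiv ℝ (funInChart F u) (coords u)

/-- The second derivative of a function in coordinates around `u`. -/
def chartD2 (F : TangentBundle 𝓘(ℝ, E) M → ℝ) (u : TangentBundle 𝓘(ℝ, E) M) :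
    E × E →L[ℝ] E × E →L[ℝ] ℝ :=
  fderiv ℝ (fderiv ℝ (funInChart F u)) (coords u)

/-- The `1`-form `d_J F`. -/
def vertDiff (F : TangentBundle 𝓘(ℝ, E) M → ℝ) :
    ∀ u : TangentBundle 𝓘(ℝ, E) M, TangentSpace 𝓘(ℝ, E).tangent u →L[ℝ] ℝ :=
  derivAlongFun 𝓘(ℝ, E).tangent (tangentStructure 𝓘(ℝ, E)) F

/-- The exterior derivative of a `1`-form as a bilinear form on the model space. -/
def extDerivCoord (θ : ∀ u : TangentBundle 𝓘(ℝ, E) M, TangentSpace 𝓘(ℝ, E).tangent u →L[ℝ] ℝ)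
    (u : TangentBundle 𝓘(ℝ, E) M) : E × E →L[ℝ] E × E →L[ℝ] ℝ :=
  extDerivOneForm 𝓘(ℝ, E).tangent θ u

lemma extDerivCoord_eq
    (θ : ∀ u : TangentBundle 𝓘(ℝ, E) M, TangentSpace 𝓘(ℝ, E).tangent u →L[ℝ] ℝ)
    (u : TangentBundle 𝓘(ℝ, E) M) (ξ η : E × E) :
    extDerivCoord θ u ξ η = oneFormDeriv θ u ξ η - oneFormDeriv θ u η ξ :=
  extDerivOneForm_eq θ u ξ η

variable (hF : ContMDiffOn 𝓘(ℝ, E).tangent 𝓘(ℝ, ℝ) ∞ F (slashedTangentBundle 𝓘(ℝ, E) M))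
  (hu : u ∈ slashedTangentBundle 𝓘(ℝ, E) M)

include hF hu

lemma hasFDerivAt_funInChart : HasFDerivAt (funInChart F u) (chartD1 F u) (coords u) :=
  ((contDiffAt_funInChart hF hu).differentiableAt (by simp)).hasFDerivAt

lemma contDiffAt_fderiv_funInChart : ContDiffAt ℝ ∞ (fderiv ℝ (funInChart F u)) (coords u) :=
  (contDiffAt_funInChart hF hu).fderiv_right (by simp)

lemma hasFDerivAt_fderiv_funInChart :
    HasFDerivAt (fderiv ℝ (funInChart F u)) (chartD2 F u) (coords u) :=
  ((contDiffAt_fderiv_funInChart hF hu).differentiableAt (by simp)).hasFDerivAt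

lemma chartD2_symm (ξ ζ : E × E) : chartD2 F u ξ ζ = chartD2 F u ζ ξ :=
  ((contDiffAt_funInChart hF hu).isSymmSndFDerivAt (by simpa using ENat.LEInfty.out)) ξ ζ

lemma mvfderiv_eq_chartD1 (ξ : TangentSpace 𝓘(ℝ, E).tangent u) :
    mvfderiv 𝓘(ℝ, E).tangent F u ξ = chartD1 F u (ξ : E × E) :=
  mvfderiv_apply_eq_fderiv (mdifferentiableAt_of_contMDiffOn_slashed hF hu) ξ

lemma vertDiff_apply (ξ : TangentSpace 𝓘(ℝ, E).tangent u) :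
    vertDiff F u ξ = chartD1 F u (0, (ξ : E × E).1) := by
  rw [vertDiff, derivAlongFun, ContinuousLinearMap.comp_apply, tangentStructure_apply]
  exact mvfderiv_eq_chartD1 hF hu _

omit hu in
lemma isSemiBasic_vertDiff : IsSemiBasic 𝓘(ℝ, E) (vertDiff F) := by
  intro w hw ξ hξ
  rw [projDiff_apply] at hξ
  rw [vertDiff_apply hF hw]
  have : ((0, (ξ : E × E).1) : E × E) = 0 := Prod.ext rfl hξ
  rw [this, map_zero]

/-- In coordinates d_JF = (∂F/∂yⁱ) dxⁱ. The equality is one of germs, so it may be differentiated.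
-/
lemma oneFormInChart_vertDiff : oneFormInChart 𝓘(ℝ, E).tangent (vertDiff F) u =ᶠ[nhds (coords u)]
    fun z ↦ (fderiv ℝ (funInChart F u) z).comp
      ((ContinuousLinearMap.inr ℝ E E).comp (ContinuousLinearMap.fst ℝ E E)) := by
  filter_upwards [eventually_slashed hu] with z hz
  refine ContinuousLinearMap.ext fun ζ ↦ ?_
  exact oneFormInChart_derivAlongFun_tangentStructure hz.1
    (mdifferentiableAt_of_contMDiffOn_slashed hF hz.2) ζ

omit hu in
lemma smoothOneFormOn_vertDiff :
    SmoothOneFormOn 𝓘(ℝ, E).tangent (vertDiff F) (slashedTangentBundle 𝓘(ℝ, E) M) := by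
  intro w hw
  refine ContMDiffAt.contMDiffWithinAt ((smoothOneForm_contDiffAt_iff _ w).2 ?_)
  refine ContDiffAt.congr_of_eventuallyEq ?_ (oneFormInChart_vertDiff hF hw)
  exact (contDiffAt_fderiv_funInChart hF hw).clm_comp contDiffAt_const

lemma oneFormDeriv_vertDiff (ξ ζ : E × E) :
    oneFormDeriv (vertDiff F) u ξ ζ = chartD2 F u ξ (0, ζ.1) := by
  have h := (hasFDerivAt_fderiv_funInChart hF hu).clm_comp
    (hasFDerivAt_const (((ContinuousLinearMap.inr ℝ E E).comp (ContinuousLinearMap.fst ℝ E E)) :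
      E × E →L[ℝ] E × E) (coords u))
  have h1 := (h.congr_of_eventuallyEq (oneFormInChart_vertDiff hF hu)).fderiv
  change fderiv ℝ (oneFormInChart 𝓘(ℝ, E).tangent (vertDiff F) u) (coords u) ξ ζ = _
  rw [h1]
  simp

lemma extDerivCoord_vertDiff (ξ ζ : E × E) :
    extDerivCoord (vertDiff F) u ξ ζ = chartD2 F u ξ (0, ζ.1) - chartD2 F u ζ (0, ξ.1) := by
  rw [extDerivCoord_eq, oneFormDeriv_vertDiff hF hu, oneFormDeriv_vertDiff hF hu]

omit hu in
lemma contMDiffOn_sq : ContMDiffOn 𝓘(ℝ, E).tangent 𝓘(ℝ, ℝ) ∞ (fun w ↦ F w ^ 2)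
    (slashedTangentBundle 𝓘(ℝ, E) M) :=
  hF.pow 2

lemma fderiv_funInChart_sq : fderiv ℝ (funInChart (fun w ↦ F w ^ 2) u) =ᶠ[nhds (coords u)]
    fun z ↦ (2 * funInChart F u z) • fderiv ℝ (funInChart F u) z := by
  have h := ((contDiffAt_funInChart hF hu).of_le (m := 1) (mod_cast le_top)).eventually (by simp)
  filter_upwards [h] with z hz
  have h1 := (hz.differentiableAt (by simp)).hasFDerivAt.pow 2
  refine HasFDerivAt.fderiv (h1.congr_fderiv ?_)
  simp

lemma chartD1_sq (ξ : E × E) :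
    chartD1 (fun w ↦ F w ^ 2) u ξ = 2 * F u * chartD1 F u ξ := by
  rw [chartD1, (fderiv_funInChart_sq hF hu).eq_of_nhds, funInChart_coords]
  rfl

lemma chartD2_sq (ξ ζ : E × E) :
    chartD2 (fun w ↦ F w ^ 2) u ξ ζ =
      2 * chartD1 F u ξ * chartD1 F u ζ + 2 * F u * chartD2 F u ξ ζ := by
  have h1 := ((hasFDerivAt_funInChart hF hu).const_mul 2).smul (hasFDerivAt_fderiv_funInChart hF hu)
  rw [chartD2, (h1.congr_of_eventuallyEq (fderiv_funInChart_sq hF hu)).fderiv, funInChart_coords]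
  simp only [add_apply, smul_apply, smul_eq_mul,
    ContinuousLinearMap.smulRight_apply, chartD1]
  ring

omit hF hu in
lemma funInChart_fiber (F : TangentBundle 𝓘(ℝ, E) M → ℝ) (x : M) (v y : E) :
    funInChart F ⟨x, v⟩ (extChartAt 𝓘(ℝ, E) x x, y) = F ⟨x, y⟩ :=
  congrArg F (extChartAt_tangent_symm_self x v y)

/-- The fibre is the affine slice {x} × E of the natural chart, so fibre derivatives are
restrictions of the derivatives in the chart. -/
lemma fderiv_fderiv_fiber (v w : E) :
    fderiv ℝ (fderiv ℝ (fun w : E ↦ F ⟨u.1, w⟩)) (fiberCoord u) v w =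
      chartD2 F u (0, v) (0, w) := by
  have hc : coords u = (extChartAt 𝓘(ℝ, E) u.1 u.1, fiberCoord u) := extChartAt_tangent_self' u
  have h0 : ∀ y : E, HasFDerivAt (fun y : E ↦ (extChartAt 𝓘(ℝ, E) u.1 u.1, y))
      (ContinuousLinearMap.inr ℝ E E) y := fun y ↦ hasFDerivAt_prodMk_right _ _
  have hev : ∀ᶠ y in nhds (fiberCoord u),
      ContDiffAt ℝ 1 (funInChart F u) (extChartAt 𝓘(ℝ, E) u.1 u.1, y) := by
    have h := ((contDiffAt_funInChart hF hu).of_le (m := 1) (mod_cast le_top)).eventually (by simp)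
    rw [hc] at h
    exact (h0 (fiberCoord u)).continuousAt.eventually h
  have h1 : fderiv ℝ (fun w : E ↦ F ⟨u.1, w⟩) =ᶠ[nhds (fiberCoord u)] fun y ↦
      (fderiv ℝ (funInChart F u) (extChartAt 𝓘(ℝ, E) u.1 u.1, y)).comp
        (ContinuousLinearMap.inr ℝ E E) := by
    filter_upwards [hev] with y hy
    have h2 := (hy.differentiableAt (by simp)).hasFDerivAt.comp y (h0 y)
    refine (h2.congr_of_eventuallyEq (Filter.Eventually.of_forall fun y ↦ ?_)).fderiv
    exact (funInChart_fiber F u.1 u.2 y).symm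
  have h3 := hasFDerivAt_fderiv_funInChart hF hu
  rw [hc] at h3
  have h4 := (h3.comp (fiberCoord u) (h0 _)).clm_comp
    (hasFDerivAt_const (ContinuousLinearMap.inr ℝ E E) (fiberCoord u))
  rw [(h4.congr_of_eventuallyEq h1).fderiv]
  simp

lemma metricTensor_apply (v w : E) : metricTensor 𝓘(ℝ, E) F u v w =
    F u * chartD2 F u (0, v) (0, w) + chartD1 F u (0, v) * chartD1 F u (0, w) := by
  have h := fderiv_fderiv_fiber (contMDiffOn_sq hF) hu v w
  have h1 : metricTensor 𝓘(ℝ, E) F u v w = (1 / 2 : ℝ) *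
    fderiv ℝ (fderiv ℝ (fun w : E ↦ F ⟨u.1, w⟩ ^ 2)) (fiberCoord u) v w := rfl
  rw [h1, h, chartD2_sq hF hu]
  ring

end Functions

/-! ### Euler's relations and the equation of the geodesic spray -/

section HomogeneousFunctions

variable {E : Type*} [NormedAddCommGroup E] [NormedSpace ℝ E]
  {M : Type*} [TopologicalSpace M] [ChartedSpace E M] [IsManifold 𝓘(ℝ, E) ∞ M]
  {F : TangentBundle 𝓘(ℝ, E) M → ℝ} {u : TangentBundle 𝓘(ℝ, E) M}
  {S : ∀ u : TangentBundle 𝓘(ℝ, E) M, TangentSpace 𝓘(ℝ, E).tangent u}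

/-- Positively homogeneous functions of degree one, smooth off the zero section. -/
structure IsSmoothHomogeneous (F : TangentBundle 𝓘(ℝ, E) M → ℝ) : Prop where
  smooth : ContMDiffOn 𝓘(ℝ, E).tangent 𝓘(ℝ, ℝ) ∞ F (slashedTangentBundle 𝓘(ℝ, E) M)
  homogeneous : ∀ (u : TangentBundle 𝓘(ℝ, E) M) (l : ℝ), 0 < l → F ⟨u.1, l • u.2⟩ = l * F u

lemma IsFinsler.isSmoothHomogeneous (h : IsFinsler 𝓘(ℝ, E) F) : IsSmoothHomogeneous F :=
  ⟨h.smooth, h.homogeneous⟩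

/-- The inverse natural chart is linear on fibres, so homogeneity passes to coordinates. -/
lemma IsSmoothHomogeneous.funInChart_smul (h : IsSmoothHomogeneous F) {z : E × E}
    (hz : z.1 ∈ (extChartAt 𝓘(ℝ, E) u.1).target) {l : ℝ} (hl : 0 < l) :
    funInChart F u (z.1, l • z.2) = l * funInChart F u z := by
  have e1 := extChartAt_tangent_symm_apply hz
  have e2 := extChartAt_tangent_symm_apply (p := u) (z := (z.1, l • z.2)) hz
  simp only [Function.comp, funInChart]
  rw [e1, e2, ← h.homogeneous _ l hl]
  exact congrArg (fun w ↦ F ⟨(extChartAt 𝓘(ℝ, E) u.1).symm z.1, w⟩)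
    (map_smul (chartInvDiff 𝓘(ℝ, E) u.1 z.1) l z.2)

/-- Differentiate F(x, ly) = l F(x, y) at l = 1. The relation is needed on a neighbourhood because
it is differentiated once more in `IsSmoothHomogeneous.chartD2_radial`. -/
lemma IsSmoothHomogeneous.euler_funInChart (h : IsSmoothHomogeneous F)
    (hu : u ∈ slashedTangentBundle 𝓘(ℝ, E) M) :
    (fun z : E × E ↦ fderiv ℝ (funInChart F u) z (0, z.2)) =ᶠ[nhds (coords u)] funInChart F u := by
  have hev := ((contDiffAt_funInChart h.smooth hu).of_le (m := 1) (mod_cast le_top)).eventually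
    (by simp)
  filter_upwards [eventually_slashed hu, hev] with z hz hz'
  have h1 : HasDerivAt (fun l : ℝ ↦ ((z.1, l • z.2) : E × E)) (0, z.2) 1 := by
    have := (hasDerivAt_const (1 : ℝ) z.1).prodMk ((hasDerivAt_id (1 : ℝ)).smul_const z.2)
    simpa using this
  have hz1 : ((z.1, (1 : ℝ) • z.2) : E × E) = z := by simp
  have h2 : HasFDerivAt (funInChart F u) (fderiv ℝ (funInChart F u) z) (z.1, (1 : ℝ) • z.2) := by
    rw [hz1]; exact (hz'.differentiableAt (by simp)).hasFDerivAt
  have h3 := h2.comp_hasDerivAt (1 : ℝ) h1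
  have h4 : funInChart F u ∘ (fun l : ℝ ↦ ((z.1, l • z.2) : E × E)) =ᶠ[nhds 1]
      fun l ↦ l * funInChart F u z := by
    filter_upwards [lt_mem_nhds (zero_lt_one (α := ℝ))] with l hl
    exact h.funInChart_smul (mem_extChartAt_tangent_target.1 hz.1) hl
  have h5 := h3.unique (((hasDerivAt_id (1 : ℝ)).mul_const _).congr_of_eventuallyEq h4)
  simpa using h5

lemma IsSmoothHomogeneous.chartD1_radial (h : IsSmoothHomogeneous F)
    (hu : u ∈ slashedTangentBundle 𝓘(ℝ, E) M) : chartD1 F u (0, fiberCoord u) = F u := by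
  have := (h.euler_funInChart hu).eq_of_nhds
  rwa [funInChart_coords, coords_snd] at this

/-- Differentiate Euler's relation in the direction ξ; the contribution of ξ.2 cancels, leaving the
derivative along the x-part. -/
lemma IsSmoothHomogeneous.chartD2_radial (h : IsSmoothHomogeneous F)
    (hu : u ∈ slashedTangentBundle 𝓘(ℝ, E) M) (ξ : E × E) :
    chartD2 F u ξ (0, fiberCoord u) = chartD1 F u (ξ.1, 0) := by
  have h1 : HasFDerivAt (fun z : E × E ↦ ((0, z.2) : E × E))
      ((ContinuousLinearMap.inr ℝ E E).comp (ContinuousLinearMap.snd ℝ E E)) (coords u) :=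
    ((ContinuousLinearMap.inr ℝ E E).comp (ContinuousLinearMap.snd ℝ E E)).hasFDerivAt
  have h2 := (hasFDerivAt_fderiv_funInChart h.smooth hu).clm_apply h1
  have h3 := h2.unique ((hasFDerivAt_funInChart h.smooth hu).congr_of_eventuallyEq
    (h.euler_funInChart hu))
  have h4 := congrArg (fun L : E × E →L[ℝ] ℝ ↦ L ξ) h3
  have h5 : chartD1 F u (0, ξ.2) + chartD2 F u ξ (0, fiberCoord u) = chartD1 F u ξ := by
    rw [← coords_snd u]
    simpa [chartD1] using h4
  have h6 : chartD1 F u ξ = chartD1 F u (ξ.1, 0) + chartD1 F u (0, ξ.2) := by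
    rw [← map_add]; simp
  linarith

lemma IsSmoothHomogeneous.chartD2_vertical_radial (h : IsSmoothHomogeneous F)
    (hu : u ∈ slashedTangentBundle 𝓘(ℝ, E) M) (v : E) :
    chartD2 F u (0, v) (0, fiberCoord u) = 0 := by
  rw [h.chartD2_radial hu]
  exact map_zero _

/-- The interior product `i_X d d_J F` for `J X = ℂ`. -/
lemma IsSmoothHomogeneous.extDerivCoord_spray (h : IsSmoothHomogeneous F)
    (hu : u ∈ slashedTangentBundle 𝓘(ℝ, E) M) {X : E × E} (hX : X.1 = fiberCoord u) (η : E × E) :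
    extDerivCoord (vertDiff F) u X η = chartD2 F u X (0, η.1) - chartD1 F u (η.1, 0) := by
  rw [extDerivCoord_vertDiff h.smooth hu, ← h.chartD2_radial hu, hX]

/-- The coefficients ∂F/∂yⁱ of d_JF have degree zero. This vanishing is what makes i_S dd_JF = 0 a
projective invariant. -/
lemma IsSmoothHomogeneous.extDerivCoord_liouville (h : IsSmoothHomogeneous F)
    (hu : u ∈ slashedTangentBundle 𝓘(ℝ, E) M) (η : E × E) :
    extDerivCoord (vertDiff F) u (0, fiberCoord u) η = 0 := by
  rw [extDerivCoord_vertDiff h.smooth hu, chartD2_symm h.smooth hu,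
    h.chartD2_vertical_radial hu]
  have h4 : chartD2 F u η (0, 0) = 0 := map_zero _
  rw [h4, sub_zero]

/-- The equation `i_X d d_J F² = -dF²` for a vector `X` with `J X = ℂ`. -/
lemma IsSmoothHomogeneous.geodesicSpray_equation_iff (h : IsSmoothHomogeneous F)
    (hu : u ∈ slashedTangentBundle 𝓘(ℝ, E) M) (hpos : 0 < F u)
    {X : E × E} (hX : X.1 = fiberCoord u) :
    (∀ η : E × E, extDerivCoord (vertDiff (fun w ↦ F w ^ 2)) u X η =
        -chartD1 (fun w ↦ F w ^ 2) u η) ↔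
      chartD1 F u X = 0 ∧ ∀ η : E × E, extDerivCoord (vertDiff F) u X η = 0 := by
  -- This is i_X dd_JF² + dF² = 2 (X(F) d_JF + F i_X dd_JF); the term dF² cancels a multiple of dF
  -- produced by Euler's relation.
  have key : ∀ η : E × E,
      extDerivCoord (vertDiff (fun w ↦ F w ^ 2)) u X η + chartD1 (fun w ↦ F w ^ 2) u η =
        2 * (chartD1 F u X * chartD1 F u (0, η.1) +
          F u * extDerivCoord (vertDiff F) u X η) := by
    intro η
    rw [h.extDerivCoord_spray hu hX, extDerivCoord_vertDiff (contMDiffOn_sq h.smooth) hu,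
      chartD2_sq h.smooth hu, chartD2_sq h.smooth hu,
      chartD1_sq h.smooth hu, hX, h.chartD1_radial hu, h.chartD2_radial hu]
    ring
  constructor
  · intro heq
    have h0 : ∀ η : E × E, chartD1 F u X * chartD1 F u (0, η.1) +
          F u * extDerivCoord (vertDiff F) u X η = 0 := by
      intro η
      have h1 := key η
      rw [heq, neg_add_cancel] at h1
      linarith
    -- At η = X the two-form vanishes and d_JF(X) = F, so X(F) F = 0.
    have h1 := h0 X
    rw [extDerivCoord_vertDiff h.smooth hu, sub_self, mul_zero, add_zero, hX,
      h.chartD1_radial hu] at h1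
    have h2 : chartD1 F u X = 0 := (mul_eq_zero.1 h1).resolve_right hpos.ne'
    refine ⟨h2, fun η ↦ ?_⟩
    have h3 := h0 η
    rw [h2, zero_mul, zero_add] at h3
    exact (mul_eq_zero.1 h3).resolve_left hpos.ne'
  · rintro ⟨h1, h2⟩ η
    have h3 := key η
    rw [h1, h2, zero_mul, mul_zero, add_zero, mul_zero] at h3
    linarith

end HomogeneousFunctions

/-! ### Continuity across the zero section -/

section Continuity

variable {E : Type*} [NormedAddCommGroup E] [NormedSpace ℝ E]
  {M : Type*} [TopologicalSpace M] [ChartedSpace E M] [IsManifold 𝓘(ℝ, E) ∞ M]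
  {F : TangentBundle 𝓘(ℝ, E) M → ℝ} {u : TangentBundle 𝓘(ℝ, E) M}

/-- A positively homogeneous function that is smooth off the zero section is continuous, if it
vanishes on the zero section. -/
lemma IsSmoothHomogeneous.continuous [FiniteDimensional ℝ E] (h : IsSmoothHomogeneous F)
    (h0 : ∀ x : M, F ⟨x, 0⟩ = 0) : Continuous F := by
  rw [continuous_iff_continuousAt]
  rintro ⟨x, v⟩
  by_cases hv : (v : E) ≠ 0
  · exact (h.smooth.contMDiffAt (isOpen_slashedTangentBundle.mem_nhds
      (show (⟨x, v⟩ : TangentBundle 𝓘(ℝ, E) M) ∈ slashedTangentBundle 𝓘(ℝ, E) M from hv))).continuousAt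
  obtain rfl : v = 0 := not_not.1 hv
  set u : TangentBundle 𝓘(ℝ, E) M := ⟨x, 0⟩ with hu
  set x' : E := extChartAt 𝓘(ℝ, E) x x with hx'
  have hcoord : extChartAt 𝓘(ℝ, E).tangent u u = (x', (0 : E)) := extChartAt_tangent_self x 0 0
  have hcont : ∀ y : E, y ≠ 0 → ContinuousAt (funInChart F u) (x', y) := by
    intro y hy
    have h1 := (contDiffAt_funInChart h.smooth (u := ⟨x, y⟩) hy).continuousAt
    have h2 : coords (⟨x, y⟩ : TangentBundle 𝓘(ℝ, E) M) = (x', y) := extChartAt_tangent_self x y y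
    rw [h2] at h1
    exact h1
  have hne : ∀ y ∈ Metric.sphere (0 : E) 1, y ≠ 0 := fun y hy ↦ by
    rintro rfl; simp at hy
  have hpar : ContinuousOn (fun y : E ↦ funInChart F u (x', y)) (Metric.sphere 0 1) := fun y hy ↦
    (ContinuousAt.comp (f := fun y : E ↦ (x', y)) (hcont y (hne y hy))
      (by fun_prop)).continuousWithinAt
  obtain ⟨C, hC⟩ := (isCompact_sphere (0 : E) 1).exists_bound_of_continuousOn hpar
  -- The bound on the compact unit sphere over x' persists, with C + 1 in place of C, over all base
  -- points near x'.
  have hbound : ∀ᶠ a in nhds x', ∀ y ∈ Metric.sphere (0 : E) 1, ‖funInChart F u (a, y)‖ < C + 1 := by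
    refine (isCompact_sphere (0 : E) 1).eventually_forall_of_forall_eventually fun y hy ↦ ?_
    exact (hcont y (hne y hy)).norm.eventually
      (gt_mem_nhds (lt_of_le_of_lt (hC y hy) (lt_add_one C)))
  have htarget : ∀ᶠ a in nhds x', a ∈ (extChartAt 𝓘(ℝ, E) x).target :=
    extChartAt_target_mem_nhds (I := 𝓘(ℝ, E)) x
  -- Homogeneity turns the bound on spheres into a linear bound in the fibre variable, which tends
  -- to zero at the zero section.
  have hle : ∀ᶠ z in nhds ((x', 0) : E × E), ‖funInChart F u z‖ ≤ (C + 1) * ‖z.2‖ := by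
    filter_upwards [continuousAt_fst.eventually (hbound.and htarget)] with z hz
    by_cases hz2 : z.2 = 0
    · have e1 := extChartAt_tangent_symm_apply (p := u) (z := z) hz.2
      have e2 : funInChart F u z = 0 := by
        simp only [Function.comp, funInChart]
        rw [e1, hz2]
        refine (congrArg (fun w ↦ F ⟨(extChartAt 𝓘(ℝ, E) u.1).symm z.1, w⟩)
          (map_zero (chartInvDiff 𝓘(ℝ, E) u.1 z.1))).trans (h0 _)
      rw [e2, hz2]
      simp
    · have hpos : 0 < ‖z.2‖ := norm_pos_iff.2 hz2
      have e1 := h.funInChart_smul (u := u) (z := (z.1, ‖z.2‖⁻¹ • z.2)) hz.2 hpos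
      simp only [smul_smul, mul_inv_cancel₀ hpos.ne', one_smul] at e1
      have e2 := hz.1 (‖z.2‖⁻¹ • z.2) (by
        rw [mem_sphere_zero_iff_norm, norm_smul, norm_inv, norm_norm, inv_mul_cancel₀ hpos.ne'])
      change ‖funInChart F u (z.1, z.2)‖ ≤ _
      rw [e1, norm_mul, norm_norm, mul_comm]
      exact mul_le_mul_of_nonneg_right e2.le hpos.le
  have hlim : Filter.Tendsto (funInChart F u) (nhds ((x', 0) : E × E)) (nhds 0) := by
    refine squeeze_zero_norm' hle ?_
    have : ContinuousAt (fun z : E × E ↦ (C + 1) * ‖z.2‖) (x', 0) := by fun_prop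
    simpa [ContinuousAt] using this
  have hcomp : Filter.Tendsto (funInChart F u ∘ extChartAt 𝓘(ℝ, E).tangent u) (nhds u) (nhds 0) := by
    refine hlim.comp ?_
    have := continuousAt_extChartAt (I := 𝓘(ℝ, E).tangent) u
    rw [ContinuousAt, hcoord] at this
    exact this
  rw [ContinuousAt, hu, h0]
  refine hcomp.congr' ?_
  filter_upwards [extChartAt_source_mem_nhds (I := 𝓘(ℝ, E).tangent) u] with w hw
  simp only [Function.comp, funInChart]
  rw [(extChartAt 𝓘(ℝ, E).tangent u).left_inv hw]

end Continuity

/-! ### The rank of dd_JF and nondegeneracy of the metric tensor -/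

section Rank

variable {E : Type*} [NormedAddCommGroup E] [NormedSpace ℝ E]
  {M : Type*} [TopologicalSpace M] [ChartedSpace E M] [IsManifold 𝓘(ℝ, E) ∞ M]
  {F : TangentBundle 𝓘(ℝ, E) M → ℝ} {u : TangentBundle 𝓘(ℝ, E) M}

omit [IsManifold 𝓘(ℝ, E) ∞ M] in
lemma fiberCoord_ne_zero (hu : u ∈ slashedTangentBundle 𝓘(ℝ, E) M) : fiberCoord u ≠ 0 := hu

lemma finrank_span_spray_liouville {y : E} (hy : y ≠ 0) {X : E × E} (hX : X.1 = y) :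
    Module.finrank ℝ (Submodule.span ℝ {X, ((0, y) : E × E)}) = 2 := by
  have h : LinearIndependent ℝ ![X, ((0, y) : E × E)] := by
    rw [LinearIndependent.pair_iff]
    intro a b hab
    have h1 : a = 0 := by
      have := congrArg Prod.fst hab
      simpa [hX, hy] using this
    have h2 := congrArg Prod.snd hab
    simp [h1, hy] at h2
    exact ⟨h1, h2⟩
  have h2 := finrank_span_eq_card h
  rw [Fintype.card_fin, Matrix.range_cons, Matrix.range_cons, Matrix.range_empty, union_empty] at h2
  exact h2

/-- The angular metric has the radial direction as its kernel if the metric tensor is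
nondegenerate. -/
lemma IsSmoothHomogeneous.mem_span_of_chartD2_eq_zero (h : IsSmoothHomogeneous F)
    (hu : u ∈ slashedTangentBundle 𝓘(ℝ, E) M) (hpos : 0 < F u)
    (hinj : Function.Injective (metricTensor 𝓘(ℝ, E) F u)) {v : E}
    (hv : ∀ w, chartD2 F u (0, v) (0, w) = 0) : ∃ a : ℝ, v = a • fiberCoord u := by
  -- If F_yy(v, ·) = 0, then g(v, ·) = F_y(v) F_y, while g(y, ·) = F F_y. So v - (F_y(v)/F) y is in
  -- the kernel of g.
  refine ⟨chartD1 F u (0, v) / F u, ?_⟩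
  rw [← sub_eq_zero]
  refine hinj ?_
  rw [map_zero]
  refine ContinuousLinearMap.ext fun w ↦ ?_
  rw [map_sub, map_smul]
  have e0 : chartD2 F u (0, fiberCoord u) (0, w) = 0 := by
    rw [chartD2_symm h.smooth hu, h.chartD2_vertical_radial hu]
  change metricTensor 𝓘(ℝ, E) F u v w -
    chartD1 F u (0, v) / F u * metricTensor 𝓘(ℝ, E) F u (fiberCoord u) w = 0
  rw [metricTensor_apply h.smooth hu, metricTensor_apply h.smooth hu, hv, e0, h.chartD1_radial hu]
  field_simp
  ring

/-- `d d_J F` has rank `2n - 2` if and only if the metric tensor of `F` is nondegenerate, when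
`i_X d d_J F = 0` for some `X` with `J X = ℂ`. -/
lemma IsSmoothHomogeneous.rank_iff [FiniteDimensional ℝ E] (h : IsSmoothHomogeneous F)
    (hu : u ∈ slashedTangentBundle 𝓘(ℝ, E) M) (hpos : 0 < F u) {X : E × E}
    (hX : X.1 = fiberCoord u) (hX' : ∀ η, extDerivCoord (vertDiff F) u X η = 0) :
    Module.finrank ℝ (LinearMap.range (extDerivCoord (vertDiff F) u).toLinearMap) + 2 =
        2 * Module.finrank ℝ E ↔
      Function.Injective (metricTensor 𝓘(ℝ, E) F u) := by
  set B := (extDerivCoord (vertDiff F) u).toLinearMap with hB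
  have hrn : Module.finrank ℝ (LinearMap.range B) + Module.finrank ℝ (LinearMap.ker B) =
      2 * Module.finrank ℝ E := by
    rw [LinearMap.finrank_range_add_finrank_ker, Module.finrank_prod, two_mul]
  have hspan := finrank_span_spray_liouville (fiberCoord_ne_zero hu) hX
  have hle : Submodule.span ℝ {X, ((0, fiberCoord u) : E × E)} ≤ LinearMap.ker B := by
    rw [Submodule.span_le]
    rintro ξ (rfl | rfl)
    · exact LinearMap.mem_ker.2 (ContinuousLinearMap.ext hX')
    · exact LinearMap.mem_ker.2 (ContinuousLinearMap.ext (h.extDerivCoord_liouville hu))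
  constructor
  -- The kernel is the plane spanned by X and ℂ. If g(v, ·) = 0, pairing with y gives F_y(v) = 0 and
  -- then F_yy(v, ·) = 0, so (0, v) lies in that plane; thus v = by, and F_y(v) = bF forces b = 0.
  · intro hrank
    have hker : Module.finrank ℝ (LinearMap.ker B) = 2 := by omega
    have heq := Submodule.eq_of_le_of_finrank_le hle (by rw [hker, hspan])
    rw [injective_iff_map_eq_zero]
    intro v hv
    have hv' : ∀ w, F u * chartD2 F u (0, v) (0, w) +
        chartD1 F u (0, v) * chartD1 F u (0, w) = 0 := fun w ↦ by
      rw [← metricTensor_apply h.smooth hu]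
      exact congrArg (fun L : E →L[ℝ] ℝ ↦ L w) hv
    have h1 : chartD1 F u (0, v) = 0 := by
      have := hv' (fiberCoord u)
      rw [h.chartD2_vertical_radial hu, h.chartD1_radial hu, mul_zero, zero_add] at this
      exact (mul_eq_zero.1 this).resolve_right hpos.ne'
    have h2 : ((0, v) : E × E) ∈ LinearMap.ker B := by
      refine LinearMap.mem_ker.2 (ContinuousLinearMap.ext fun η ↦ ?_)
      change extDerivCoord (vertDiff F) u (0, v) η = 0
      rw [extDerivCoord_vertDiff h.smooth hu]
      have h3 := hv' η.1
      rw [h1, zero_mul, add_zero] at h3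
      have h4 : chartD2 F u η (0, 0) = 0 := map_zero _
      rw [(mul_eq_zero.1 h3).resolve_left hpos.ne', h4, sub_zero]
    rw [← heq, Submodule.mem_span_pair] at h2
    obtain ⟨a, b, hab⟩ := h2
    have ha : a = 0 := by
      have := congrArg Prod.fst hab
      simpa [hX, fiberCoord_ne_zero hu] using this
    have hb : b • fiberCoord u = v := by
      have := congrArg Prod.snd hab
      simpa [ha] using this
    have h5 : chartD1 F u (0, v) = b * F u := by
      rw [← hb, ← h.chartD1_radial hu, ← smul_eq_mul, ← map_smul]
      simp
    rw [h1] at h5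
    rw [← hb, (mul_eq_zero.1 h5.symm).resolve_right hpos.ne', zero_smul]
  -- Testing a kernel vector ξ on vertical vectors shows that ξ.1 = ay. Then ξ - aX is vertical and
  -- in the kernel; testing it on vectors (w, 0) makes it a multiple of ℂ.
  · intro hinj
    have hge : LinearMap.ker B ≤ Submodule.span ℝ {X, ((0, fiberCoord u) : E × E)} := by
      intro ξ hξ
      have hξ' : ∀ η, chartD2 F u ξ (0, η.1) - chartD2 F u η (0, ξ.1) = 0 := fun η ↦ by
        rw [← extDerivCoord_vertDiff h.smooth hu]
        exact congrArg (fun L : E × E →L[ℝ] ℝ ↦ L η) (LinearMap.mem_ker.1 hξ)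
      have hvert : ∀ ζ : E × E, ζ ∈ LinearMap.ker B → ∀ w, chartD2 F u (0, ζ.1) (0, w) = 0 := by
        intro ζ hζ w
        have h3 : extDerivCoord (vertDiff F) u ζ (0, w) = 0 :=
          congrArg (fun L : E × E →L[ℝ] ℝ ↦ L (0, w)) (LinearMap.mem_ker.1 hζ)
        rw [extDerivCoord_vertDiff h.smooth hu] at h3
        have h4 : chartD2 F u ζ (0, 0) = 0 := map_zero _
        rw [h4, zero_sub, neg_eq_zero] at h3
        rw [chartD2_symm h.smooth hu, h3]
      obtain ⟨a, ha⟩ := h.mem_span_of_chartD2_eq_zero hu hpos hinj (hvert ξ hξ)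
      have h5 : ξ - a • X ∈ LinearMap.ker B :=
        Submodule.sub_mem _ hξ (Submodule.smul_mem _ _ (hle (Submodule.subset_span (by simp))))
      have h6 : ξ - a • X = (0, ξ.2 - a • X.2) := Prod.ext (by simp [hX, ← ha]) rfl
      have h7 : ∀ w, chartD2 F u (0, ξ.2 - a • X.2) (0, w) = 0 := by
        intro w
        have h3 : extDerivCoord (vertDiff F) u (0, ξ.2 - a • X.2) (w, 0) = 0 := by
          rw [← h6]
          exact congrArg (fun L : E × E →L[ℝ] ℝ ↦ L (w, 0)) (LinearMap.mem_ker.1 h5)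
        rw [extDerivCoord_vertDiff h.smooth hu] at h3
        have h4 : chartD2 F u (w, 0) (0, 0) = 0 := map_zero _
        rwa [h4, sub_zero] at h3
      obtain ⟨b, hb⟩ := h.mem_span_of_chartD2_eq_zero hu hpos hinj h7
      rw [Submodule.mem_span_pair]
      refine ⟨a, b, ?_⟩
      have h8 : ξ = a • X + (0, ξ.2 - a • X.2) := by rw [← h6]; abel
      rw [h8, hb]
      simp
    have heq := le_antisymm hle hge
    rw [← heq, hspan] at hrn
    exact hrn

end Rank

/-! ### From the form θ to the Finsler function i_Sθ -/

section FormToFunction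

variable {E : Type*} [NormedAddCommGroup E] [NormedSpace ℝ E]
  {M : Type*} [TopologicalSpace M] [ChartedSpace E M] [IsManifold 𝓘(ℝ, E) ∞ M]
  {S : ∀ u : TangentBundle 𝓘(ℝ, E) M, TangentSpace 𝓘(ℝ, E).tangent u}
  {θ : ∀ u : TangentBundle 𝓘(ℝ, E) M, TangentSpace 𝓘(ℝ, E).tangent u →L[ℝ] ℝ}
  {u : TangentBundle 𝓘(ℝ, E) M}

/-- The value of a vector field as a vector of the model space. -/
def sprayCoord (S : ∀ u : TangentBundle 𝓘(ℝ, E) M, TangentSpace 𝓘(ℝ, E).tangent u)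
    (u : TangentBundle 𝓘(ℝ, E) M) : E × E := S u

/-- The value of a `1`-form as a functional on the model space. -/
def formCoord (θ : ∀ u : TangentBundle 𝓘(ℝ, E) M, TangentSpace 𝓘(ℝ, E).tangent u →L[ℝ] ℝ)
    (u : TangentBundle 𝓘(ℝ, E) M) : E × E →L[ℝ] ℝ := θ u

lemma IsSpray.sprayCoord_fst (hS : IsSpray 𝓘(ℝ, E) S)
    (hu : u ∈ slashedTangentBundle 𝓘(ℝ, E) M) : (sprayCoord S u).1 = fiberCoord u :=
  spray_fst hS.tangentStructure_apply hu

/-- The factor 2 of Euler's relation for S cancels the 1/2 in the connection. It means hS = S. -/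
lemma IsSpray.sprayConnection_radial (hS : IsSpray 𝓘(ℝ, E) S)
    (hu : u ∈ slashedTangentBundle 𝓘(ℝ, E) M) :
    sprayConnection S u (fiberCoord u) = (sprayCoord S u).2 := by
  have h : (fderiv ℝ (vectorFieldInChart 𝓘(ℝ, E).tangent S u) (extChartAt 𝓘(ℝ, E).tangent u u)
      (0, fiberCoord u)).2 = (2 : ℝ) • (sprayCoord S u).2 := congrArg Prod.snd (hS.fderiv_radial hu)
  rw [sprayConnection, h, smul_smul]
  norm_num

lemma formCoord_eq (θ : ∀ u : TangentBundle 𝓘(ℝ, E) M, TangentSpace 𝓘(ℝ, E).tangent u →L[ℝ] ℝ)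
    (u : TangentBundle 𝓘(ℝ, E) M) :
    oneFormInChart 𝓘(ℝ, E).tangent θ u (coords u) = formCoord θ u :=
  ContinuousLinearMap.ext fun ζ ↦ oneFormInChart_self_apply (I := 𝓘(ℝ, E).tangent) θ u ζ

lemma IsSemiBasic.formCoord_eq (hb : IsSemiBasic 𝓘(ℝ, E) θ)
    (hu : u ∈ slashedTangentBundle 𝓘(ℝ, E) M) {ξ η : E × E} (h : ξ.1 = η.1) :
    formCoord θ u ξ = formCoord θ u η :=
  hb.apply_eq hu h

section Conditions

variable (h : ProjectiveMetrizabilityConditions 𝓘(ℝ, E) S θ)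
include h

/-- ℒ_ℂθ = 0 is Euler's relation of degree zero for the coefficients of θ. -/
lemma ProjectiveMetrizabilityConditions.oneFormDeriv_radial
    (hu : u ∈ slashedTangentBundle 𝓘(ℝ, E) M) : oneFormDeriv θ u (0, fiberCoord u) = 0 := by
  refine ContinuousLinearMap.ext fun η ↦ ?_
  have h1 := h.semiBasic.lieDerivOneForm_liouville h.smooth hu η
  rw [h.lieDeriv u hu] at h1
  exact h1.symm

lemma ProjectiveMetrizabilityConditions.oneFormDeriv_vertical_symm
    (hu : u ∈ slashedTangentBundle 𝓘(ℝ, E) M) (ξ η : E × E) :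
    oneFormDeriv θ u (0, ξ.1) η = oneFormDeriv θ u (0, η.1) ξ := by
  have h1 := h.semiBasic.derivAlongOneForm_tangentStructure h.smooth hu ξ η
  exact sub_eq_zero.1 (h1.symm.trans (h.dJ u hu ξ η))

/-- Since hS = S, the equation d_hθ(S, η) = 0 reduces to dθ(S, hη) = 0. On a vertical vector, dθ(S,
·) is a y-derivative of θ evaluated on S, which the symmetry from d_Jθ = 0 turns into the vanishing
radial derivative. Horizontal and vertical vectors span. -/
lemma ProjectiveMetrizabilityConditions.extDerivCoord_spray (hS : IsSpray 𝓘(ℝ, E) S)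
    (hu : u ∈ slashedTangentBundle 𝓘(ℝ, E) M) (η : E × E) :
    extDerivCoord θ u (sprayCoord S u) η = 0 := by
  have h1 : extDerivCoord θ u
      ((sprayCoord S u).1, sprayConnection S u (sprayCoord S u).1) η +
      extDerivCoord θ u (sprayCoord S u) (η.1, sprayConnection S u η.1) -
        extDerivCoord θ u (sprayCoord S u) η = 0 :=
    (h.semiBasic.derivAlongOneForm_horizontalProjector hS hu (S u) η).symm.trans
      (h.dh u hu (S u) η)
  have h2 : ((sprayCoord S u).1, sprayConnection S u (sprayCoord S u).1) = sprayCoord S u := by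
    refine Prod.ext rfl ?_
    rw [hS.sprayCoord_fst hu]
    exact hS.sprayConnection_radial hu
  rw [h2, add_sub_cancel_left] at h1
  have h3 : ∀ b : E, extDerivCoord θ u (sprayCoord S u) (0, b) = 0 := by
    intro b
    rw [extDerivCoord_eq, h.semiBasic.oneFormDeriv_apply h.smooth hu,
      h.oneFormDeriv_vertical_symm hu (b, 0), hS.sprayCoord_fst hu, h.oneFormDeriv_radial hu]
    simp
  have h4 : η = (η.1, sprayConnection S u η.1) + (0, η.2 - sprayConnection S u η.1) := by simp
  rw [h4, map_add, h1, h3, add_zero]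

end Conditions

open Classical in
/-- The function `i_S θ` on the slashed tangent bundle, extended by zero. -/
def contractionWithSpray (S : ∀ u : TangentBundle 𝓘(ℝ, E) M, TangentSpace 𝓘(ℝ, E).tangent u)
    (θ : ∀ u : TangentBundle 𝓘(ℝ, E) M, TangentSpace 𝓘(ℝ, E).tangent u →L[ℝ] ℝ)
    (u : TangentBundle 𝓘(ℝ, E) M) : ℝ :=
  if u ∈ slashedTangentBundle 𝓘(ℝ, E) M then θ u (S u) else 0

lemma contractionWithSpray_apply (hu : u ∈ slashedTangentBundle 𝓘(ℝ, E) M) :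
    contractionWithSpray S θ u = θ u (S u) := if_pos hu

lemma contractionWithSpray_zero (x : M) : contractionWithSpray S θ ⟨x, 0⟩ = 0 :=
  if_neg fun h ↦ h rfl

/-- A semi-basic form sees only the first component of S, which is y; hence i_Sθ = θ_i yⁱ. -/
lemma IsSemiBasic.funInChart_contractionWithSpray (hb : IsSemiBasic 𝓘(ℝ, E) θ)
    (hS : IsSpray 𝓘(ℝ, E) S) (hu : u ∈ slashedTangentBundle 𝓘(ℝ, E) M) :
    funInChart (contractionWithSpray S θ) u =ᶠ[nhds (coords u)]
      fun z ↦ oneFormInChart 𝓘(ℝ, E).tangent θ u z (z.2, 0) := by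
  filter_upwards [eventually_slashed hu] with z hz
  have h1 : oneFormInChart 𝓘(ℝ, E).tangent θ u z (vectorFieldInChart 𝓘(ℝ, E).tangent S u z) =
      funInChart (contractionWithSpray S θ) u z :=
    (congrArg (θ ((extChartAt 𝓘(ℝ, E).tangent u).symm z))
      (chartInvDiff_chartDiff hz.1 (S ((extChartAt 𝓘(ℝ, E).tangent u).symm z)))).trans
        (contractionWithSpray_apply hz.2).symm
  rw [← h1, hb.oneFormInChart_apply hz.1 hz.2,
    vectorFieldInChart_fst hS.tangentStructure_apply hz.1 hz.2]

section Conditions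

variable (h : ProjectiveMetrizabilityConditions 𝓘(ℝ, E) S θ) (hS : IsSpray 𝓘(ℝ, E) S)
include h

lemma ProjectiveMetrizabilityConditions.formCoord_smul (x : M) {y : E} (hy : y ≠ 0) {l : ℝ}
    (hl : 0 < l) : formCoord θ ⟨x, l • y⟩ = formCoord θ ⟨x, y⟩ := by
  have hhom := posHomogeneous_of_euler (f := fun y : E ↦ formCoord θ ⟨x, y⟩)
    (f' := fun y ↦ (oneFormDeriv θ ⟨x, y⟩).comp (ContinuousLinearMap.inr ℝ E E)) (k := 0)
    (fun v hv ↦ ?_) (fun v hv ↦ ?_) hy hl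
  · simpa using hhom
  · have h1 := (h.smooth.contDiffAt (u := ⟨x, v⟩) hv).differentiableAt (by simp)
    have h2 : HasFDerivAt (oneFormInChart 𝓘(ℝ, E).tangent θ ⟨x, v⟩) (oneFormDeriv θ ⟨x, v⟩)
      (extChartAt 𝓘(ℝ, E) x x, v) := by
      have := h1.hasFDerivAt
      rw [extChartAt_tangent_self] at this
      unfold oneFormDeriv
      rw [extChartAt_tangent_self]
      exact this
    have h3 : HasFDerivAt (fun y : E ↦ (extChartAt 𝓘(ℝ, E) x x, y))
      (ContinuousLinearMap.inr ℝ E E) v := hasFDerivAt_prodMk_right _ _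
    refine (h2.comp v h3).congr_of_eventuallyEq (Filter.Eventually.of_forall fun y ↦ ?_)
    exact (ContinuousLinearMap.ext fun ζ ↦ oneFormInChart_fiber θ x v y ζ).symm
  · have h1 := h.oneFormDeriv_radial (u := ⟨x, v⟩) hv
    rw [Nat.cast_zero, zero_smul]
    exact h1

include hS

lemma ProjectiveMetrizabilityConditions.isSmoothHomogeneous :
    IsSmoothHomogeneous (contractionWithSpray S θ) where
  smooth := by
    intro u hu
    refine (contMDiffAt_iff_funInChart.2 ?_).contMDiffWithinAt
    refine ContDiffAt.congr_of_eventuallyEq ?_ (h.semiBasic.funInChart_contractionWithSpray hS hu)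
    exact ContDiffAt.clm_apply (h.smooth.contDiffAt hu) (contDiffAt_snd.prodMk contDiffAt_const)
  homogeneous := by
    rintro ⟨x, y⟩ l hl
    by_cases hy : (y : E) = 0
    · obtain rfl : y = 0 := hy
      rw [smul_zero, contractionWithSpray_zero, mul_zero]
    · have hy' : (l • y : E) ≠ 0 := smul_ne_zero hl.ne' hy
      have hu : (⟨x, y⟩ : TangentBundle 𝓘(ℝ, E) M) ∈ slashedTangentBundle 𝓘(ℝ, E) M := hy
      have hu' : (⟨x, l • y⟩ : TangentBundle 𝓘(ℝ, E) M) ∈ slashedTangentBundle 𝓘(ℝ, E) M := hy'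
      have e1 : formCoord θ ⟨x, l • y⟩ (sprayCoord S ⟨x, l • y⟩) =
          l * formCoord θ ⟨x, y⟩ (sprayCoord S ⟨x, y⟩) := by
        have e2 := h.formCoord_smul x hy hl
        refine (congrArg (fun L : E × E →L[ℝ] ℝ ↦ L (sprayCoord S ⟨x, l • y⟩)) e2).trans ?_
        rw [← smul_eq_mul, ← map_smul]
        refine h.semiBasic.formCoord_eq hu ?_
        rw [hS.sprayCoord_fst hu', Prod.smul_fst, hS.sprayCoord_fst hu]
        rfl
      rw [contractionWithSpray_apply hu']
      refine Eq.trans e1 ?_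
      rw [contractionWithSpray_apply hu]
      rfl

/-- In ∂(θ_i yⁱ)/∂yʲ = θ_j + yⁱ ∂θ_i/∂yʲ the last term equals yⁱ ∂θ_j/∂yⁱ by d_Jθ = 0, and this
vanishes by ℒ_ℂθ = 0. -/
lemma ProjectiveMetrizabilityConditions.vertDiff_eq (hu : u ∈ slashedTangentBundle 𝓘(ℝ, E) M) :
    θ u = vertDiff (contractionWithSpray S θ) u := by
  refine ContinuousLinearMap.ext fun ξ ↦ ?_
  rw [vertDiff_apply (h.isSmoothHomogeneous hS).smooth hu]
  have h1 : HasFDerivAt (fun z : E × E ↦ ((z.2, 0) : E × E))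
      ((ContinuousLinearMap.inl ℝ E E).comp (ContinuousLinearMap.snd ℝ E E)) (coords u) :=
    ((ContinuousLinearMap.inl ℝ E E).comp (ContinuousLinearMap.snd ℝ E E)).hasFDerivAt
  have h2 : HasFDerivAt (oneFormInChart 𝓘(ℝ, E).tangent θ u) (oneFormDeriv θ u) (coords u) :=
    ((h.smooth.contDiffAt hu).differentiableAt (by simp)).hasFDerivAt
  have h3 := ((h2.clm_apply h1).congr_of_eventuallyEq
    (h.semiBasic.funInChart_contractionWithSpray hS hu)).fderiv
  have key : ∀ v : E, chartD1 (contractionWithSpray S θ) u (0, v) = formCoord θ u (v, 0) := by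
    intro v
    have h5 := h.oneFormDeriv_vertical_symm hu (v, 0) (fiberCoord u, 0)
    rw [h.oneFormDeriv_radial hu] at h5
    rw [chartD1, h3, ← formCoord_eq, coords_snd]
    simpa using h5
  rw [key]
  exact h.semiBasic.formCoord_eq hu rfl

lemma ProjectiveMetrizabilityConditions.extDerivCoord_vertDiff
    (hu : u ∈ slashedTangentBundle 𝓘(ℝ, E) M) :
    extDerivCoord (vertDiff (contractionWithSpray S θ)) u = extDerivCoord θ u :=
  (extDerivOneForm_congr (fun _ hw ↦ h.vertDiff_eq hS hw) hu).symm

omit hS in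
lemma ProjectiveMetrizabilityConditions.contractionWithSpray_pos
    (hu : u ∈ slashedTangentBundle 𝓘(ℝ, E) M) : 0 < contractionWithSpray S θ u := by
  rw [contractionWithSpray_apply hu]
  exact h.pos u hu

lemma ProjectiveMetrizabilityConditions.isFinsler [FiniteDimensional ℝ E] :
    IsFinsler 𝓘(ℝ, E) (contractionWithSpray S θ) where
  continuous := (h.isSmoothHomogeneous hS).continuous contractionWithSpray_zero
  smooth := (h.isSmoothHomogeneous hS).smooth
  pos := fun u hu ↦ h.contractionWithSpray_pos hu
  zero := contractionWithSpray_zero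
  homogeneous := (h.isSmoothHomogeneous hS).homogeneous
  -- The rank hypothesis on dθ = dd_JF is converted by `IsSmoothHomogeneous.rank_iff`, with S as the
  -- second kernel direction besides ℂ.
  regular := by
    intro u hu
    have e := h.extDerivCoord_vertDiff hS hu
    have hi := ((h.isSmoothHomogeneous hS).rank_iff hu (h.contractionWithSpray_pos hu)
      (hS.sprayCoord_fst hu) (by rw [e]; exact h.extDerivCoord_spray hS hu)).1
      (by rw [e]; exact h.rank u hu)
    exact LinearMap.finrank_range_of_inj hi

end Conditions

end FormToFunction

/-! ### The geodesic spray of F as S - (S(F)/F) ℂ -/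

section GeodesicSpray

variable {E : Type*} [NormedAddCommGroup E] [NormedSpace ℝ E]
  {M : Type*} [TopologicalSpace M] [ChartedSpace E M] [IsManifold 𝓘(ℝ, E) ∞ M]
  {S : ∀ u : TangentBundle 𝓘(ℝ, E) M, TangentSpace 𝓘(ℝ, E).tangent u}
  {F a : TangentBundle 𝓘(ℝ, E) M → ℝ} {u : TangentBundle 𝓘(ℝ, E) M}

/-- The vector field `S + a ℂ`. -/
def addLiouville (S : ∀ u : TangentBundle 𝓘(ℝ, E) M, TangentSpace 𝓘(ℝ, E).tangent u)
    (a : TangentBundle 𝓘(ℝ, E) M → ℝ) (u : TangentBundle 𝓘(ℝ, E) M) :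
    TangentSpace 𝓘(ℝ, E).tangent u :=
  S u + a u • liouville 𝓘(ℝ, E) u

lemma sprayCoord_addLiouville
    (S : ∀ u : TangentBundle 𝓘(ℝ, E) M, TangentSpace 𝓘(ℝ, E).tangent u)
    (a : TangentBundle 𝓘(ℝ, E) M → ℝ) (u : TangentBundle 𝓘(ℝ, E) M) :
    sprayCoord (addLiouville S a) u = sprayCoord S u + a u • ((0, fiberCoord u) : E × E) :=
  congrArg (fun w : E × E ↦ sprayCoord S u + a u • w) (liouville_apply u)

lemma vectorFieldInChart_addLiouville
    (S : ∀ u : TangentBundle 𝓘(ℝ, E) M, TangentSpace 𝓘(ℝ, E).tangent u)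
    (a : TangentBundle 𝓘(ℝ, E) M → ℝ) (u : TangentBundle 𝓘(ℝ, E) M) :
    vectorFieldInChart 𝓘(ℝ, E).tangent (addLiouville S a) u =ᶠ[nhds (coords u)]
      fun z ↦ vectorFieldInChart 𝓘(ℝ, E).tangent S u z + funInChart a u z • ((0, z.2) : E × E) := by
  filter_upwards [extChartAt_target_mem_nhds (I := 𝓘(ℝ, E).tangent) u] with z hz
  rw [← vectorFieldInChart_liouville hz]
  simp only [vectorFieldInChart, addLiouville, funInChart, Function.comp, map_add, map_smul]

lemma sprayCoord_eq (S : ∀ u : TangentBundle 𝓘(ℝ, E) M, TangentSpace 𝓘(ℝ, E).tangent u)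
    (u : TangentBundle 𝓘(ℝ, E) M) :
    vectorFieldInChart 𝓘(ℝ, E).tangent S u (coords u) = sprayCoord S u :=
  vectorFieldInChart_self (I := 𝓘(ℝ, E).tangent) S u

lemma IsSpray.fderiv_radial_coords (hS : IsSpray 𝓘(ℝ, E) S)
    (hu : u ∈ slashedTangentBundle 𝓘(ℝ, E) M) :
    fderiv ℝ (vectorFieldInChart 𝓘(ℝ, E).tangent S u) (coords u) (0, fiberCoord u) =
      (fiberCoord u, (2 : ℝ) • (sprayCoord S u).2) :=
  hS.fderiv_radial hu

lemma IsSpray.hasFDerivAt (hS : IsSpray 𝓘(ℝ, E) S)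
    (hu : u ∈ slashedTangentBundle 𝓘(ℝ, E) M) :
    HasFDerivAt (vectorFieldInChart 𝓘(ℝ, E).tangent S u)
      (fderiv ℝ (vectorFieldInChart 𝓘(ℝ, E).tangent S u) (coords u)) (coords u) :=
  ((hS.contDiffAt hu).differentiableAt (by simp)).hasFDerivAt

/-- `S + a ℂ` is a spray if `S` is one and `a` satisfies Euler's relation of degree one. -/
lemma IsSpray.isSpray_addLiouville (hS : IsSpray 𝓘(ℝ, E) S)
    (ha : ContMDiffOn 𝓘(ℝ, E).tangent 𝓘(ℝ, ℝ) ∞ a (slashedTangentBundle 𝓘(ℝ, E) M))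
    (ha' : ∀ u ∈ slashedTangentBundle 𝓘(ℝ, E) M, chartD1 a u (0, fiberCoord u) = a u) :
    IsSpray 𝓘(ℝ, E) (addLiouville S a) where
  smooth := by
    intro u hu
    refine ((smoothVectorField_contDiffAt_iff _ u).2 ?_).contMDiffWithinAt
    refine ContDiffAt.congr_of_eventuallyEq ?_ (vectorFieldInChart_addLiouville S a u)
    exact (hS.contDiffAt hu).add
      ((contDiffAt_funInChart ha hu).smul (contDiffAt_const.prodMk contDiffAt_snd))
  tangentStructure_apply := by
    intro u hu
    rw [_root_.tangentStructure_apply, liouville_apply]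
    have h1 : (sprayCoord (addLiouville S a) u).1 = fiberCoord u := by
      rw [sprayCoord_addLiouville, Prod.fst_add, hS.sprayCoord_fst hu]
      simp
    exact congrArg (fun w : E ↦ ((0, w) : E × E)) h1
  homogeneous := by
    intro u hu
    have h1 : HasFDerivAt (fun z : E × E ↦ ((0, z.2) : E × E))
        ((ContinuousLinearMap.inr ℝ E E).comp (ContinuousLinearMap.snd ℝ E E)) (coords u) :=
      ((ContinuousLinearMap.inr ℝ E E).comp (ContinuousLinearMap.snd ℝ E E)).hasFDerivAt
    have h2 := ((hS.hasFDerivAt hu).add ((hasFDerivAt_funInChart ha hu).smul h1)).congr_of_eventuallyEq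
      (vectorFieldInChart_addLiouville S a u)
    have h3 : fderiv ℝ (vectorFieldInChart 𝓘(ℝ, E).tangent (addLiouville S a) u) (coords u)
        (0, fiberCoord u) - (0, (sprayCoord (addLiouville S a) u).2) =
          sprayCoord (addLiouville S a) u := by
      have h4 := hS.fderiv_radial_coords hu
      have h5 := hS.sprayCoord_fst hu
      rw [h2.fderiv, sprayCoord_addLiouville, funInChart_coords, coords_snd]
      simp only [add_apply, smul_apply, h4, ContinuousLinearMap.smulRight_apply, ha' u hu,
        ContinuousLinearMap.comp_apply, ContinuousLinearMap.coe_snd', ContinuousLinearMap.inr_apply]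
      refine Prod.ext ?_ ?_
      · simp [h5]
      · simp only [Prod.snd_sub, Prod.snd_add, Prod.smul_snd]
        module
    exact (mlieBracket_liouville u).trans h3

/-- The function `-S(F) / F`. -/
def geodesicSprayFactor (S : ∀ u : TangentBundle 𝓘(ℝ, E) M, TangentSpace 𝓘(ℝ, E).tangent u)
    (F : TangentBundle 𝓘(ℝ, E) M → ℝ) (u : TangentBundle 𝓘(ℝ, E) M) : ℝ :=
  -(mvfderiv 𝓘(ℝ, E).tangent F u (S u) / F u)

lemma funInChart_geodesicSprayFactor
    (hF : ContMDiffOn 𝓘(ℝ, E).tangent 𝓘(ℝ, ℝ) ∞ F (slashedTangentBundle 𝓘(ℝ, E) M))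
    (hu : u ∈ slashedTangentBundle 𝓘(ℝ, E) M) :
    funInChart (geodesicSprayFactor S F) u =ᶠ[nhds (coords u)] fun z ↦
      -(fderiv ℝ (funInChart F u) z (vectorFieldInChart 𝓘(ℝ, E).tangent S u z) *
        (funInChart F u z)⁻¹) := by
  filter_upwards [eventually_slashed hu] with z hz
  have h1 := mvfderiv_chartInvDiff hz.1 (mdifferentiableAt_of_contMDiffOn_slashed hF hz.2)
    (vectorFieldInChart 𝓘(ℝ, E).tangent S u z)
  rw [vectorFieldInChart, chartInvDiff_chartDiff hz.1] at h1
  have h2 : funInChart (geodesicSprayFactor S F) u z =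
    -(mvfderiv 𝓘(ℝ, E).tangent F _ (S ((extChartAt 𝓘(ℝ, E).tangent u).symm z)) /
      funInChart F u z) := rfl
  rw [h2, h1, div_eq_mul_inv]
  rfl

lemma contMDiffOn_geodesicSprayFactor (hS : IsSpray 𝓘(ℝ, E) S)
    (hF : ContMDiffOn 𝓘(ℝ, E).tangent 𝓘(ℝ, ℝ) ∞ F (slashedTangentBundle 𝓘(ℝ, E) M))
    (hpos : ∀ u ∈ slashedTangentBundle 𝓘(ℝ, E) M, 0 < F u) :
    ContMDiffOn 𝓘(ℝ, E).tangent 𝓘(ℝ, ℝ) ∞ (geodesicSprayFactor S F)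
      (slashedTangentBundle 𝓘(ℝ, E) M) := by
  intro u hu
  refine (contMDiffAt_iff_funInChart.2 ?_).contMDiffWithinAt
  refine ContDiffAt.congr_of_eventuallyEq ?_ (funInChart_geodesicSprayFactor hF hu)
  refine (((contDiffAt_fderiv_funInChart hF hu).clm_apply (hS.contDiffAt hu)).mul
    ((contDiffAt_funInChart hF hu).inv ?_)).neg
  rw [funInChart_coords]
  exact (hpos u hu).ne'

lemma geodesicSprayFactor_eq
    (hF : ContMDiffOn 𝓘(ℝ, E).tangent 𝓘(ℝ, ℝ) ∞ F (slashedTangentBundle 𝓘(ℝ, E) M))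
    (hu : u ∈ slashedTangentBundle 𝓘(ℝ, E) M) :
    geodesicSprayFactor S F u = -(chartD1 F u (sprayCoord S u) / F u) :=
  congrArg (fun r ↦ -(r / F u)) (mvfderiv_eq_chartD1 hF hu (S u))

/-- S(F) satisfies Euler's relation of degree two and F that of degree one, so the quotient has
degree one, as needed for S + aℂ to be a spray. -/
lemma IsSmoothHomogeneous.chartD1_geodesicSprayFactor (h : IsSmoothHomogeneous F)
    (hS : IsSpray 𝓘(ℝ, E) S) (hu : u ∈ slashedTangentBundle 𝓘(ℝ, E) M) (hpos : 0 < F u) :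
    chartD1 (geodesicSprayFactor S F) u (0, fiberCoord u) = geodesicSprayFactor S F u := by
  have hne : funInChart F u (coords u) ≠ 0 := by rw [funInChart_coords]; exact hpos.ne'
  have h1 := (hasFDerivAt_fderiv_funInChart h.smooth hu).clm_apply (hS.hasFDerivAt hu)
  have h2 := (hasDerivAt_inv hne).comp_hasFDerivAt (coords u) (hasFDerivAt_funInChart h.smooth hu)
  have h3 := ((h1.mul h2).neg.congr_of_eventuallyEq
    (funInChart_geodesicSprayFactor h.smooth hu)).fderiv
  have e1 : chartD2 F u (0, fiberCoord u) (sprayCoord S u) = chartD1 F u (fiberCoord u, 0) := by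
    rw [chartD2_symm h.smooth hu, h.chartD2_radial hu, hS.sprayCoord_fst hu]
  -- The derivative of S(F) along ℂ is DF(DS(ℂ)) + D²F(ℂ, S) = DF(y, 2σ) + DF(y, 0) = 2 S(F).
  have e2 : chartD1 F u (fiberCoord u, (2 : ℝ) • (sprayCoord S u).2) +
      chartD1 F u (fiberCoord u, 0) = 2 * chartD1 F u (sprayCoord S u) := by
    rw [← map_add, ← smul_eq_mul, ← map_smul]
    congr 1
    refine Prod.ext ?_ ?_
    · rw [Prod.smul_fst, hS.sprayCoord_fst hu, two_smul ℝ (fiberCoord u)]; rfl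
    · simp
  have e3 : fderiv ℝ (funInChart F u) (coords u) = chartD1 F u := rfl
  rw [geodesicSprayFactor_eq h.smooth hu, chartD1, h3]
  simp only [neg_apply, add_apply, smul_apply, smul_eq_mul, Function.comp, sprayCoord_eq,
    funInChart_coords, h.chartD1_radial hu, ContinuousLinearMap.comp_apply,
    ContinuousLinearMap.flip_apply, hS.fderiv_radial_coords hu, e1, e2, e3]
  field_simp
  ring

/-- If `i_S d d_J F = 0`, then the geodesic spray of `F` is `S - (S(F) / F) ℂ`. -/
lemma IsSmoothHomogeneous.isGeodesicSpray (h : IsSmoothHomogeneous F)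
    (hS : IsSpray 𝓘(ℝ, E) S) (hpos : ∀ u ∈ slashedTangentBundle 𝓘(ℝ, E) M, 0 < F u)
    (hX : ∀ u ∈ slashedTangentBundle 𝓘(ℝ, E) M, ∀ η,
      extDerivCoord (vertDiff F) u (sprayCoord S u) η = 0) :
    IsGeodesicSpray 𝓘(ℝ, E) F (addLiouville S (geodesicSprayFactor S F)) := by
  have hG : IsSpray 𝓘(ℝ, E) (addLiouville S (geodesicSprayFactor S F)) :=
    hS.isSpray_addLiouville (contMDiffOn_geodesicSprayFactor hS h.smooth hpos)
      fun u hu ↦ h.chartD1_geodesicSprayFactor hS hu (hpos u hu)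
  refine ⟨hG, fun u hu ↦ ?_⟩
  -- Adding aℂ preserves i_S dd_JF = 0, and the factor a = -S(F)/F is chosen so that (S + aℂ)(F) =
  -- S(F) + aF = 0.
  have h1 := (h.geodesicSpray_equation_iff hu (hpos u hu) (hG.sprayCoord_fst hu)).2 ⟨?_, ?_⟩
  · refine ContinuousLinearMap.ext fun η ↦ (h1 η).trans ?_
    exact congrArg Neg.neg (mvfderiv_eq_chartD1 (contMDiffOn_sq h.smooth) hu η).symm
  · rw [sprayCoord_addLiouville, map_add, map_smul, h.chartD1_radial hu,
      geodesicSprayFactor_eq h.smooth hu, smul_eq_mul]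
    have := (hpos u hu).ne'
    field_simp
    ring
  · intro η
    rw [sprayCoord_addLiouville, map_add, map_smul, add_apply, smul_apply, hX u hu,
      h.extDerivCoord_liouville hu, smul_zero, add_zero]

lemma IsSpray.projectivelyEquivalent_addLiouville (hS : IsSpray 𝓘(ℝ, E) S)
    (hS' : IsSpray 𝓘(ℝ, E) (addLiouville S a))
    (ha : ContMDiffOn 𝓘(ℝ, E).tangent 𝓘(ℝ, ℝ) ∞ a (slashedTangentBundle 𝓘(ℝ, E) M)) :
    ProjectivelyEquivalent 𝓘(ℝ, E) S (addLiouville S a) := by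
  have h : ∀ u, (sprayCoord (addLiouville S a) u).2 = (sprayCoord S u).2 + a u • fiberCoord u := by
    intro u
    rw [sprayCoord_addLiouville]
    rfl
  refine ⟨geodesicsReparamTo_of_eq_add_liouville hS hS' ha fun u _ ↦ h u,
    geodesicsReparamTo_of_eq_add_liouville hS' hS (a := fun u ↦ -a u) ha.neg fun u _ ↦ ?_⟩
  have h1 : (sprayCoord S u).2 =
      (sprayCoord (addLiouville S a) u).2 + (-a u) • fiberCoord u := by
    rw [h]; module
  exact h1

lemma ProjectiveMetrizabilityConditions.isProjectivelyMetrizedBy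
    {θ : ∀ u : TangentBundle 𝓘(ℝ, E) M, TangentSpace 𝓘(ℝ, E).tangent u →L[ℝ] ℝ}
    (h : ProjectiveMetrizabilityConditions 𝓘(ℝ, E) S θ) (hS : IsSpray 𝓘(ℝ, E) S) :
    IsProjectivelyMetrizedBy 𝓘(ℝ, E) S (contractionWithSpray S θ) := by
  have hF := h.isSmoothHomogeneous hS
  have hpos : ∀ u ∈ slashedTangentBundle 𝓘(ℝ, E) M, 0 < contractionWithSpray S θ u :=
    fun u hu ↦ h.contractionWithSpray_pos hu
  have hG := hF.isGeodesicSpray hS hpos fun u hu η ↦ by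
    rw [h.extDerivCoord_vertDiff hS hu, h.extDerivCoord_spray hS hu]
  exact ⟨_, hG, hS.projectivelyEquivalent_addLiouville hG.isSpray
    (contMDiffOn_geodesicSprayFactor hS hF.smooth hpos)⟩

end GeodesicSpray

/-! ### Symmetry of the third derivative -/

section ThirdDerivative

variable {V : Type*} [NormedAddCommGroup V] [NormedSpace ℝ V] {f : V → ℝ} {z : V}

lemma ContDiffAt.hasFDerivAt_fderiv_fderiv (hf : ContDiffAt ℝ ∞ f z) :
    HasFDerivAt (fderiv ℝ (fderiv ℝ f)) (fderiv ℝ (fderiv ℝ (fderiv ℝ f)) z) z :=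
  (((hf.fderiv_right (m := ∞) (by simp)).fderiv_right (m := ∞) (by simp)).differentiableAt
    (by simp)).hasFDerivAt

lemma ContDiffAt.eventually_symm_fderiv_fderiv (hf : ContDiffAt ℝ ∞ f z) :
    ∀ᶠ w in nhds z, ∀ ξ ζ, fderiv ℝ (fderiv ℝ f) w ξ ζ = fderiv ℝ (fderiv ℝ f) w ζ ξ := by
  filter_upwards [(hf.of_le (m := 2) ENat.LEInfty.out).eventually (by simp)] with w hw
  exact hw.isSymmSndFDerivAt (by simp)

/-- The third derivative is symmetric in its first and last arguments. -/
lemma ContDiffAt.third_fderiv_symm (hf : ContDiffAt ℝ ∞ f z) (ξ ζ η : V) :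
    fderiv ℝ (fderiv ℝ (fderiv ℝ f)) z ξ ζ η = fderiv ℝ (fderiv ℝ (fderiv ℝ f)) z η ζ ξ := by
  -- The swap of the first two arguments is symmetry of the second derivative of `fderiv ℝ f`; the
  -- swap of the last two comes from differentiating the symmetry of the Hessian. Together they give
  -- the swap of the outer ones.
  have h12 : ∀ ξ ζ η, fderiv ℝ (fderiv ℝ (fderiv ℝ f)) z ξ ζ η =
      fderiv ℝ (fderiv ℝ (fderiv ℝ f)) z ζ ξ η := fun ξ ζ η ↦
    congrArg (fun L : V →L[ℝ] ℝ ↦ L η) (((hf.fderiv_right (m := ∞) (by simp)).isSymmSndFDerivAt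
      (by simpa using ENat.LEInfty.out)) ξ ζ)
  have h23 : ∀ ξ ζ η, fderiv ℝ (fderiv ℝ (fderiv ℝ f)) z ξ ζ η =
      fderiv ℝ (fderiv ℝ (fderiv ℝ f)) z ξ η ζ := by
    intro ξ ζ η
    have h1 := (hf.hasFDerivAt_fderiv_fderiv.clm_apply (hasFDerivAt_const ζ z)).clm_apply
      (hasFDerivAt_const η z)
    have h2 := (hf.hasFDerivAt_fderiv_fderiv.clm_apply (hasFDerivAt_const η z)).clm_apply
      (hasFDerivAt_const ζ z)
    have h3 := h1.unique (h2.congr_of_eventuallyEq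
      (hf.eventually_symm_fderiv_fderiv.mono fun w hw ↦ hw ζ η))
    simpa using congrArg (fun L : V →L[ℝ] ℝ ↦ L ξ) h3
  rw [h12, h23, h12]

end ThirdDerivative

/-! ### Isotropy of horizontal spaces in coordinates -/

section FiberDerivative

variable {E : Type*} [NormedAddCommGroup E] [NormedSpace ℝ E] {f : E × E → ℝ} {s : E × E → E × E}
  {s' : E × E →L[ℝ] E × E} {x y : E}

/-- The hypothesis is i_s dd_Jf = 0 near one point of a fibre, and its derivative is taken in the
fibre direction b by the product rule. -/
lemma fiber_derivative_spray_equation (hf : ContDiffAt ℝ ∞ f (x, y)) (hs : HasFDerivAt s s' (x, y))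
    (h : ∀ᶠ v in nhds y, ∀ a : E,
      fderiv ℝ (fderiv ℝ f) (x, v) (s (x, v)) (0, a) = fderiv ℝ f (x, v) (a, 0)) (a b : E) :
    fderiv ℝ (fderiv ℝ (fderiv ℝ f)) (x, y) (0, b) (s (x, y)) (0, a) +
      fderiv ℝ (fderiv ℝ f) (x, y) (s' (0, b)) (0, a) =
        fderiv ℝ (fderiv ℝ f) (x, y) (0, b) (a, 0) := by
  have hi : HasFDerivAt (fun v : E ↦ (x, v)) (ContinuousLinearMap.inr ℝ E E) y :=
    hasFDerivAt_prodMk_right _ _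
  have h1 := ((hf.hasFDerivAt_fderiv_fderiv.clm_apply hs).clm_apply
    (hasFDerivAt_const ((0, a) : E × E) (x, y))).comp y hi
  have hd : HasFDerivAt (fderiv ℝ f) (fderiv ℝ (fderiv ℝ f) (x, y)) (x, y) :=
    ((hf.fderiv_right (m := ∞) (by simp)).differentiableAt (by simp)).hasFDerivAt
  have h2 := (hd.clm_apply (hasFDerivAt_const ((a, 0) : E × E) (x, y))).comp y hi
  have h3 := h1.unique (h2.congr_of_eventuallyEq (h.mono fun v hv ↦ hv a))
  have h4 := congrArg (fun L : E →L[ℝ] ℝ ↦ L b) h3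
  simp at h4
  linarith

/-- If `s = (y, σ)` is a spray with `i_s d d_J f = 0` then the horizontal spaces of `s` are
isotropic for `d d_J f`. -/
lemma fderiv_fderiv_horizontal_symm (hf : ContDiffAt ℝ ∞ f (x, y)) (hs : HasFDerivAt s s' (x, y))
    (hs' : ∀ b, (s' (0, b)).1 = b)
    (h : ∀ᶠ v in nhds y, ∀ a : E,
      fderiv ℝ (fderiv ℝ f) (x, v) (s (x, v)) (0, a) = fderiv ℝ f (x, v) (a, 0)) (a b : E) :
    fderiv ℝ (fderiv ℝ f) (x, y) (b, (1 / 2 : ℝ) • (s' (0, b)).2) (0, a) =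
      fderiv ℝ (fderiv ℝ f) (x, y) (a, (1 / 2 : ℝ) • (s' (0, a)).2) (0, b) := by
  have hsymm : ∀ ξ ζ, fderiv ℝ (fderiv ℝ f) (x, y) ξ ζ = fderiv ℝ (fderiv ℝ f) (x, y) ζ ξ :=
    hf.eventually_symm_fderiv_fderiv.self_of_nhds
  -- Twice the horizontal lift of b is s'(0, b) + (b, 0), because s'(0, b) has first component b.
  have key : ∀ a b, (2 : ℝ) * fderiv ℝ (fderiv ℝ f) (x, y) (b, (1 / 2 : ℝ) • (s' (0, b)).2) (0, a) =
      fderiv ℝ (fderiv ℝ f) (x, y) (s' (0, b)) (0, a) +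
        fderiv ℝ (fderiv ℝ f) (x, y) (0, a) (b, 0) := by
    intro a b
    rw [hsymm (0, a) (b, 0), ← add_apply, ← map_add, ← smul_eq_mul, ← smul_apply, ← map_smul]
    congr 2
    refine Prod.ext ?_ ?_
    · simp [hs', two_smul]
    · simp
  have h1 := fiber_derivative_spray_equation hf hs h a b
  have h2 := fiber_derivative_spray_equation hf hs h b a
  have h3 := hf.third_fderiv_symm (0, b) (s (x, y)) (0, a)
  have h4 := key a b
  have h5 := key b a
  -- Twice the left side is D²f((0, b), (a, 0)) + D²f((0, a), (b, 0)) minus the third derivative on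
  -- (0, b), s, (0, a), an expression symmetric in a and b.
  linarith

end FiberDerivative

/-! ### From the Finsler function F to the form d_JF -/

section FunctionToForm

variable {E : Type*} [NormedAddCommGroup E] [NormedSpace ℝ E]
  {M : Type*} [TopologicalSpace M] [ChartedSpace E M] [IsManifold 𝓘(ℝ, E) ∞ M]
  {S SF : ∀ u : TangentBundle 𝓘(ℝ, E) M, TangentSpace 𝓘(ℝ, E).tangent u}
  {F : TangentBundle 𝓘(ℝ, E) M → ℝ} {u : TangentBundle 𝓘(ℝ, E) M}

lemma IsGeodesicSpray.extDerivCoord_eq_zero (hF : IsFinsler 𝓘(ℝ, E) F)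
    (hG : IsGeodesicSpray 𝓘(ℝ, E) F SF) (hu : u ∈ slashedTangentBundle 𝓘(ℝ, E) M) (η : E × E) :
    extDerivCoord (vertDiff F) u (sprayCoord SF u) η = 0 := by
  have h := hF.isSmoothHomogeneous
  refine ((h.geodesicSpray_equation_iff hu (hF.pos u hu)
    (hG.isSpray.sprayCoord_fst hu)).1 fun ζ ↦ ?_).2 η
  have h1 := congrArg (fun L : E × E →L[ℝ] ℝ ↦ L ζ) (hG.eq u hu)
  refine Eq.trans h1 ?_
  exact congrArg Neg.neg (mvfderiv_eq_chartD1 (contMDiffOn_sq h.smooth) hu ζ)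

/-- The equation `i_S d d_J F = 0` is projectively invariant. -/
lemma IsGeodesicSpray.extDerivCoord_eq_zero_of_geodesicsReparamTo [CompleteSpace E]
    (hF : IsFinsler 𝓘(ℝ, E) F) (hG : IsGeodesicSpray 𝓘(ℝ, E) F SF) (hS : IsSpray 𝓘(ℝ, E) S)
    (hP : GeodesicsReparamTo 𝓘(ℝ, E) SF S) (hu : u ∈ slashedTangentBundle 𝓘(ℝ, E) M) (η : E × E) :
    extDerivCoord (vertDiff F) u (sprayCoord S u) η = 0 := by
  obtain ⟨a, ha⟩ := exists_eq_add_liouville_of_geodesicsReparamTo hG.isSpray hS hP hu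
  have h1 : sprayCoord S u = sprayCoord SF u + a • ((0, fiberCoord u) : E × E) := by
    refine Prod.ext ?_ ha
    rw [hS.sprayCoord_fst hu, Prod.fst_add, hG.isSpray.sprayCoord_fst hu]
    simp
  rw [h1, map_add, map_smul, add_apply, smul_apply, hG.extDerivCoord_eq_zero hF hu,
    hF.isSmoothHomogeneous.extDerivCoord_liouville hu, smul_zero, add_zero]

/-- Horizontal spaces of `S` are isotropic for `d d_J F` if `i_S d d_J F = 0`. -/
lemma IsSmoothHomogeneous.chartD2_horizontal_symm (h : IsSmoothHomogeneous F)
    (hS : IsSpray 𝓘(ℝ, E) S)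
    (hX : ∀ u ∈ slashedTangentBundle 𝓘(ℝ, E) M, ∀ η,
      extDerivCoord (vertDiff F) u (sprayCoord S u) η = 0)
    (hu : u ∈ slashedTangentBundle 𝓘(ℝ, E) M) (a b : E) :
    chartD2 F u (b, sprayConnection S u b) (0, a) =
      chartD2 F u (a, sprayConnection S u a) (0, b) := by
  obtain ⟨x, y⟩ := u
  have hc : ∀ v : E, coords (⟨x, v⟩ : TangentBundle 𝓘(ℝ, E) M) = (extChartAt 𝓘(ℝ, E) x x, v) :=
    fun v ↦ extChartAt_tangent_self x v v
  have hf := contDiffAt_funInChart h.smooth hu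
  have hs := hS.hasFDerivAt hu
  have hs' : ∀ b, (fderiv ℝ (vectorFieldInChart 𝓘(ℝ, E).tangent S ⟨x, y⟩) (coords ⟨x, y⟩)
      (0, b)).1 = b := fun b ↦ hS.fderiv_fst hu (0, b)
  -- The hypothesis at the points (x, v) is read in the single chart centred at (x, y), which is the
  -- chart centred at each of them.
  have hev : ∀ᶠ v in nhds (y : E), ∀ a : E,
      fderiv ℝ (fderiv ℝ (funInChart F ⟨x, y⟩)) (extChartAt 𝓘(ℝ, E) x x, v)
        (vectorFieldInChart 𝓘(ℝ, E).tangent S ⟨x, y⟩ (extChartAt 𝓘(ℝ, E) x x, v)) (0, a) =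
      fderiv ℝ (funInChart F ⟨x, y⟩) (extChartAt 𝓘(ℝ, E) x x, v) (a, 0) := by
    filter_upwards [isOpen_ne.mem_nhds (show (y : E) ≠ 0 from hu)] with v hv a
    have h1 := hX ⟨x, v⟩ hv (a, 0)
    rw [h.extDerivCoord_spray hv (hS.sprayCoord_fst hv), sub_eq_zero, chartD2, chartD1, hc] at h1
    exact (congrArg (fun ζ : E × E ↦ fderiv ℝ (fderiv ℝ (funInChart F ⟨x, y⟩))
      (extChartAt 𝓘(ℝ, E) x x, v) ζ (0, a)) (vectorFieldInChart_fiber S x y v)).trans h1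
  have hcy : coords (⟨x, y⟩ : TangentBundle 𝓘(ℝ, E) M) = (extChartAt 𝓘(ℝ, E) x x, (y : E)) := hc y
  unfold chartD2 sprayConnection
  change fderiv ℝ (fderiv ℝ (funInChart F ⟨x, y⟩)) (coords ⟨x, y⟩) (b, (1 / 2 : ℝ) •
    (fderiv ℝ (vectorFieldInChart 𝓘(ℝ, E).tangent S ⟨x, y⟩) (coords ⟨x, y⟩) (0, b)).2) (0, a) =
    fderiv ℝ (fderiv ℝ (funInChart F ⟨x, y⟩)) (coords ⟨x, y⟩) (a, (1 / 2 : ℝ) •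
    (fderiv ℝ (vectorFieldInChart 𝓘(ℝ, E).tangent S ⟨x, y⟩) (coords ⟨x, y⟩) (0, a)).2) (0, b)
  rw [hcy] at hf hs hs' ⊢
  exact fderiv_fderiv_horizontal_symm hf hs hs' hev a b

lemma IsFinsler.projectiveMetrizabilityConditions [FiniteDimensional ℝ E]
    (hF : IsFinsler 𝓘(ℝ, E) F) (hG : IsGeodesicSpray 𝓘(ℝ, E) F SF) (hS : IsSpray 𝓘(ℝ, E) S)
    (hP : GeodesicsReparamTo 𝓘(ℝ, E) SF S) :
    ProjectiveMetrizabilityConditions 𝓘(ℝ, E) S (vertDiff F) := by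
  have : CompleteSpace E := FiniteDimensional.complete ℝ E
  have h := hF.isSmoothHomogeneous
  have hX : ∀ u ∈ slashedTangentBundle 𝓘(ℝ, E) M, ∀ η,
      extDerivCoord (vertDiff F) u (sprayCoord S u) η = 0 := fun u hu ↦
    hG.extDerivCoord_eq_zero_of_geodesicsReparamTo hF hS hP hu
  have hb := isSemiBasic_vertDiff h.smooth
  have hsm := smoothOneFormOn_vertDiff h.smooth
  refine ⟨hsm, hb, fun u hu ↦ ?_, fun u hu ↦ ?_, fun u hu ↦ ?_, fun u hu ξ η ↦ ?_,
    fun u hu ξ η ↦ ?_⟩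
  · refine (h.rank_iff hu (hF.pos u hu) (hS.sprayCoord_fst hu) (hX u hu)).2 ?_
    have h1 := LinearMap.finrank_range_add_finrank_ker (metricTensor 𝓘(ℝ, E) F u).toLinearMap
    have h2 := hF.regular u hu
    exact LinearMap.ker_eq_bot.1 (Submodule.finrank_eq_zero.1 (by omega))
  · have h1 : vertDiff F u (S u) = chartD1 F u (0, (sprayCoord S u).1) :=
      vertDiff_apply h.smooth hu (S u)
    rw [h1, hS.sprayCoord_fst hu, h.chartD1_radial hu]
    exact hF.pos u hu
  · refine ContinuousLinearMap.ext fun η ↦ (hb.lieDerivOneForm_liouville hsm hu η).trans ?_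
    refine (oneFormDeriv_vertDiff h.smooth hu _ _).trans ?_
    rw [chartD2_symm h.smooth hu]
    exact h.chartD2_vertical_radial hu _
  · refine (hb.derivAlongOneForm_tangentStructure hsm hu ξ η).trans ?_
    have h1 : ∀ a b : E × E, oneFormDeriv (vertDiff F) u (0, a.1) b -
        oneFormDeriv (vertDiff F) u (0, b.1) a = 0 := fun a b ↦ by
      rw [oneFormDeriv_vertDiff h.smooth hu, oneFormDeriv_vertDiff h.smooth hu,
        chartD2_symm h.smooth hu, sub_self]
    exact h1 ξ η
  · refine (hb.derivAlongOneForm_horizontalProjector hS hu ξ η).trans ?_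
    -- Expanded in second derivatives of F, the terms without h cancel and D²F(hξ, Jη) - D²F(hη, Jξ)
    -- remains, which vanishes by isotropy of the horizontal spaces.
    have h1 : ∀ a b : E × E, extDerivCoord (vertDiff F) u (a.1, sprayConnection S u a.1) b +
        extDerivCoord (vertDiff F) u a (b.1, sprayConnection S u b.1) -
          extDerivCoord (vertDiff F) u a b = 0 := fun a b ↦ by
      have h2 := h.chartD2_horizontal_symm hS hX hu b.1 a.1
      simp only [extDerivCoord_vertDiff h.smooth hu]
      linarith
    exact h1 ξ η

end FunctionToForm

end

theorem mainTheorem1 (n : ℕ) (M : Type*) [TopologicalSpace M] [T2Space M]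
    [ChartedSpace (EuclideanSpace ℝ (Fin n)) M] [IsManifold (𝓡 n) ∞ M]
    (S : ∀ u : TangentBundle (𝓡 n) M, TangentSpace (𝓡 n).tangent u) (hS : IsSpray (𝓡 n) S) :
    (IsProjectivelyMetrizable (𝓡 n) S ↔
      ∃ θ : ∀ u : TangentBundle (𝓡 n) M, TangentSpace (𝓡 n).tangent u →L[ℝ] ℝ,
        ProjectiveMetrizabilityConditions (𝓡 n) S θ) ∧
    ∀ θ : ∀ u : TangentBundle (𝓡 n) M, TangentSpace (𝓡 n).tangent u →L[ℝ] ℝ,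
      ProjectiveMetrizabilityConditions (𝓡 n) S θ →
        ∃ F : TangentBundle (𝓡 n) M → ℝ,
          IsFinsler (𝓡 n) F ∧ IsProjectivelyMetrizedBy (𝓡 n) S F ∧
          ∀ u ∈ slashedTangentBundle (𝓡 n) M,
            F u = θ u (S u) ∧
            θ u = derivAlongFun (𝓡 n).tangent (tangentStructure (𝓡 n)) F u := by
  refine ⟨⟨?_, ?_⟩, fun θ hθ ↦ ?_⟩
  -- The form is d_JF; geodesics of the geodesic spray, reparametrized into geodesics of S, transfer
  -- i_X dd_JF = 0 from that spray to S.
  · rintro ⟨F, hF, SF, hG, hP⟩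
    exact ⟨vertDiff F, hF.projectiveMetrizabilityConditions hG hS hP.2⟩
  · rintro ⟨θ, hθ⟩
    exact ⟨contractionWithSpray S θ, hθ.isFinsler hS, hθ.isProjectivelyMetrizedBy hS⟩
  · exact ⟨contractionWithSpray S θ, hθ.isFinsler hS, hθ.isProjectivelyMetrizedBy hS,
      fun u hu ↦ ⟨contractionWithSpray_apply hu, hθ.vertDiff_eq hS hu⟩⟩
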